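/- **Setting.** Let $(X,Y)$ be a random pair with values in $\mathbb{R}^d\times\mathbb{R}$ such that $\mathbb{E}\|X\|^2<\infty$, $\mathbb{E}|Y|<\infty$, $\mathbb{E}\|XY\|<\infty$ and $\Sigma:=\mathbb{E}[XX^\top]$ is invertible. Put $\beta:=\Sigma^{-1}\mathbb{E}[XY]$, $b(X):=\mathbb{E}[Y\mid X]-X^\top\beta$ (approximation error) and $\eta(X):=Y-\mathbb{E}[Y\mid X]$ (noise). Let $(X_1,Y_1),\dots,(X_n,Y_n)$ be independent copies of $(X,Y)$; for a quantity depending on $(X,Y)$, $\hat{\mathbb{E}}[\cdot]$ denotes the average of its values at the $n$ observations. Put $\hat\Sigma:=\hat{\mathbb{E}}[XX^\top]$ and, when $\hat\Sigma$ is invertible, $\hat\beta_{\mathrm{ols}}:=\hat\Sigma^{-1}\hat{\mathbb{E}}[XY]$. Here $\|\cdot\|$ is the Euclidean norm of a vector and the spectral norm of a matrix, and $\|x\|_\Sigma:=\sqrt{x^\top\Sigma x}$. **Conditions.** * (N) Subgaussian noise: $\sigma\ge 0$ and, for every $\lambda\in\mathbb{R}$, $\mathbb{E}[\exp(\lambda\eta(X))\mid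 X]\le\exp(\lambda^2\sigma^2/2)$ almost surely. * (A) Bounded approximation error: $B\ge 0$ and $\|\Sigma^{-1/2}Xb(X)\|\le B\sqrt d$ almost surely. * (C1) Subgaussian projections: $\rho_1\ge 1$ and $\mathbb{E}[\exp(\alpha^\top\Sigma^{-1/2}X)]\le\exp(\rho_1\|\alpha\|^2/2)$ for all $\alpha\in\mathbb{R}^d$. * (C2) Bounded statistical leverage: $\rho_2\ge 1$ and $\|\Sigma^{-1/2}X\|/\sqrt d\le\rho_2$ almost surely. For $\delta\in(0,1)$ let $$n_{1,\delta}:=70\rho_1^2\bigl(d\log 41+\log(2/\delta)\bigr),\qquad n_{2,\delta}:=4\rho_2^2\,d\log(d/\delta),$$ $$K_{1,\delta,n}:=\frac{1}{1-\frac{10\rho_1}{9}\Bigl(\sqrt{\frac{32(d\log 41+\log(2/\delta))}{n}}+\frac{2(d\log 41+\log(2/\delta))}{n}\Bigr)},\qquad K_{2,\delta,n}:=\frac{1}{1-\sqrt{\frac{2\rho_2^2d\log(d/\delta)}{n}}}.$$ **Theorem (misspecified model).** Fix $\delta\in(0,1)$ and suppose that (N), (A) and (C1) hold. If $n>n_{1,\delta}$,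 then, with $K:=K_{1,\delta,n}$, we have $K\le 5$, and with probability at least $1-3\delta$ the matrix $\hat\Sigma$ is positive definite and all of the following hold: * (Matrix errors) $\|\Sigma^{1/2}\hat\Sigma^{-1}\Sigma^{1/2}\|\le K$. * (Approximation error contribution) $$\bigl\|\hat{\mathbb{E}}[\hat\Sigma^{-1}Xb(X)]\bigr\|_\Sigma^2\le K^2\left(\frac{4\,\mathbb{E}\bigl[\|\Sigma^{-1/2}Xb(X)\|^2\bigr]\bigl(1+8\log(1/\delta)\bigr)}{n}+\frac{3B^2d\log^2(1/\delta)}{n^2}\right).$$ * (Noise contribution) $$\bigl\|\hat{\mathbb{E}}[\hat\Sigma^{-1}X\eta(X)]\bigr\|_\Sigma^2\le K\cdot\frac{\sigma^2\bigl(d+2\sqrt{d\log(1/\delta)}+2\log(1/\delta)\bigr)}{n}.$$ * (Excess loss) $$\|\hat\beta_{\mathrm{ols}}-\beta\|_\Sigma\le\bigl\|\hat{\mathbb{E}}[\hat\Sigma^{-1}Xb(X)]\bigr\|_\Sigma+\bigl\|\hat{\mathbb{E}}[\hat\Sigma^{-1}X\eta(X)]\bigr\|_\Sigma,$$ $$\|\hat\beta_{\mathrm{ols}}-\beta\|_\Sigma^2\le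 2\bigl\|\hat{\mathbb{E}}[\hat\Sigma^{-1}Xb(X)]\bigr\|_\Sigma^2+2\bigl\|\hat{\mathbb{E}}[\hat\Sigma^{-1}X\eta(X)]\bigr\|_\Sigma^2.$$ If instead (N), (A) and (C2) hold and $n>n_{2,\delta}$, then the same conclusions hold with $K:=K_{2,\delta,n}$. -/

import Mathlib

open MeasureTheory ProbabilityTheory
open scoped MatrixOrder

namespace RandomDesign

noncomputable section

/-- The spectral norm of a matrix: the operator norm for the Euclidean norm. -/
def specNorm {d : ℕ} (M : Matrix (Fin d) (Fin d) ℝ) : ℝ :=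
  ‖Matrix.toEuclideanCLM (n := Fin d) (𝕜 := ℝ) M‖

/-- The norm `‖x‖_M = √(xᵀ M x)` of a positive semidefinite matrix `M`. -/
def matNorm {d : ℕ} (M : Matrix (Fin d) (Fin d) ℝ) (x : EuclideanSpace ℝ (Fin d)) : ℝ :=
  √(inner ℝ x (Matrix.toEuclideanLin M x))

/-- `M ^ (1/2)`, the positive semidefinite square root of a positive semidefinite matrix. -/
def halfPow {d : ℕ} (M : Matrix (Fin d) (Fin d) ℝ) : Matrix (Fin d) (Fin d) ℝ :=
  CFC.sqrt M

/-- `M ^ (-1/2)`. -/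
def negHalfPow {d : ℕ} (M : Matrix (Fin d) (Fin d) ℝ) : Matrix (Fin d) (Fin d) ℝ :=
  (halfPow M)⁻¹

section Population

variable {Ω : Type*} [MeasurableSpace Ω] {d : ℕ}

/-- `Σ = E[X Xᵀ]`. -/
def secondMoment (μ : Measure Ω) (X : Ω → EuclideanSpace ℝ (Fin d)) :
    Matrix (Fin d) (Fin d) ℝ :=
  Matrix.of fun i j => ∫ ω, X ω i * X ω j ∂μ

/-- `β = Σ⁻¹ E[X Y]`. -/
def popCoef (μ : Measure Ω) (X : Ω → EuclideanSpace ℝ (Fin d)) (Y : Ω → ℝ) :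
    EuclideanSpace ℝ (Fin d) :=
  Matrix.toEuclideanLin (secondMoment μ X)⁻¹ (∫ ω, Y ω • X ω ∂μ)

/-- The regression function `x ↦ E[Y | X = x]`, the mean of the regular conditional distribution
of `Y` given `X = x`. -/
def regression (μ : Measure Ω) [IsFiniteMeasure μ] (X : Ω → EuclideanSpace ℝ (Fin d))
    (Y : Ω → ℝ) (x : EuclideanSpace ℝ (Fin d)) : ℝ :=
  ∫ y, y ∂(condDistrib Y X μ x)

theorem regression_comp_ae_eq_condExp (μ : Measure Ω) [IsFiniteMeasure μ]
    {X : Ω → EuclideanSpace ℝ (Fin d)} {Y : Ω → ℝ} (hX : Measurable X) (hY : Integrable Y μ) :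
    (fun ω => regression μ X Y (X ω)) =ᵐ[μ] μ[Y | MeasurableSpace.comap X inferInstance] :=
  (condExp_ae_eq_integral_condDistrib' hX hY).symm

/-- The approximation error `b(x) = E[Y | X = x] - xᵀ β`. -/
def approxErr (μ : Measure Ω) [IsFiniteMeasure μ] (X : Ω → EuclideanSpace ℝ (Fin d))
    (Y : Ω → ℝ) (x : EuclideanSpace ℝ (Fin d)) : ℝ :=
  regression μ X Y x - inner ℝ x (popCoef μ X Y)

/-- The response noise `y - E[Y | X = x]` of an observation `(x, y)`. -/
def noise (μ : Measure Ω) [IsFiniteMeasure μ] (X : Ω → EuclideanSpace ℝ (Fin d))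
    (Y : Ω → ℝ) (x : EuclideanSpace ℝ (Fin d)) (y : ℝ) : ℝ :=
  y - regression μ X Y x

/-- The whitened vector `Σ^(-1/2) X b(X)` at a covariate `x`. -/
def whitenedApprox (μ : Measure Ω) [IsFiniteMeasure μ] (X : Ω → EuclideanSpace ℝ (Fin d))
    (Y : Ω → ℝ) (x : EuclideanSpace ℝ (Fin d)) : EuclideanSpace ℝ (Fin d) :=
  Matrix.toEuclideanLin (negHalfPow (secondMoment μ X)) (approxErr μ X Y x • x)

/-- Subgaussian noise. The integrability clause only says that the conditional expectation of the
positive variable is finite, so that Mathlib's conditional expectation is the true one. -/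
def SubgaussianNoise (μ : Measure Ω) [IsFiniteMeasure μ] (X : Ω → EuclideanSpace ℝ (Fin d))
    (Y : Ω → ℝ) (σ : ℝ) : Prop :=
  0 ≤ σ ∧ ∀ l : ℝ,
    Integrable (fun ω => Real.exp (l * noise μ X Y (X ω) (Y ω))) μ ∧
    ∀ᵐ ω ∂μ,
      (μ[fun ω' => Real.exp (l * noise μ X Y (X ω') (Y ω')) |
          MeasurableSpace.comap X inferInstance]) ω
        ≤ Real.exp (l ^ 2 * σ ^ 2 / 2)

/-- Bounded approximation error: `‖Σ^(-1/2) X b(X)‖ ≤ B √d` almost surely. -/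
def BoundedApprox (μ : Measure Ω) [IsFiniteMeasure μ] (X : Ω → EuclideanSpace ℝ (Fin d))
    (Y : Ω → ℝ) (B : ℝ) : Prop :=
  0 ≤ B ∧ ∀ᵐ ω ∂μ, ‖whitenedApprox μ X Y (X ω)‖ ≤ B * √d

/-- Subgaussian projections of the whitened covariates. -/
def SubgaussianProjections (μ : Measure Ω) (X : Ω → EuclideanSpace ℝ (Fin d)) (ρ : ℝ) : Prop :=
  1 ≤ ρ ∧ ∀ α : EuclideanSpace ℝ (Fin d),
    Integrable (fun ω => Real.exp
      (inner ℝ α (Matrix.toEuclideanLin (negHalfPow (secondMoment μ X)) (X ω)))) μ ∧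
    ∫ ω, Real.exp (inner ℝ α (Matrix.toEuclideanLin (negHalfPow (secondMoment μ X)) (X ω))) ∂μ
      ≤ Real.exp (ρ * ‖α‖ ^ 2 / 2)

/-- Bounded statistical leverage. -/
def BoundedLeverage (μ : Measure Ω) (X : Ω → EuclideanSpace ℝ (Fin d)) (ρ : ℝ) : Prop :=
  1 ≤ ρ ∧ ∀ᵐ ω ∂μ,
    ‖Matrix.toEuclideanLin (negHalfPow (secondMoment μ X)) (X ω)‖ / √d ≤ ρ

end Population

section Sample

variable {n d : ℕ}

/-- The empirical mean `Ê[v] = (1/n) ∑ v_k`. -/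
def empMean (v : Fin n → EuclideanSpace ℝ (Fin d)) : EuclideanSpace ℝ (Fin d) :=
  (n : ℝ)⁻¹ • ∑ k, v k

/-- The empirical second moment matrix `Σ̂ = (1/n) ∑ x_k x_kᵀ`. -/
def empSecondMoment (x : Fin n → EuclideanSpace ℝ (Fin d)) : Matrix (Fin d) (Fin d) ℝ :=
  Matrix.of fun i j => (∑ k, x k i * x k j) / (n : ℝ)

/-- The ordinary least squares estimator `Σ̂⁻¹ Ê[X Y]`. -/
def ols (x : Fin n → EuclideanSpace ℝ (Fin d)) (y : Fin n → ℝ) : EuclideanSpace ℝ (Fin d) :=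
  Matrix.toEuclideanLin (empSecondMoment x)⁻¹ (empMean fun k => y k • x k)

/-- `Ê[Σ̂⁻¹ X u]` for scalars `u_1, …, u_n` attached to the observations. -/
def empContribution (x : Fin n → EuclideanSpace ℝ (Fin d)) (u : Fin n → ℝ) :
    EuclideanSpace ℝ (Fin d) :=
  empMean fun k => Matrix.toEuclideanLin (empSecondMoment x)⁻¹ (u k • x k)

end Sample

/-- The sample size threshold under subgaussian projections. -/
def n₁ (ρ : ℝ) (d : ℕ) (δ : ℝ) : ℝ :=
  70 * ρ ^ 2 * (d * Real.log 41 + Real.log (2 / δ))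

/-- The sample size threshold under bounded statistical leverage. -/
def n₂ (ρ : ℝ) (d : ℕ) (δ : ℝ) : ℝ :=
  4 * ρ ^ 2 * d * Real.log (d / δ)

def K₁ (ρ : ℝ) (d : ℕ) (δ : ℝ) (n : ℕ) : ℝ :=
  1 / (1 - 10 * ρ / 9 *
    (√(32 * (d * Real.log 41 + Real.log (2 / δ)) / n)
      + 2 * (d * Real.log 41 + Real.log (2 / δ)) / n))

def K₂ (ρ : ℝ) (d : ℕ) (δ : ℝ) (n : ℕ) : ℝ :=
  1 / (1 - √(2 * ρ ^ 2 * d * Real.log (d / δ) / n))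

/-- The bounds for one realization `(x_1, y_1), …, (x_n, y_n)` of the sample, with factor `K`:
`Σ̂` is positive definite, the matrix error, the approximation error contribution, the noise
contribution, and the two forms of the excess loss bound. -/
def SampleBounds {Ω : Type*} [MeasurableSpace Ω] {n d : ℕ} (μ : Measure Ω) [IsFiniteMeasure μ]
    (X : Ω → EuclideanSpace ℝ (Fin d)) (Y : Ω → ℝ) (σ B δ K : ℝ)
    (x : Fin n → EuclideanSpace ℝ (Fin d)) (y : Fin n → ℝ) : Prop :=
  let S := secondMoment μ X
  let approx := matNorm S (empContribution x fun k => approxErr μ X Y (x k))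
  let noiseC := matNorm S (empContribution x fun k => noise μ X Y (x k) (y k))
  let excess := matNorm S (ols x y - popCoef μ X Y)
  (empSecondMoment x).PosDef ∧
  specNorm (halfPow S * (empSecondMoment x)⁻¹ * halfPow S) ≤ K ∧
  approx ^ 2 ≤ K ^ 2 *
    (4 * (∫ ω, ‖whitenedApprox μ X Y (X ω)‖ ^ 2 ∂μ) * (1 + 8 * Real.log (1 / δ)) / n
      + 3 * B ^ 2 * d * Real.log (1 / δ) ^ 2 / (n : ℝ) ^ 2) ∧
  noiseC ^ 2 ≤ K *
    (σ ^ 2 * (d + 2 * √(d * Real.log (1 / δ)) + 2 * Real.log (1 / δ)) / n) ∧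
  excess ≤ approx + noiseC ∧
  excess ^ 2 ≤ 2 * approx ^ 2 + 2 * noiseC ^ 2

end

end RandomDesign

open RandomDesign

namespace RandomDesign

/-! ### Integration over finite products -/

section Pi

variable {α : Type*} [MeasurableSpace α] (ν : Measure α) [IsProbabilityMeasure ν]

/-! Everything reduces to one number: the smallest eigenvalue of the whitened empirical matrix
`Σ^(-1/2) Σ̂ Σ^(-1/2)`. If it is at least `κ = 1/K`, then `Σ̂` is positive definite and all the
remaining claims follow deterministically from two further inequalities
(`sampleBounds_of_whitenedLowerBound`): a bound on `‖∑ Σ^(-1/2) X_k b(X_k)‖²` and a bound on `ηᵀ H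
η`, where `H` is the hat matrix of the sample. Each of the three inequalities fails with probability
at most `δ`, and a union bound gives `1 - 3δ`.

Noise. `H` is a projection of rank at most `d` determined by the covariates. Writing `exp (l ηᵀHη)`
as a Gaussian average of exponentials linear in `η` allows the conditionally subgaussian noise to be
integrated out. What remains is `σ²` times the same quadratic form in a Gaussian vector, so the
exponential moments are those of a scaled chi-squared variable with `d` degrees of freedom
(`SubgaussianNoise.lintegral_exp_hatMatrix_le`).

Approximation error. The vectors `Σ^(-1/2) X b(X)` are centred and bounded. The potential `cosh
(θ‖S‖)` of their partial sums `S` grows in mean by at most a factor `exp (θ² v)` per summand, `v`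
being the second moment (`lintegral_cosh_norm_add_le`). This yields a dimension-free Bernstein
inequality, combined with Chebyshev's inequality for small deviations (`measure_norm_sum_sq_le`).

Smallest eigenvalue, bounded leverage. The potential is `tr exp (-θ S)`, `S` being the sum of the
first rank-one operators. Instead of the general Golden–Thompson or Lieb theorems, only a rank-one
trace inequality is needed (`trace_exp_le_of_isPositive`); it is obtained by comparing power series
term by term and by integrating a differential inequality in discrete steps. Isotropy then makes the
potential shrink by a fixed factor per summand.

Smallest eigenvalue, subgaussian projections. For a fixed direction the centred squares are
sub-gamma (`lintegral_exp_sq_sub_one_le`); a net of at most `41^d` points on the unit sphere covers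
all directions (`abs_inner_le_of_net`). -/

theorem lintegral_pi_succ {n : ℕ} {F : (Fin (n + 1) → α) → ENNReal} (hF : Measurable F) :
    ∫⁻ z, F z ∂Measure.pi (fun _ => ν) =
      ∫⁻ a, ∫⁻ z, F (Fin.cons a z) ∂Measure.pi (fun _ : Fin n => ν) ∂ν := by
  have h := (measurePreserving_piFinSuccAbove (fun _ : Fin (n + 1) => ν) 0).symm
  rw [← h.lintegral_comp hF, lintegral_prod]
  · simp [MeasurableEquiv.piFinSuccAbove, Fin.insertNthEquiv]
  · exact (hF.comp (MeasurableEquiv.measurable _)).aemeasurable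

theorem lintegral_pi_prod {n : ℕ} {f : Fin n → α → ENNReal} (hf : ∀ k, Measurable (f k)) :
    ∫⁻ z, ∏ k, f k (z k) ∂Measure.pi (fun _ => ν) = ∏ k, ∫⁻ a, f k a ∂ν := by
  induction n with
  | zero => simp
  | succ n ih =>
    rw [lintegral_pi_succ ν (by fun_prop)]
    simp only [Fin.prod_univ_succ, Fin.cons_zero, Fin.cons_succ]
    have h1 : ∀ a, ∫⁻ z, f 0 a * ∏ k : Fin n, f k.succ (z k) ∂Measure.pi (fun _ => ν) =
        f 0 a * ∏ k : Fin n, ∫⁻ a, f k.succ a ∂ν := fun a => by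
      rw [lintegral_const_mul _ (by fun_prop), ih fun k => hf k.succ]
    simp only [h1]
    rw [lintegral_mul_const _ (hf 0)]

/-- If the mean of `Φ k` after adding an increment `f z` is at most `Φ (k + 1)`, then the mean of
`Φ 0` after adding `n` independent increments is at most `Φ n`. -/
theorem lintegral_potential_sum_le {V : Type*} [AddCommMonoid V] [MeasurableSpace V]
    [MeasurableAdd₂ V] {p : V → Prop} {Φ : ℕ → V → ENNReal} (hΦ : ∀ k, Measurable (Φ k)) {f : α → V}
    (hf : Measurable f) (hp : ∀ s a, p s → p (s + f a))
    (h : ∀ k s, p s → ∫⁻ a, Φ k (s + f a) ∂ν ≤ Φ (k + 1) s) (n : ℕ) {s : V} (hs : p s) :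
    ∫⁻ z, Φ 0 (s + ∑ k : Fin n, f (z k)) ∂Measure.pi (fun _ => ν) ≤ Φ n s := by
  induction n generalizing s with
  | zero => simp
  | succ n ih =>
    rw [lintegral_pi_succ ν (by fun_prop)]
    refine (lintegral_mono fun a => ?_).trans (h n s hs)
    simpa [Fin.sum_univ_succ, add_assoc] using ih (hp s a hs)

/-- Integrating out the coordinate `j` preserves an inequality between iterated integrals. -/
theorem lintegral_pi_mono_coord {n : ℕ} (j : Fin n) {F G : (Fin n → α) → ENNReal}
    (hF : Measurable F) (hG : Measurable G)
    (h : ∀ z, ∫⁻ a, F (Function.update z j a) ∂ν ≤ ∫⁻ a, G (Function.update z j a) ∂ν) :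
    ∫⁻ z, F z ∂Measure.pi (fun _ => ν) ≤ ∫⁻ z, G z ∂Measure.pi (fun _ => ν) := by
  refine lintegral_le_of_lmarginal_le {j} hF hG fun z => ?_
  simpa [lmarginal_singleton] using h z

end Pi

/-! ### Chernoff bounds -/

theorem measure_lt_le_of_lintegral_exp_le {α : Type*} [MeasurableSpace α] {ν : Measure α}
    {W : α → ℝ} (hW : Measurable W) {s a b : ℝ} (hs : 0 ≤ s)
    (h : ∫⁻ z, ENNReal.ofReal (Real.exp (s * W z)) ∂ν ≤ ENNReal.ofReal (Real.exp b)) :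
    ν {z | a < W z} ≤ ENNReal.ofReal (Real.exp (b - s * a)) := by
  have hm := mul_meas_ge_le_lintegral₀ (μ := ν)
    (f := fun z => ENNReal.ofReal (Real.exp (s * W z))) (by fun_prop)
    (ENNReal.ofReal (Real.exp (s * a)))
  have hsub : {z | a < W z} ⊆ {z | ENNReal.ofReal (Real.exp (s * a)) ≤
      ENNReal.ofReal (Real.exp (s * W z))} := fun z hz =>
    ENNReal.ofReal_le_ofReal (Real.exp_le_exp.2 (mul_le_mul_of_nonneg_left (le_of_lt hz) hs))
  have hpos : ENNReal.ofReal (Real.exp (s * a)) ≠ 0 := by simp [Real.exp_pos]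
  rw [Real.exp_sub, ENNReal.ofReal_div_of_pos (Real.exp_pos _),
    ENNReal.le_div_iff_mul_le (Or.inl hpos) (Or.inl ENNReal.ofReal_ne_top), mul_comm]
  exact (mul_le_mul_right (measure_mono hsub) _).trans (hm.trans h)

/-- The tail of a sub-gamma variable with variance factor `2D` and scale `2`. -/
theorem measure_lt_le_of_subgamma {α : Type*} [MeasurableSpace α] {ν : Measure α}
    {W : α → ℝ} (hW : Measurable W) {D t : ℝ} (hD : 0 < D) (ht : 0 ≤ t)
    (h : ∀ s, 0 ≤ s → s < 1 / 2 → ∫⁻ z, ENNReal.ofReal (Real.exp (s * W z)) ∂ν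
      ≤ ENNReal.ofReal (Real.exp (D * s ^ 2 / (1 - 2 * s)))) :
    ν {z | 2 * √(D * t) + 2 * t < W z} ≤ ENNReal.ofReal (Real.exp (-t)) := by
  have ha : 0 < √D := Real.sqrt_pos.2 hD
  have hu : 0 ≤ √t := Real.sqrt_nonneg t
  have hDa : √D ^ 2 = D := Real.sq_sqrt hD.le
  have htu : √t ^ 2 = t := Real.sq_sqrt ht
  have hpos : 0 < √D + 2 * √t := by positivity
  -- This `s` minimises the Chernoff exponent, which then equals exactly `-t`.
  have hs : √t / (√D + 2 * √t) < 1 / 2 := by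
    rw [div_lt_div_iff₀ hpos two_pos]; linarith
  have key := measure_lt_le_of_lintegral_exp_le hW (a := 2 * √(D * t) + 2 * t)
    (by positivity) (h (√t / (√D + 2 * √t)) (by positivity) hs)
  convert key using 3
  rw [Real.sqrt_mul hD.le]
  have h1 : 1 - 2 * (√t / (√D + 2 * √t)) = √D / (√D + 2 * √t) := by field_simp; ring
  rw [h1]
  generalize √D = a at *
  generalize √t = u at *
  subst hDa htu
  field_simp
  ring

/-! ### Gaussian integrals -/

theorem lintegral_exp_mul_gaussian (a : ℝ) :
    ∫⁻ g, ENNReal.ofReal (Real.exp (a * g)) ∂gaussianReal 0 1 =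
      ENNReal.ofReal (Real.exp (a ^ 2 / 2)) := by
  rw [← ofReal_integral_eq_lintegral_ofReal (integrable_exp_mul_gaussianReal a)
    (Filter.Eventually.of_forall fun _ => (Real.exp_pos _).le)]
  have := mgf_gaussianReal (p := gaussianReal 0 1) (X := id) (μ := 0) (v := 1) (by simp) a
  simp only [mgf, id] at this
  rw [this]; simp

theorem lintegral_exp_mul_sq_gaussian {s : ℝ} (hs : s < 1 / 2) :
    ∫⁻ g, ENNReal.ofReal (Real.exp (s * g ^ 2)) ∂gaussianReal 0 1 =
      ENNReal.ofReal (√(1 - 2 * s)⁻¹) := by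
  rw [gaussianReal_of_var_ne_zero _ one_ne_zero,
    lintegral_withDensity_eq_lintegral_mul _ (measurable_gaussianPDF 0 1) (by fun_prop)]
  have h1 : ∀ g : ℝ, (gaussianPDF 0 1 * fun g => ENNReal.ofReal (Real.exp (s * g ^ 2))) g =
      ENNReal.ofReal ((√(2 * Real.pi))⁻¹ * Real.exp (-(1 / 2 - s) * g ^ 2)) := fun g => by
    rw [Pi.mul_apply, gaussianPDF, gaussianPDFReal, ← ENNReal.ofReal_mul (by positivity),
      mul_assoc, ← Real.exp_add]
    congr 2
    · simp
    · congr 1; simp; ring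
  simp only [h1]
  rw [← ofReal_integral_eq_lintegral_ofReal
    ((integrable_exp_neg_mul_sq (by linarith)).const_mul _)
    (Filter.Eventually.of_forall fun _ => by positivity), integral_const_mul, integral_gaussian,
    ← Real.sqrt_inv, ← Real.sqrt_mul (by positivity)]
  have := Real.pi_pos
  have h2 : 1 / 2 - s ≠ 0 := by linarith
  have h3 : 1 - 2 * s ≠ 0 := by linarith
  congr 2
  field_simp

/-- With `y = 1 / (1 - 2s)` the exponent on the right is `sinh (log y) / 2` and the left side is
`exp (log y / 2)`, so this is `x ≤ sinh x` at `x = log y`. -/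
theorem sqrt_inv_one_sub_le_exp {s : ℝ} (h0 : 0 ≤ s) (hs : s < 1 / 2) :
    √(1 - 2 * s)⁻¹ ≤ Real.exp (s + s ^ 2 / (1 - 2 * s)) := by
  have hx : 0 < 1 - 2 * s := by linarith
  set y := (1 - 2 * s)⁻¹ with hy
  have hy1 : 1 ≤ y := (one_le_inv₀ hx).2 (by linarith)
  have hy0 : 0 < y := by linarith
  have h := Real.self_le_sinh_iff.2 (Real.log_nonneg hy1)
  rw [Real.sinh_log hy0] at h
  rw [← Real.exp_log hy0, Real.sqrt_eq_rpow, ← Real.exp_mul]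
  refine Real.exp_le_exp.2 ?_
  have h2 : s + s ^ 2 / (1 - 2 * s) = (y - y⁻¹) / 2 / 2 := by
    have hx' : 1 - 2 * s = y⁻¹ := by rw [hy, inv_inv]
    have hs' : s = (1 - y⁻¹) / 2 := by linarith
    rw [hx', hs']; field_simp; ring
  rw [h2]; linarith

theorem lintegral_exp_sum_mul_gaussian {m : ℕ} (a : Fin m → ℝ) :
    ∫⁻ g, ENNReal.ofReal (Real.exp (∑ k, a k * g k)) ∂Measure.pi (fun _ => gaussianReal 0 1) =
      ENNReal.ofReal (Real.exp ((∑ k, a k ^ 2) / 2)) := by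
  have h : ∀ g : Fin m → ℝ, ENNReal.ofReal (Real.exp (∑ k, a k * g k)) =
      ∏ k, ENNReal.ofReal (Real.exp (a k * g k)) := fun g => by
    rw [Real.exp_sum, ENNReal.ofReal_prod_of_nonneg fun _ _ => (Real.exp_pos _).le]
  simp only [h]
  rw [lintegral_pi_prod (gaussianReal 0 1) (f := fun k g => ENNReal.ofReal (Real.exp (a k * g)))
    (fun k => by fun_prop)]
  simp only [lintegral_exp_mul_gaussian]
  rw [← ENNReal.ofReal_prod_of_nonneg fun _ _ => (Real.exp_pos _).le, ← Real.exp_sum,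
    Finset.sum_div]

theorem lintegral_exp_mul_sum_sq_gaussian_le {m : ℕ} {s : ℝ} (h0 : 0 ≤ s) (hs : s < 1 / 2) :
    ∫⁻ g, ENNReal.ofReal (Real.exp (s * ∑ k, g k ^ 2))
        ∂Measure.pi (fun _ : Fin m => gaussianReal 0 1) ≤
      ENNReal.ofReal (Real.exp (m * (s + s ^ 2 / (1 - 2 * s)))) := by
  have h : ∀ g : Fin m → ℝ, ENNReal.ofReal (Real.exp (s * ∑ k, g k ^ 2)) =
      ∏ k, ENNReal.ofReal (Real.exp (s * g k ^ 2)) := fun g => by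
    rw [Finset.mul_sum, Real.exp_sum, ENNReal.ofReal_prod_of_nonneg fun _ _ => (Real.exp_pos _).le]
  simp only [h]
  rw [lintegral_pi_prod (gaussianReal 0 1) (f := fun _ g => ENNReal.ofReal (Real.exp (s * g ^ 2)))
    (fun k => by fun_prop)]
  simp only [lintegral_exp_mul_sq_gaussian hs, Finset.prod_const, Finset.card_univ,
    Fintype.card_fin]
  rw [Real.exp_nat_mul, ENNReal.ofReal_pow (Real.exp_pos _).le]
  gcongr
  exact sqrt_inv_one_sub_le_exp h0 hs

/-! ### Conditionally subgaussian noise -/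

section Noise

variable {Ω : Type*} [MeasurableSpace Ω] {d n : ℕ}

theorem measurable_regression (μ : Measure Ω) [IsFiniteMeasure μ]
    (X : Ω → EuclideanSpace ℝ (Fin d)) (Y : Ω → ℝ) : Measurable (regression μ X Y) :=
  (StronglyMeasurable.integral_condDistrib (X := X) (Y := Y) (μ := μ)
    (f := fun p : EuclideanSpace ℝ (Fin d) × ℝ => p.2)
    measurable_snd.stronglyMeasurable).measurable

/-- The regular conditional distribution of subgaussian noise has a subgaussian moment generating
function, simultaneously at all points. -/
theorem SubgaussianNoise.ae_lintegral_condDistrib_le {μ : Measure Ω} [IsProbabilityMeasure μ]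
    {X : Ω → EuclideanSpace ℝ (Fin d)} {Y : Ω → ℝ} (hX : Measurable X) (hY : Measurable Y) {σ : ℝ}
    (h : SubgaussianNoise μ X Y σ) :
    ∀ᵐ x ∂(μ.map X), ∀ l : ℝ,
      ∫⁻ y, ENNReal.ofReal (Real.exp (l * (y - regression μ X Y x))) ∂(condDistrib Y X μ x) ≤
        ENNReal.ofReal (Real.exp (σ ^ 2 * l ^ 2 / 2)) := by
  have hr := measurable_regression μ X Y
  -- Only countably many null sets can be discarded, so rational parameters come first; Fatou's
  -- lemma along rationals tending to `l` then gives every real parameter.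
  have hq : ∀ᵐ x ∂(μ.map X), ∀ q : ℚ,
      ∫⁻ y, ENNReal.ofReal (Real.exp (q * (y - regression μ X Y x))) ∂(condDistrib Y X μ x) ≤
        ENNReal.ofReal (Real.exp (σ ^ 2 * q ^ 2 / 2)) := by
    rw [ae_all_iff]
    intro q
    set f : EuclideanSpace ℝ (Fin d) × ℝ → ℝ :=
      fun p => Real.exp (q * (p.2 - regression μ X Y p.1)) with hf
    have hfm : StronglyMeasurable f := by
      apply Measurable.stronglyMeasurable; fun_prop
    obtain ⟨hInt, hle⟩ := h.2 q
    have hInt' : Integrable f (μ.map fun ω => (X ω, Y ω)) := by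
      rw [integrable_map_measure hfm.aestronglyMeasurable (hX.prodMk hY).aemeasurable]
      exact hInt
    have h1 := condExp_prod_ae_eq_integral_condDistrib' (μ := μ) hX hY.aemeasurable hInt'
    have h2 : ∀ᵐ ω ∂μ, ∫ y, f (X ω, y) ∂(condDistrib Y X μ (X ω)) ≤
        Real.exp (σ ^ 2 * q ^ 2 / 2) := by
      filter_upwards [h1, hle] with ω h1 hle
      rw [← h1]
      exact hle.trans_eq (by ring_nf)
    have h3 : ∀ᵐ x ∂(μ.map X), ∫ y, f (x, y) ∂(condDistrib Y X μ x) ≤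
        Real.exp (σ ^ 2 * q ^ 2 / 2) := by
      rw [ae_map_iff hX.aemeasurable]
      · exact h2
      · exact measurableSet_le hfm.integral_condDistrib.measurable measurable_const
    filter_upwards [h3, hInt'.condDistrib_ae_map hY.aemeasurable] with x h3 h4
    rw [← ofReal_integral_eq_lintegral_ofReal h4
      (Filter.Eventually.of_forall fun _ => (Real.exp_pos _).le)]
    exact ENNReal.ofReal_le_ofReal h3
  filter_upwards [hq] with x hx l
  obtain ⟨u, hu⟩ : ∃ u : ℕ → ℚ, Filter.Tendsto (fun k => (u k : ℝ)) Filter.atTop (nhds l) := by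
    obtain ⟨u, hu, hl⟩ := mem_closure_iff_seq_limit.1 (Rat.isDenseEmbedding_coe_real.dense l)
    choose v hv using hu
    exact ⟨v, by simpa [hv] using hl⟩
  have hlim : ∀ y : ℝ, Filter.liminf (fun k =>
      ENNReal.ofReal (Real.exp (u k * (y - regression μ X Y x)))) Filter.atTop =
        ENNReal.ofReal (Real.exp (l * (y - regression μ X Y x))) := fun y => by
    refine Filter.Tendsto.liminf_eq (ENNReal.tendsto_ofReal ?_)
    exact (Real.continuous_exp.tendsto _).comp (hu.mul_const _)
  have hlim' : Filter.liminf (fun k => ENNReal.ofReal (Real.exp (σ ^ 2 * (u k : ℝ) ^ 2 / 2)))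
      Filter.atTop = ENNReal.ofReal (Real.exp (σ ^ 2 * l ^ 2 / 2)) := by
    refine Filter.Tendsto.liminf_eq (ENNReal.tendsto_ofReal ?_)
    exact (Real.continuous_exp.tendsto _).comp (((hu.pow 2).const_mul _).div_const _)
  simp only [← hlim, ← hlim']
  refine (lintegral_liminf_le fun k => by fun_prop).trans ?_
  exact Filter.liminf_le_liminf (Filter.Eventually.of_forall fun k => hx (u k))

theorem SubgaussianNoise.lintegral_mul_exp_le {μ : Measure Ω} [IsProbabilityMeasure μ]
    {X : Ω → EuclideanSpace ℝ (Fin d)} {Y : Ω → ℝ} (hX : Measurable X) (hY : Measurable Y) {σ : ℝ}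
    (h : SubgaussianNoise μ X Y σ) {F : EuclideanSpace ℝ (Fin d) → ENNReal} (hF : Measurable F)
    {a : EuclideanSpace ℝ (Fin d) → ℝ} (ha : Measurable a) :
    ∫⁻ p, F p.1 * ENNReal.ofReal (Real.exp (a p.1 * noise μ X Y p.1 p.2))
        ∂(μ.map fun ω => (X ω, Y ω)) ≤
      ∫⁻ p, F p.1 * ENNReal.ofReal (Real.exp (σ ^ 2 * a p.1 ^ 2 / 2))
        ∂(μ.map fun ω => (X ω, Y ω)) := by
  have hr := measurable_regression μ X Y
  have hm : Measurable fun p : EuclideanSpace ℝ (Fin d) × ℝ =>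
      F p.1 * ENNReal.ofReal (Real.exp (a p.1 * noise μ X Y p.1 p.2)) := by
    unfold noise; fun_prop
  rw [← compProd_map_condDistrib hY.aemeasurable, Measure.lintegral_compProd hm,
    Measure.lintegral_compProd (by fun_prop)]
  refine lintegral_mono_ae ?_
  filter_upwards [h.ae_lintegral_condDistrib_le hX hY] with x hx
  rw [lintegral_const_mul _ (by unfold noise; fun_prop), lintegral_const, measure_univ, mul_one]
  gcongr
  exact hx (a x)

/-- Integrating out the noise of a sample, with weights depending on the covariates. -/
theorem SubgaussianNoise.lintegral_exp_sum_le {μ : Measure Ω} [IsProbabilityMeasure μ]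
    {X : Ω → EuclideanSpace ℝ (Fin d)} {Y : Ω → ℝ} (hX : Measurable X) (hY : Measurable Y) {σ : ℝ}
    (h : SubgaussianNoise μ X Y σ) {a : Fin n → (Fin n → EuclideanSpace ℝ (Fin d)) → ℝ}
    (ha : ∀ k, Measurable (a k)) :
    ∫⁻ z, ENNReal.ofReal (Real.exp
        (∑ k, a k (fun i => (z i).1) * noise μ X Y (z k).1 (z k).2))
        ∂Measure.pi (fun _ : Fin n => μ.map fun ω => (X ω, Y ω)) ≤
      ∫⁻ z, ENNReal.ofReal (Real.exp (∑ k, σ ^ 2 * a k (fun i => (z i).1) ^ 2 / 2))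
        ∂Measure.pi (fun _ : Fin n => μ.map fun ω => (X ω, Y ω)) := by
  have hr := measurable_regression μ X Y
  have : IsProbabilityMeasure (μ.map fun ω => (X ω, Y ω)) :=
    Measure.isProbabilityMeasure_map (hX.prodMk hY).aemeasurable
  set ν := μ.map fun ω => (X ω, Y ω)
  -- A hybrid exponent: observations in `J` already carry their variance proxy, the others still
  -- carry their noise. Enlarging `J` by one observation at a time avoids the conditional law of the
  -- whole sample given its covariates.
  let T : Finset (Fin n) → Fin n → (Fin n → EuclideanSpace ℝ (Fin d) × ℝ) → ℝ := fun J k z =>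
    if k ∈ J then σ ^ 2 * a k (fun i => (z i).1) ^ 2 / 2
    else a k (fun i => (z i).1) * noise μ X Y (z k).1 (z k).2
  have hTm : ∀ J k, Measurable (T J k) := fun J k => by
    have := ha k
    by_cases hk : k ∈ J
    · simp only [T, hk, if_true]; fun_prop
    · simp only [T, hk, if_false, noise]; fun_prop
  have key : ∀ J : Finset (Fin n),
      ∫⁻ z, ENNReal.ofReal (Real.exp (∑ k, T ∅ k z)) ∂Measure.pi (fun _ => ν) ≤
      ∫⁻ z, ENNReal.ofReal (Real.exp (∑ k, T J k z)) ∂Measure.pi (fun _ => ν) := by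
    intro J
    induction J using Finset.induction_on with
    | empty => exact le_rfl
    | insert j J hj ih =>
      refine ih.trans (lintegral_pi_mono_coord ν j (by fun_prop) (by fun_prop) fun z => ?_)
      have hx : ∀ p : EuclideanSpace ℝ (Fin d) × ℝ, (fun i => (Function.update z j p i).1) =
          Function.update (fun i => (z i).1) j p.1 := fun p => by
        ext1 i; by_cases hi : i = j
        · subst hi; simp
        · simp [hi]
      -- The terms other than `j` may depend on the covariate of `j` but not on its response, so the
      -- dummy response `0` is harmless and these terms form a factor depending on the covariate
      -- alone.
      let G : EuclideanSpace ℝ (Fin d) → ENNReal := fun x => ENNReal.ofReal (Real.exp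
        (∑ k ∈ Finset.univ.erase j, T J k (Function.update z j (x, (0 : ℝ)))))
      have hG : Measurable G := by
        have : Measurable fun x : EuclideanSpace ℝ (Fin d) =>
            Function.update z j (x, (0 : ℝ)) := (measurable_update z).comp (by fun_prop)
        fun_prop
      have hA : Measurable fun x : EuclideanSpace ℝ (Fin d) =>
          a j (Function.update (fun i => (z i).1) j x) :=
        (ha j).comp (measurable_update _)
      have hsame : ∀ p : EuclideanSpace ℝ (Fin d) × ℝ, ∀ k ∈ Finset.univ.erase j,
          T J k (Function.update z j p) = T J k (Function.update z j (p.1, (0 : ℝ))) ∧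
          T (insert j J) k (Function.update z j p) =
            T J k (Function.update z j (p.1, (0 : ℝ))) := fun p k hk => by
        have hkj : k ≠ j := Finset.ne_of_mem_erase hk
        simp only [T, hx, Finset.mem_insert, hkj, false_or, Function.update_of_ne hkj, and_self]
      have hL : ∀ p : EuclideanSpace ℝ (Fin d) × ℝ,
          ENNReal.ofReal (Real.exp (∑ k, T J k (Function.update z j p))) =
          G p.1 * ENNReal.ofReal (Real.exp (a j (Function.update (fun i => (z i).1) j p.1) *
            noise μ X Y p.1 p.2)) := fun p => by
        rw [← Finset.sum_erase_add _ _ (Finset.mem_univ j), Real.exp_add,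
          ENNReal.ofReal_mul (Real.exp_pos _).le,
          Finset.sum_congr rfl fun k hk => (hsame p k hk).1]
        congr 3
        simp only [T, hj, if_false, hx, Function.update_self]
      have hR : ∀ p : EuclideanSpace ℝ (Fin d) × ℝ,
          ENNReal.ofReal (Real.exp (∑ k, T (insert j J) k (Function.update z j p))) =
          G p.1 * ENNReal.ofReal (Real.exp
            (σ ^ 2 * a j (Function.update (fun i => (z i).1) j p.1) ^ 2 / 2)) := fun p => by
        rw [← Finset.sum_erase_add _ _ (Finset.mem_univ j), Real.exp_add,
          ENNReal.ofReal_mul (Real.exp_pos _).le,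
          Finset.sum_congr rfl fun k hk => (hsame p k hk).2]
        congr 3
        simp only [T, Finset.mem_insert_self, if_true, hx]
      rw [lintegral_congr hL, lintegral_congr hR]
      clear_value G
      exact h.lintegral_mul_exp_le hX hY hG hA
  simpa [T] using key Finset.univ

end Noise

/-! ### Quadratic forms of the noise -/

section Quadratic

variable {d n : ℕ}

open Matrix

/-- The exponential moment of a quadratic form with a projection of rank `d` of a standard Gaussian
vector. -/
theorem lintegral_exp_quadratic_gaussian_le (U : Matrix (Fin n) (Fin d) ℝ) (hU : Uᵀ * U = 1) {s : ℝ}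
    (h0 : 0 ≤ s) (hs : s < 1 / 2) :
    ∫⁻ g, ENNReal.ofReal (Real.exp (s * (g ⬝ᵥ (U * Uᵀ) *ᵥ g)))
        ∂Measure.pi (fun _ : Fin n => gaussianReal 0 1) ≤
      ENNReal.ofReal (Real.exp (d * (s + s ^ 2 / (1 - 2 * s)))) := by
  have hsq : √(2 * s) ^ 2 = 2 * s := Real.sq_sqrt (by linarith)
  -- Gaussian linearisation: `exp (‖v‖² / 2)` is the mean of `exp ⟨v, h⟩`. After exchanging the two
  -- Gaussian integrals, `UᵀU = 1` leaves a function of `‖h‖²` in dimension `d` instead of `n`.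
  have h1 : ∀ g : Fin n → ℝ, ENNReal.ofReal (Real.exp (s * (g ⬝ᵥ (U * Uᵀ) *ᵥ g))) =
      ∫⁻ h, ENNReal.ofReal (Real.exp (∑ a, (√(2 * s) * (Uᵀ *ᵥ g) a) * h a))
        ∂Measure.pi (fun _ : Fin d => gaussianReal 0 1) := fun g => by
    rw [lintegral_exp_sum_mul_gaussian]
    congr 2
    simp only [mul_pow, hsq, ← Finset.mul_sum]
    rw [← mulVec_mulVec, dotProduct_mulVec, ← mulVec_transpose, dotProduct]
    simp only [← sq]
    ring
  have h2 : ∀ (g : Fin n → ℝ) (h : Fin d → ℝ), ∑ a, (√(2 * s) * (Uᵀ *ᵥ g) a) * h a =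
      ∑ k, (√(2 * s) * (U *ᵥ h) k) * g k := fun g h => by
    have : (Uᵀ *ᵥ g) ⬝ᵥ h = (U *ᵥ h) ⬝ᵥ g := by
      rw [mulVec_transpose, ← dotProduct_mulVec, dotProduct_comm]
    simp only [mul_assoc, ← Finset.mul_sum]
    exact congrArg (√(2 * s) * ·) this
  simp only [h1]
  rw [lintegral_lintegral_swap]
  · simp only [h2, lintegral_exp_sum_mul_gaussian]
    refine le_of_eq_of_le ?_ (lintegral_exp_mul_sum_sq_gaussian_le h0 hs)
    refine lintegral_congr fun h => ?_
    congr 2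
    simp only [mul_pow, hsq, ← Finset.mul_sum]
    have : (U *ᵥ h) ⬝ᵥ (U *ᵥ h) = h ⬝ᵥ h := by
      rw [dotProduct_mulVec, ← mulVec_transpose, mulVec_mulVec, hU, one_mulVec]
    simp only [dotProduct, ← sq] at this
    rw [this]; ring
  · simp only [mulVec, dotProduct]
    exact Measurable.aemeasurable (by fun_prop)

end Quadratic

section HatMatrix

variable {Ω : Type*} [MeasurableSpace Ω] {d n : ℕ}

open Matrix

/-- The design matrix, with the observations as rows. -/
def designMatrix (x : Fin n → EuclideanSpace ℝ (Fin d)) : Matrix (Fin n) (Fin d) ℝ :=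
  Matrix.of fun k i => x k i

theorem empSecondMoment_eq (x : Fin n → EuclideanSpace ℝ (Fin d)) :
    empSecondMoment x = (n : ℝ)⁻¹ • ((designMatrix x)ᵀ * designMatrix x) := by
  ext i j
  simp [empSecondMoment, designMatrix, Matrix.mul_apply, div_eq_inv_mul]

theorem posSemidef_empSecondMoment (x : Fin n → EuclideanSpace ℝ (Fin d)) :
    (empSecondMoment x).PosSemidef := by
  rw [empSecondMoment_eq]
  exact (posSemidef_conjTranspose_mul_self (designMatrix x)).smul (by positivity)

/-- The orthogonal projection onto the column space of the design matrix (zero if the columns are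
linearly dependent). -/
noncomputable def hatMatrix (x : Fin n → EuclideanSpace ℝ (Fin d)) : Matrix (Fin n) (Fin n) ℝ :=
  (n : ℝ)⁻¹ • (designMatrix x * (empSecondMoment x)⁻¹ * (designMatrix x)ᵀ)

theorem transpose_empSecondMoment (x : Fin n → EuclideanSpace ℝ (Fin d)) :
    (empSecondMoment x)ᵀ = empSecondMoment x := by
  rw [← conjTranspose_eq_transpose_of_trivial]
  exact (posSemidef_empSecondMoment x).isHermitian.eq

theorem transpose_hatMatrix (x : Fin n → EuclideanSpace ℝ (Fin d)) :
    (hatMatrix x)ᵀ = hatMatrix x := by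
  simp [hatMatrix, transpose_nonsing_inv, transpose_empSecondMoment, Matrix.mul_assoc]

/-- The positive semidefinite square root of a positive definite matrix. -/
theorem halfPow_mul_self {M : Matrix (Fin d) (Fin d) ℝ} (hM : M.PosSemidef) :
    halfPow M * halfPow M = M :=
  CFC.sqrt_mul_sqrt_self M hM.nonneg

theorem transpose_halfPow (M : Matrix (Fin d) (Fin d) ℝ) : (halfPow M)ᵀ = halfPow M := by
  have h : (halfPow M).PosSemidef := Matrix.nonneg_iff_posSemidef.1 (CFC.sqrt_nonneg M)
  rw [← conjTranspose_eq_transpose_of_trivial]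
  exact h.isHermitian.eq

theorem transpose_negHalfPow (M : Matrix (Fin d) (Fin d) ℝ) :
    (negHalfPow M)ᵀ = negHalfPow M := by
  rw [negHalfPow, transpose_nonsing_inv, transpose_halfPow]

theorem isUnit_det_halfPow {M : Matrix (Fin d) (Fin d) ℝ} (hM : M.PosSemidef) (hu : IsUnit M) :
    IsUnit (halfPow M).det := by
  have h : IsUnit (halfPow M * halfPow M).det := by
    rwa [halfPow_mul_self hM, ← isUnit_iff_isUnit_det]
  rw [det_mul] at h
  exact isUnit_of_mul_isUnit_left h

theorem halfPow_mul_negHalfPow {M : Matrix (Fin d) (Fin d) ℝ} (hM : M.PosSemidef)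
    (hu : IsUnit M) : halfPow M * negHalfPow M = 1 :=
  mul_nonsing_inv _ (isUnit_det_halfPow hM hu)

theorem negHalfPow_mul_halfPow {M : Matrix (Fin d) (Fin d) ℝ} (hM : M.PosSemidef)
    (hu : IsUnit M) : negHalfPow M * halfPow M = 1 :=
  nonsing_inv_mul _ (isUnit_det_halfPow hM hu)

theorem negHalfPow_mul_mul_negHalfPow {M : Matrix (Fin d) (Fin d) ℝ} (hM : M.PosSemidef)
    (hu : IsUnit M) : negHalfPow M * M * negHalfPow M = 1 := by
  nth_rewrite 2 [← halfPow_mul_self hM]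
  rw [← Matrix.mul_assoc, negHalfPow_mul_halfPow hM hu, Matrix.one_mul,
    halfPow_mul_negHalfPow hM hu]

theorem negHalfPow_mul_self {M : Matrix (Fin d) (Fin d) ℝ} (hM : M.PosSemidef) :
    negHalfPow M * negHalfPow M = M⁻¹ := by
  rw [negHalfPow, ← Matrix.mul_inv_rev, halfPow_mul_self hM]

theorem hatMatrix_mul_self (x : Fin n → EuclideanSpace ℝ (Fin d)) :
    hatMatrix x * hatMatrix x = hatMatrix x := by
  by_cases hu : IsUnit (empSecondMoment x)
  · have h1 : (empSecondMoment x)⁻¹ * empSecondMoment x = 1 :=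
      nonsing_inv_mul _ ((isUnit_iff_isUnit_det _).1 hu)
    calc hatMatrix x * hatMatrix x
        = (n : ℝ)⁻¹ • (designMatrix x * ((empSecondMoment x)⁻¹ *
            ((n : ℝ)⁻¹ • ((designMatrix x)ᵀ * designMatrix x))) * (empSecondMoment x)⁻¹ *
            (designMatrix x)ᵀ) := by
          simp [hatMatrix, Matrix.mul_assoc]
      _ = hatMatrix x := by
          rw [← empSecondMoment_eq, h1, Matrix.mul_one, hatMatrix]
  · have h0 : (empSecondMoment x)⁻¹ = 0 :=
      nonsing_inv_apply_not_isUnit _ (by rwa [← isUnit_iff_isUnit_det])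
    simp [hatMatrix, h0]

/-- The columns of `n^(-1/2)` times the design matrix times `Σ̂^(-1/2)` are orthonormal. For a
singular `Σ̂` the conventional inverse is zero, so the noise estimate can be proved without first
restricting to an event where `Σ̂` is invertible. -/
theorem hatMatrix_eq_zero_or_exists (x : Fin n → EuclideanSpace ℝ (Fin d)) :
    hatMatrix x = 0 ∨ ∃ U : Matrix (Fin n) (Fin d) ℝ, Uᵀ * U = 1 ∧ hatMatrix x = U * Uᵀ := by
  by_cases hu : IsUnit (empSecondMoment x)
  · right
    have hM := posSemidef_empSecondMoment x
    have hs : (√(n : ℝ))⁻¹ * (√(n : ℝ))⁻¹ = (n : ℝ)⁻¹ := by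
      rw [← mul_inv, Real.mul_self_sqrt (by positivity)]
    refine ⟨(√(n : ℝ))⁻¹ • (designMatrix x * negHalfPow (empSecondMoment x)), ?_, ?_⟩
    · rw [transpose_smul, transpose_mul, transpose_negHalfPow, Matrix.smul_mul, Matrix.mul_smul,
        smul_smul, hs]
      calc _ = negHalfPow (empSecondMoment x) * ((n : ℝ)⁻¹ • ((designMatrix x)ᵀ * designMatrix x)) *
            negHalfPow (empSecondMoment x) := by simp [Matrix.mul_assoc]
        _ = 1 := by rw [← empSecondMoment_eq, negHalfPow_mul_mul_negHalfPow hM hu]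
    · rw [transpose_smul, transpose_mul, transpose_negHalfPow, Matrix.smul_mul, Matrix.mul_smul,
        smul_smul, hs, hatMatrix, ← negHalfPow_mul_self hM]
      simp [Matrix.mul_assoc]
  · left
    have h0 : (empSecondMoment x)⁻¹ = 0 :=
      nonsing_inv_apply_not_isUnit _ (by rwa [← isUnit_iff_isUnit_det])
    simp [hatMatrix, h0]

theorem measurable_hatMatrix (k l : Fin n) :
    Measurable fun x : Fin n → EuclideanSpace ℝ (Fin d) => hatMatrix x k l := by
  have hc : Continuous fun x : Fin n → EuclideanSpace ℝ (Fin d) => empSecondMoment x := by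
    refine continuous_matrix fun i j => ?_
    simp only [empSecondMoment, Matrix.of_apply]
    fun_prop
  have hinv : ∀ i j, Measurable fun x : Fin n → EuclideanSpace ℝ (Fin d) =>
      (empSecondMoment x)⁻¹ i j := fun i j => by
    simp only [Matrix.inv_def, Matrix.smul_apply, smul_eq_mul, Ring.inverse_eq_inv']
    exact hc.matrix_det.measurable.inv.mul (hc.matrix_adjugate.matrix_elem i j).measurable
  have hcoord : ∀ k i, Measurable fun x : Fin n → EuclideanSpace ℝ (Fin d) => x k i :=
    fun k i => Continuous.measurable (by fun_prop)
  simp only [hatMatrix, Matrix.smul_apply, Matrix.mul_apply, smul_eq_mul, designMatrix,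
    Matrix.transpose_apply, Matrix.of_apply]
  exact (Finset.measurable_sum _ fun i _ => (Finset.measurable_sum _ fun j _ =>
    (hcoord k j).mul (hinv j i)).mul (hcoord l i)).const_mul _

/-- The exponential moment of the projected noise. -/
theorem SubgaussianNoise.lintegral_exp_hatMatrix_le {μ : Measure Ω} [IsProbabilityMeasure μ]
    {X : Ω → EuclideanSpace ℝ (Fin d)} {Y : Ω → ℝ} (hX : Measurable X) (hY : Measurable Y) {σ : ℝ}
    (h : SubgaussianNoise μ X Y σ) {l : ℝ} (hl : 0 ≤ l) (hs : l * σ ^ 2 < 1 / 2) :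
    ∫⁻ z, ENNReal.ofReal (Real.exp (l *
        ((fun k => noise μ X Y (z k).1 (z k).2) ⬝ᵥ hatMatrix (fun i => (z i).1) *ᵥ
          (fun k => noise μ X Y (z k).1 (z k).2))))
        ∂Measure.pi (fun _ : Fin n => μ.map fun ω => (X ω, Y ω)) ≤
      ENNReal.ofReal (Real.exp
        (d * (l * σ ^ 2 + (l * σ ^ 2) ^ 2 / (1 - 2 * (l * σ ^ 2))))) := by
  have hr := measurable_regression μ X Y
  have : IsProbabilityMeasure (μ.map fun ω => (X ω, Y ω)) :=
    Measure.isProbabilityMeasure_map (hX.prodMk hY).aemeasurable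
  have hsq : √(2 * l) ^ 2 = 2 * l := Real.sq_sqrt (by linarith)
  have hH := measurable_hatMatrix (n := n) (d := d)
  have hs0 : 0 ≤ l * σ ^ 2 := by positivity
  have hnorm : ∀ (x : Fin n → EuclideanSpace ℝ (Fin d)) (g : Fin n → ℝ),
      ∑ k, (hatMatrix x *ᵥ g) k ^ 2 = g ⬝ᵥ hatMatrix x *ᵥ g := fun x g => by
    have : (hatMatrix x *ᵥ g) ⬝ᵥ (hatMatrix x *ᵥ g) = g ⬝ᵥ hatMatrix x *ᵥ g := by
      rw [dotProduct_mulVec, ← mulVec_transpose, mulVec_mulVec, transpose_hatMatrix,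
        hatMatrix_mul_self, dotProduct_comm]
    simpa [dotProduct, sq] using this
  -- The same linearisation, now in the noise: since `H` is a symmetric projection, `‖He‖² = eᵀHe`,
  -- and the resulting weights `√(2l) (Hg)_k` depend only on the covariates.
  have h1 : ∀ z : Fin n → EuclideanSpace ℝ (Fin d) × ℝ, ENNReal.ofReal (Real.exp (l *
        ((fun k => noise μ X Y (z k).1 (z k).2) ⬝ᵥ hatMatrix (fun i => (z i).1) *ᵥ
          (fun k => noise μ X Y (z k).1 (z k).2)))) =
      ∫⁻ g, ENNReal.ofReal (Real.exp (∑ k, (√(2 * l) * (hatMatrix (fun i => (z i).1) *ᵥ g) k) *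
          noise μ X Y (z k).1 (z k).2)) ∂Measure.pi (fun _ : Fin n => gaussianReal 0 1) := by
    intro z
    set e : Fin n → ℝ := fun k => noise μ X Y (z k).1 (z k).2
    set H := hatMatrix (fun i => (z i).1) with hHdef
    have h2 : ∀ g : Fin n → ℝ, ∑ k, (√(2 * l) * (H *ᵥ g) k) * e k =
        ∑ k, (√(2 * l) * (H *ᵥ e) k) * g k := fun g => by
      have : (H *ᵥ g) ⬝ᵥ e = (H *ᵥ e) ⬝ᵥ g := by
        rw [dotProduct_comm, dotProduct_mulVec, ← mulVec_transpose, hHdef, transpose_hatMatrix]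
      simp only [mul_assoc, ← Finset.mul_sum]
      exact congrArg (√(2 * l) * ·) this
    have h3 : ∀ k, noise μ X Y (z k).1 (z k).2 = e k := fun _ => rfl
    simp only [h3, h2, lintegral_exp_sum_mul_gaussian, mul_pow, hsq, ← Finset.mul_sum]
    rw [hnorm]
    congr 2
    ring
  simp only [h1]
  have hHg : ∀ g : Fin n → ℝ, ∀ k, Measurable fun x : Fin n → EuclideanSpace ℝ (Fin d) =>
      √(2 * l) * (hatMatrix x *ᵥ g) k := fun g k => by
    simp only [mulVec, dotProduct]; fun_prop
  rw [lintegral_lintegral_swap]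
  -- For fixed `g` the noise is integrated out; this replaces `e` by `g` and `l` by `l σ²` in the
  -- quadratic form. Exchanging back, the Gaussian integral is taken for fixed covariates.
  · calc _ ≤ ∫⁻ g, ∫⁻ z, ENNReal.ofReal (Real.exp
            (l * σ ^ 2 * (g ⬝ᵥ hatMatrix (fun i => (z i).1) *ᵥ g)))
            ∂Measure.pi (fun _ : Fin n => μ.map fun ω => (X ω, Y ω))
            ∂Measure.pi (fun _ : Fin n => gaussianReal 0 1) := by
          refine lintegral_mono fun g => ?_
          refine (h.lintegral_exp_sum_le hX hY (hHg g)).trans_eq (lintegral_congr fun z => ?_)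
          simp only [mul_pow, hsq, ← Finset.sum_div, ← Finset.mul_sum, hnorm]
          congr 2
          ring
      _ = ∫⁻ z, ∫⁻ g, ENNReal.ofReal (Real.exp
            (l * σ ^ 2 * (g ⬝ᵥ hatMatrix (fun i => (z i).1) *ᵥ g)))
            ∂Measure.pi (fun _ : Fin n => gaussianReal 0 1)
            ∂Measure.pi (fun _ : Fin n => μ.map fun ω => (X ω, Y ω)) := by
          rw [lintegral_lintegral_swap]
          refine Measurable.aemeasurable ?_
          simp only [mulVec, dotProduct, Function.uncurry_def]
          fun_prop
      _ ≤ ∫⁻ _, ENNReal.ofReal (Real.exp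
            (d * (l * σ ^ 2 + (l * σ ^ 2) ^ 2 / (1 - 2 * (l * σ ^ 2)))))
            ∂Measure.pi (fun _ : Fin n => μ.map fun ω => (X ω, Y ω)) := by
          refine lintegral_mono fun z => ?_
          rcases hatMatrix_eq_zero_or_exists fun i => (z i).1 with h0 | ⟨U, hU, hHU⟩
          · simp only [h0, zero_mulVec, dotProduct_zero, mul_zero, Real.exp_zero,
              lintegral_const, measure_univ, mul_one]
            refine ENNReal.ofReal_le_ofReal (Real.one_le_exp ?_)
            have : 0 < 1 - 2 * (l * σ ^ 2) := by linarith
            positivity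
          · simp only [hHU]
            exact lintegral_exp_quadratic_gaussian_le U hU hs0 hs
      _ = _ := by simp
  · refine Measurable.aemeasurable ?_
    simp only [mulVec, dotProduct, Function.uncurry_def, noise]
    fun_prop

theorem hatMatrix_quadratic_nonneg (x : Fin n → EuclideanSpace ℝ (Fin d)) (g : Fin n → ℝ) :
    0 ≤ g ⬝ᵥ hatMatrix x *ᵥ g := by
  rcases hatMatrix_eq_zero_or_exists x with h0 | ⟨U, -, hU⟩
  · simp [h0]
  · rw [hU, ← mulVec_mulVec, dotProduct_mulVec, ← mulVec_transpose]
    exact dotProduct_self_star_nonneg _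

/-- The tail of a variable whose exponential moments are dominated by those of `σ ^ 2` times a
chi-squared variable with `d` degrees of freedom. -/
theorem measure_lt_le_of_chi_squared {α : Type*} [MeasurableSpace α] {ν : Measure α}
    [IsProbabilityMeasure ν] {Q : α → ℝ} (hQ : Measurable Q) (hQ0 : ∀ z, 0 ≤ Q z) {σ : ℝ}
    (hd : 0 < d)
    (h : ∀ l, 0 ≤ l → l * σ ^ 2 < 1 / 2 → ∫⁻ z, ENNReal.ofReal (Real.exp (l * Q z)) ∂ν ≤
      ENNReal.ofReal (Real.exp (d * (l * σ ^ 2 + (l * σ ^ 2) ^ 2 / (1 - 2 * (l * σ ^ 2))))))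
    {t : ℝ} (ht : 0 ≤ t) :
    ν {z | σ ^ 2 * (d + 2 * √(d * t) + 2 * t) < Q z} ≤ ENNReal.ofReal (Real.exp (-t)) := by
  -- Rescaling by `σ²` is impossible here, but then `exp Q` has mean at most one while `Q ≥ 0`,
  -- which forces `Q = 0` almost everywhere.
  by_cases hσ : σ = 0
  · have h1 := h 1 zero_le_one (by simp [hσ])
    simp only [hσ, one_mul, ne_eq, OfNat.ofNat_ne_zero, not_false_eq_true, zero_pow, mul_zero,
      sub_zero, div_one, add_zero, Real.exp_zero, ENNReal.ofReal_one] at h1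
    have h2 : (fun _ => (1 : ENNReal)) =ᵐ[ν] fun z => ENNReal.ofReal (Real.exp (Q z)) := by
      refine ae_eq_of_ae_le_of_lintegral_le (Filter.Eventually.of_forall fun z => ?_) (by simp)
        (by fun_prop) (by simpa using h1)
      simpa using hQ0 z
    have h3 : ν {z | σ ^ 2 * (d + 2 * √(d * t) + 2 * t) < Q z} = 0 := by
      refine measure_mono_null (fun z hz => ?_) h2
      simp only [hσ, Set.mem_ofPred_eq, ne_eq, OfNat.ofNat_ne_zero, not_false_eq_true, zero_pow,
        zero_mul] at hz
      intro hz'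
      have : ENNReal.ofReal (Real.exp (Q z)) = 1 := hz'.symm
      rw [ENNReal.ofReal_eq_one, Real.exp_eq_one_iff] at this
      linarith
    rw [h3]; exact zero_le
  · have hσ2 : 0 < σ ^ 2 := by positivity
    -- Subtracting the mean `d` cancels the linear part of the exponent and leaves `d s² / (1 -
    -- 2s)`.
    have key := measure_lt_le_of_subgamma (ν := ν) (W := fun z => Q z / σ ^ 2 - d) (by fun_prop)
      (D := d) (t := t) (by exact_mod_cast hd) ht fun s hs0 hs => by
        have h1 := h (s / σ ^ 2) (by positivity) (by rwa [div_mul_cancel₀ _ hσ2.ne'])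
        rw [div_mul_cancel₀ _ hσ2.ne'] at h1
        have h2 : ∀ z, ENNReal.ofReal (Real.exp (s * (Q z / σ ^ 2 - d))) =
            ENNReal.ofReal (Real.exp (-(s * d))) *
              ENNReal.ofReal (Real.exp (s / σ ^ 2 * Q z)) := fun z => by
          rw [← ENNReal.ofReal_mul (Real.exp_pos _).le, ← Real.exp_add]
          congr 2; ring
        simp only [h2]
        rw [lintegral_const_mul _ (by fun_prop)]
        refine (mul_le_mul_right h1 _).trans_eq ?_
        rw [← ENNReal.ofReal_mul (Real.exp_pos _).le, ← Real.exp_add]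
        congr 2; ring
    refine le_trans (measure_mono fun z hz => ?_) key
    simp only [Set.mem_ofPred_eq] at hz ⊢
    rw [← lt_div_iff₀' hσ2] at hz
    linarith

/-- The tail of the projected noise. -/
theorem SubgaussianNoise.measure_hatMatrix_le {μ : Measure Ω} [IsProbabilityMeasure μ]
    {X : Ω → EuclideanSpace ℝ (Fin d)} {Y : Ω → ℝ} (hX : Measurable X) (hY : Measurable Y) {σ : ℝ}
    (h : SubgaussianNoise μ X Y σ) (hd : 0 < d) {t : ℝ} (ht : 0 ≤ t) :
    Measure.pi (fun _ : Fin n => μ.map fun ω => (X ω, Y ω))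
      {z | σ ^ 2 * (d + 2 * √(d * t) + 2 * t) <
        (fun k => noise μ X Y (z k).1 (z k).2) ⬝ᵥ hatMatrix (fun i => (z i).1) *ᵥ
          (fun k => noise μ X Y (z k).1 (z k).2)} ≤ ENNReal.ofReal (Real.exp (-t)) := by
  have hr := measurable_regression μ X Y
  have : IsProbabilityMeasure (μ.map fun ω => (X ω, Y ω)) :=
    Measure.isProbabilityMeasure_map (hX.prodMk hY).aemeasurable
  have hH := measurable_hatMatrix (n := n) (d := d)
  have hQ : Measurable fun z : Fin n → EuclideanSpace ℝ (Fin d) × ℝ =>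
      (fun k => noise μ X Y (z k).1 (z k).2) ⬝ᵥ hatMatrix (fun i => (z i).1) *ᵥ
          (fun k => noise μ X Y (z k).1 (z k).2) := by
    simp only [mulVec, dotProduct, noise]
    fun_prop
  exact measure_lt_le_of_chi_squared hQ (fun z => hatMatrix_quadratic_nonneg _ _) hd
    (fun l hl hs => h.lintegral_exp_hatMatrix_le hX hY hl hs) ht

end HatMatrix

/-! ### A Bernstein inequality for sums of bounded random vectors -/

/-- `cosh √x` is the power series `∑ x^k / (2k)!`, whose terms are all convex on the half-line. -/
theorem cosh_sqrt_convex {a b w : ℝ} (ha : 0 ≤ a) (hb : 0 ≤ b) (h0 : 0 ≤ w) (h1 : w ≤ 1) :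
    Real.cosh √((1 - w) * a + w * b) ≤ (1 - w) * Real.cosh √a + w * Real.cosh √b := by
  have hs : ∀ x, 0 ≤ x → HasSum (fun k : ℕ => x ^ k / ((2 * k).factorial : ℝ)) (Real.cosh √x) :=
    fun x hx => by simpa [pow_mul, Real.sq_sqrt hx] using Real.hasSum_cosh √x
  have h1w : 0 ≤ 1 - w := by linarith
  refine hasSum_le (fun k => ?_) (hs _ (by positivity))
    (((hs a ha).mul_left (1 - w)).add ((hs b hb).mul_left w))
  have := (convexOn_pow (𝕜 := ℝ) k).2 ha hb h1w h0 (by ring)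
  simp only [smul_eq_mul] at this
  rw [← mul_div_assoc, ← mul_div_assoc, ← add_div]
  gcongr

/-- With `c` the cosine of the angle between `s` and `z`, `‖s + z‖²` is the convex combination of
`(‖s‖ - ‖z‖)²` and `(‖s‖ + ‖z‖)²` with weight `(1 + c) / 2` on the latter, so convexity of `cosh √x`
applies. The bound is linear in `z` up to a second-order remainder; the linear term vanishes in the
mean for centred `z`. -/
theorem cosh_norm_add_le {E : Type*} [NormedAddCommGroup E] [InnerProductSpace ℝ E] (s z : E) :
    Real.cosh ‖s + z‖ ≤ Real.cosh ‖s‖ + Real.sinh ‖s‖ / ‖s‖ * inner ℝ s z +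
      Real.cosh ‖s‖ * (Real.exp ‖z‖ - 1 - ‖z‖) := by
  have hz0 : 0 ≤ Real.sinh ‖z‖ - ‖z‖ :=
    sub_nonneg.2 (Real.self_le_sinh_iff.2 (norm_nonneg z))
  have hez : Real.exp ‖z‖ = Real.cosh ‖z‖ + Real.sinh ‖z‖ := (Real.cosh_add_sinh _).symm
  by_cases hs : s = 0
  · subst hs
    simp only [zero_add, norm_zero, Real.cosh_zero, Real.sinh_zero, inner_zero_left]
    linarith
  by_cases hz : z = 0
  · subst hz; simp
  have hS : 0 < ‖s‖ := norm_pos_iff.2 hs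
  have hZ : 0 < ‖z‖ := norm_pos_iff.2 hz
  have hSZ : 0 < ‖s‖ * ‖z‖ := mul_pos hS hZ
  obtain ⟨c, hc⟩ : ∃ c, inner ℝ s z = c * (‖s‖ * ‖z‖) :=
    ⟨inner ℝ s z / (‖s‖ * ‖z‖), by field_simp⟩
  have hc1 : |c| ≤ 1 := by
    have := abs_real_inner_le_norm s z
    rw [hc, abs_mul, abs_of_pos hSZ] at this
    exact le_of_mul_le_mul_right (by simpa using this) hSZ
  obtain ⟨hcl, hcu⟩ := abs_le.1 hc1
  have key := cosh_sqrt_convex (a := (‖s‖ - ‖z‖) ^ 2) (b := (‖s‖ + ‖z‖) ^ 2) (w := (1 + c) / 2)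
    (by positivity) (by positivity) (by linarith) (by linarith)
  have hn : (1 - (1 + c) / 2) * (‖s‖ - ‖z‖) ^ 2 + (1 + c) / 2 * (‖s‖ + ‖z‖) ^ 2 =
      ‖s + z‖ ^ 2 := by
    rw [norm_add_sq_real, hc]; ring
  rw [hn, Real.sqrt_sq (norm_nonneg _), Real.sqrt_sq_eq_abs, Real.cosh_abs,
    Real.sqrt_sq (by positivity), Real.cosh_sub, Real.cosh_add] at key
  refine key.trans ?_
  rw [hc, hez]
  have h1 : Real.sinh ‖s‖ / ‖s‖ * (c * (‖s‖ * ‖z‖)) = Real.sinh ‖s‖ * c * ‖z‖ := by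
    field_simp
  rw [h1]
  -- The gap between the convexity bound and the claim is exactly `(cosh ‖s‖ - c sinh ‖s‖) (sinh ‖z‖
  -- - ‖z‖)`.
  have h2 : 0 ≤ Real.cosh ‖s‖ - c * Real.sinh ‖s‖ := by
    have := (Real.sinh_lt_cosh ‖s‖).le
    have hsp : 0 < Real.sinh ‖s‖ := Real.sinh_pos_iff.2 hS
    nlinarith
  nlinarith [mul_nonneg h2 hz0]

section Bernstein

variable {α : Type*} [MeasurableSpace α] {ν : Measure α} [IsProbabilityMeasure ν]
  {E : Type*} [NormedAddCommGroup E] [InnerProductSpace ℝ E] [FiniteDimensional ℝ E]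
  [MeasurableSpace E] [BorelSpace E] {f : α → E} {M : ℝ}

theorem integrable_norm_sq_of_bound (hf : Measurable f) (hM : ∀ᵐ a ∂ν, ‖f a‖ ≤ M) :
    Integrable (fun a => ‖f a‖ ^ 2) ν := by
  refine Integrable.of_bound (by fun_prop) (M ^ 2) ?_
  filter_upwards [hM] with a ha
  rw [Real.norm_of_nonneg (by positivity)]
  gcongr

theorem integrable_const_add_inner_add_norm_sq (hf : Measurable f) (hM : ∀ᵐ a ∂ν, ‖f a‖ ≤ M)
    (s : E) (A B C : ℝ) : Integrable (fun a => A + B * inner ℝ s (f a) + C * ‖f a‖ ^ 2) ν :=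
  have hfi : Integrable f ν := Integrable.of_bound hf.aestronglyMeasurable M hM
  ((integrable_const _).add ((hfi.const_inner s).const_mul _)).add
    ((integrable_norm_sq_of_bound hf hM).const_mul _)

theorem integral_const_add_inner_add_norm_sq (hf : Measurable f) (hM : ∀ᵐ a ∂ν, ‖f a‖ ≤ M)
    (h0 : ∫ a, f a ∂ν = 0) (s : E) (A B C : ℝ) :
    ∫ a, (A + B * inner ℝ s (f a) + C * ‖f a‖ ^ 2) ∂ν = A + C * ∫ a, ‖f a‖ ^ 2 ∂ν := by
  have hfi : Integrable f ν := Integrable.of_bound hf.aestronglyMeasurable M hM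
  have h1 : Integrable (fun a => B * inner ℝ s (f a)) ν := (hfi.const_inner s).const_mul _
  have h2 : Integrable (fun a => A + B * inner ℝ s (f a)) ν := (integrable_const _).add h1
  rw [integral_add h2 ((integrable_norm_sq_of_bound hf hM).const_mul _),
    integral_add (integrable_const _) h1, integral_const_mul, integral_const_mul,
    integral_inner hfi, h0]
  simp

/-- Since `θM ≤ 1`, the remainder `e^x - 1 - x` is at most `x²`. Centring removes the linear term,
so the potential grows by at most `1 + vθ² ≤ exp (vθ²)`, with `v` the second moment. -/
theorem lintegral_cosh_norm_add_le (hf : Measurable f) (hM : ∀ᵐ a ∂ν, ‖f a‖ ≤ M)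
    (h0 : ∫ a, f a ∂ν = 0) {θ : ℝ} (hθ : 0 ≤ θ) (hθM : θ * M ≤ 1) (s : E) :
    ∫⁻ a, ENNReal.ofReal (Real.cosh (θ * ‖s + f a‖)) ∂ν ≤
      ENNReal.ofReal (Real.exp ((∫ a, ‖f a‖ ^ 2 ∂ν) * θ ^ 2) * Real.cosh (θ * ‖s‖)) := by
  set c := Real.sinh ‖θ • s‖ / ‖θ • s‖
  set C := Real.cosh (θ * ‖s‖) with hC
  have hns : ‖θ • s‖ = θ * ‖s‖ := by rw [norm_smul, Real.norm_of_nonneg hθ]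
  have hInt := integrable_const_add_inner_add_norm_sq hf hM s C (c * θ ^ 2) (C * θ ^ 2)
  have hle : ∀ᵐ a ∂ν, Real.cosh (θ * ‖s + f a‖) ≤
      C + c * θ ^ 2 * inner ℝ s (f a) + C * θ ^ 2 * ‖f a‖ ^ 2 := by
    filter_upwards [hM] with a ha
    have h1 := cosh_norm_add_le (θ • s) (θ • f a)
    have h2 : ‖θ • f a‖ = θ * ‖f a‖ := by rw [norm_smul, Real.norm_of_nonneg hθ]
    have h3 : ‖θ • s + θ • f a‖ = θ * ‖s + f a‖ := by
      rw [← smul_add, norm_smul, Real.norm_of_nonneg hθ]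
    have h4 : θ * ‖f a‖ ≤ 1 := (mul_le_mul_of_nonneg_left ha hθ).trans hθM
    have h5 : Real.exp (θ * ‖f a‖) - 1 - θ * ‖f a‖ ≤ (θ * ‖f a‖) ^ 2 :=
      (le_abs_self _).trans (Real.abs_exp_sub_one_sub_id_le (by rwa [abs_of_nonneg (by positivity)]))
    have h6 : 0 ≤ C := (Real.cosh_pos _).le
    rw [h2, h3, hns, ← hC, real_inner_smul_left, real_inner_smul_right] at h1
    have h7 := mul_le_mul_of_nonneg_left h5 h6
    simp only [c, hns]
    nlinarith
  refine (lintegral_mono_ae (hle.mono fun a h => ENNReal.ofReal_le_ofReal h)).trans ?_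
  rw [← ofReal_integral_eq_lintegral_ofReal hInt
    (hle.mono fun a h => (Real.cosh_pos _).le.trans h)]
  refine ENNReal.ofReal_le_ofReal ?_
  rw [integral_const_add_inner_add_norm_sq hf hM h0]
  have h6 : 0 ≤ C := (Real.cosh_pos _).le
  have := Real.add_one_le_exp ((∫ a, ‖f a‖ ^ 2 ∂ν) * θ ^ 2)
  nlinarith [mul_le_mul_of_nonneg_left this h6]

/-- The potential starts at `cosh 0 = 1` and dominates half the exponential; the half is the source
of `log 2`, which takes the place of any dependence on the dimension. -/
theorem measure_norm_sum_le_exp (hf : Measurable f) (hM : ∀ᵐ a ∂ν, ‖f a‖ ≤ M)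
    (h0 : ∫ a, f a ∂ν = 0) {θ : ℝ} (hθ : 0 ≤ θ) (hθM : θ * M ≤ 1) (n : ℕ) (r : ℝ) :
    Measure.pi (fun _ : Fin n => ν) {z | r < ‖∑ k, f (z k)‖} ≤
      ENNReal.ofReal (Real.exp (Real.log 2 + n * (∫ a, ‖f a‖ ^ 2 ∂ν) * θ ^ 2 - θ * r)) := by
  set v := ∫ a, ‖f a‖ ^ 2 ∂ν with hv
  refine measure_lt_le_of_lintegral_exp_le (by fun_prop) hθ ?_
  have key := lintegral_potential_sum_le ν (p := fun _ : E => True)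
    (Φ := fun k s => ENNReal.ofReal (Real.exp (k * (v * θ ^ 2)) * Real.cosh (θ * ‖s‖)))
    (fun k => by have := Real.continuous_cosh.measurable; fun_prop) hf (fun _ _ _ => trivial)
    (fun k s _ => ?_) n (s := 0) trivial
  · simp only [CharP.cast_eq_zero, zero_mul, Real.exp_zero, one_mul, zero_add, norm_zero, mul_zero,
      Real.cosh_zero, mul_one] at key
    calc _ ≤ ∫⁻ z, ENNReal.ofReal 2 * ENNReal.ofReal (Real.cosh (θ * ‖∑ k, f (z k)‖))
            ∂Measure.pi (fun _ : Fin n => ν) := by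
          refine lintegral_mono fun z => ?_
          rw [← ENNReal.ofReal_mul two_pos.le]
          refine ENNReal.ofReal_le_ofReal ?_
          rw [Real.cosh_eq]
          linarith [Real.exp_pos (-(θ * ‖∑ k, f (z k)‖))]
      _ = ENNReal.ofReal 2 * ∫⁻ z, ENNReal.ofReal (Real.cosh (θ * ‖∑ k, f (z k)‖))
            ∂Measure.pi (fun _ : Fin n => ν) := by
          have := Real.continuous_cosh.measurable
          rw [lintegral_const_mul _ (by fun_prop)]
      _ ≤ ENNReal.ofReal 2 * ENNReal.ofReal (Real.exp (n * (v * θ ^ 2))) := by gcongr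
      _ = _ := by
          rw [← ENNReal.ofReal_mul two_pos.le, Real.exp_add, Real.exp_log two_pos, mul_assoc]
  · have h1 : ∀ a, ENNReal.ofReal (Real.exp (k * (v * θ ^ 2)) * Real.cosh (θ * ‖s + f a‖)) =
        ENNReal.ofReal (Real.exp (k * (v * θ ^ 2))) *
          ENNReal.ofReal (Real.cosh (θ * ‖s + f a‖)) := fun a =>
      ENNReal.ofReal_mul (Real.exp_pos _).le
    have := Real.continuous_cosh.measurable
    simp only [h1]
    rw [lintegral_const_mul _ (by fun_prop)]
    refine (mul_le_mul_right (lintegral_cosh_norm_add_le hf hM h0 hθ hθM s) _).trans_eq ?_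
    rw [← ENNReal.ofReal_mul (Real.exp_pos _).le, ← mul_assoc, ← Real.exp_add]
    congr 3
    push_cast; ring

theorem lintegral_norm_sum_sq_le (hf : Measurable f) (hM : ∀ᵐ a ∂ν, ‖f a‖ ≤ M)
    (h0 : ∫ a, f a ∂ν = 0) (n : ℕ) :
    ∫⁻ z, ENNReal.ofReal (‖∑ k, f (z k)‖ ^ 2) ∂Measure.pi (fun _ : Fin n => ν) ≤
      ENNReal.ofReal (n * ∫ a, ‖f a‖ ^ 2 ∂ν) := by
  have key := lintegral_potential_sum_le ν (p := fun _ : E => True)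
    (Φ := fun k s => ENNReal.ofReal (‖s‖ ^ 2 + k * ∫ a, ‖f a‖ ^ 2 ∂ν))
    (fun k => by fun_prop) hf (fun _ _ _ => trivial) (fun k s _ => ?_) n (s := 0) trivial
  · simpa using key
  · have h1 : ∀ a, ‖s + f a‖ ^ 2 + k * ∫ a, ‖f a‖ ^ 2 ∂ν =
        (‖s‖ ^ 2 + k * ∫ a, ‖f a‖ ^ 2 ∂ν) + 2 * inner ℝ s (f a) + 1 * ‖f a‖ ^ 2 := fun a => by
      rw [norm_add_sq_real]; ring
    have hi := integrable_const_add_inner_add_norm_sq hf hM s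
      (‖s‖ ^ 2 + k * ∫ a, ‖f a‖ ^ 2 ∂ν) 2 1
    have hv : 0 ≤ ∫ a, ‖f a‖ ^ 2 ∂ν := integral_nonneg fun a => by positivity
    rw [← ofReal_integral_eq_lintegral_ofReal (by simpa only [h1] using hi)
      (Filter.Eventually.of_forall fun a => by positivity)]
    refine ENNReal.ofReal_le_ofReal (le_of_eq ?_)
    simp only [h1]
    rw [integral_const_add_inner_add_norm_sq hf hM h0]
    push_cast; ring

/-- A Bernstein inequality for the norm of a sum of independent centered bounded vectors. -/
theorem measure_norm_sum_sq_le (hf : Measurable f) (hM0 : 0 ≤ M) (hM : ∀ᵐ a ∂ν, ‖f a‖ ≤ M)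
    (h0 : ∫ a, f a ∂ν = 0) (n : ℕ) {t : ℝ} (ht : 0 ≤ t) :
    Measure.pi (fun _ : Fin n => ν)
      {z | 4 * (n * ∫ a, ‖f a‖ ^ 2 ∂ν) * (1 + 8 * t) + 3 * M ^ 2 * t ^ 2 < ‖∑ k, f (z k)‖ ^ 2} ≤
      ENNReal.ofReal (Real.exp (-t)) := by
  have hexp := fun θ hθ hθM r => measure_norm_sum_le_exp hf hM h0 (θ := θ) hθ hθM n r
  have hsq := lintegral_norm_sum_sq_le hf hM h0 n
  have hw0 : 0 ≤ n * ∫ a, ‖f a‖ ^ 2 ∂ν :=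
    mul_nonneg (by positivity) (integral_nonneg fun a => by positivity)
  set w := n * ∫ a, ‖f a‖ ^ 2 ∂ν with hw
  set ra := 4 * w * (1 + 8 * t) + 3 * M ^ 2 * t ^ 2 with hra
  have hra0 : 0 ≤ ra := by positivity
  rcases hw0.eq_or_lt with hw0 | hw0
  · have h1 : ∫⁻ z, ENNReal.ofReal (‖∑ k, f (z k)‖ ^ 2) ∂Measure.pi (fun _ : Fin n => ν) = 0 := by
      simpa [← hw0] using hsq
    rw [lintegral_eq_zero_iff (by fun_prop)] at h1
    have h2 : Measure.pi (fun _ : Fin n => ν) {z | ra < ‖∑ k, f (z k)‖ ^ 2} = 0 := by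
      refine measure_mono_null (fun z hz => ?_) h1
      intro hz'
      have : ENNReal.ofReal (‖∑ k, f (z k)‖ ^ 2) = 0 := hz'
      rw [ENNReal.ofReal_eq_zero] at this
      exact absurd (hra0.trans_lt hz) (not_lt.2 this)
    rw [h2]; exact zero_le
  -- For `t ≤ 2 log 2` the target probability is at least `1/4`, and Markov's inequality for the
  -- squared norm at level `4w` suffices. For larger `t`, the term `log 2` is at most `t/2` and can
  -- be absorbed.
  rcases le_or_gt t (2 * Real.log 2) with htl | htl
  · have hm := mul_meas_ge_le_lintegral₀ (μ := Measure.pi (fun _ : Fin n => ν))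
      (f := fun z => ENNReal.ofReal (‖∑ k, f (z k)‖ ^ 2)) (Measurable.aemeasurable (by fun_prop)) (ENNReal.ofReal (4 * w))
    have hsub : {z : Fin n → α | ra < ‖∑ k, f (z k)‖ ^ 2} ⊆
        {z | ENNReal.ofReal (4 * w) ≤ ENNReal.ofReal (‖∑ k, f (z k)‖ ^ 2)} := fun z hz => by
      refine ENNReal.ofReal_le_ofReal ((?_ : 4 * w ≤ ra).trans (le_of_lt hz))
      have : 0 ≤ 4 * w * (8 * t) + 3 * M ^ 2 * t ^ 2 := by positivity
      linarith
    have h4 : Measure.pi (fun _ : Fin n => ν) {z | ra < ‖∑ k, f (z k)‖ ^ 2} ≤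
        ENNReal.ofReal (w / (4 * w)) := by
      rw [ENNReal.ofReal_div_of_pos (by positivity), ENNReal.le_div_iff_mul_le
        (Or.inl (by simpa using hw0)) (Or.inl ENNReal.ofReal_ne_top), mul_comm]
      exact (mul_le_mul_right (measure_mono hsub) _).trans (hm.trans hsq)
    refine h4.trans (ENNReal.ofReal_le_ofReal ?_)
    have h5 : w / (4 * w) = Real.exp (-(2 * Real.log 2)) := by
      rw [Real.exp_neg, two_mul, Real.exp_add, Real.exp_log two_pos]
      field_simp; norm_num
    rw [h5]
    exact Real.exp_le_exp.2 (by linarith)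
  · have ht0 : 0 < t := lt_of_le_of_lt (by positivity) htl
    have hset : {z : Fin n → α | ra < ‖∑ k, f (z k)‖ ^ 2} ⊆ {z | √ra < ‖∑ k, f (z k)‖} :=
      fun z hz => by simpa using Real.sqrt_lt_sqrt hra0 hz
    refine (measure_mono hset).trans ?_
    have hr2 : √ra ^ 2 = ra := Real.sq_sqrt hra0
    have hr0 : 0 ≤ √ra := Real.sqrt_nonneg _
    -- The parameter `θ = √(8t/w)` is admissible only if `θM ≤ 1`, that is `8M²t ≤ w`; otherwise `θ
    -- = 1/M` is used. The exponents obtained are at most `log 2 - 8t` and `log 2 - 3t/2`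
    -- respectively.
    rcases le_or_gt w (8 * M ^ 2 * t) with hwM | hwM
    · have hMp : 0 < M := by
        rcases hM0.eq_or_lt with h | h
        · rw [← h] at hwM; simp at hwM; linarith
        · exact h
      refine (hexp M⁻¹ (by positivity) (by field_simp; exact le_rfl) _).trans
        (ENNReal.ofReal_le_ofReal (Real.exp_le_exp.2 ?_))
      have h1 : w / M + 3 / 2 * M * t ≤ √ra := by
        refine Real.le_sqrt_of_sq_le ?_
        have h2 : (w / M) ^ 2 ≤ 8 * w * t := by
          rw [div_pow, div_le_iff₀ (by positivity)]
          nlinarith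
        have h3 : (w / M + 3 / 2 * M * t) ^ 2 = (w / M) ^ 2 + 3 * w * t + 9 / 4 * M ^ 2 * t ^ 2 := by
          field_simp; ring
        rw [h3, hra]
        nlinarith [mul_pos hw0 ht0, sq_nonneg (M * t)]
      have h4 : M⁻¹ * (w / M + 3 / 2 * M * t) ≤ M⁻¹ * √ra := by gcongr
      have h5 : M⁻¹ * (w / M + 3 / 2 * M * t) = w * M⁻¹ ^ 2 + 3 / 2 * t := by
        field_simp
      linarith
    · set θ := √(8 * t / w) with hθ
      have hθ2 : θ ^ 2 = 8 * t / w := Real.sq_sqrt (by positivity)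
      have hθ0 : 0 ≤ θ := Real.sqrt_nonneg _
      refine (hexp θ hθ0 ?_ _).trans (ENNReal.ofReal_le_ofReal (Real.exp_le_exp.2 ?_))
      · refine abs_le_one_iff_mul_self_le_one.2 ?_ |> le_of_abs_le
        have : θ * M * (θ * M) = 8 * t / w * M ^ 2 := by rw [← hθ2]; ring
        rw [this, div_mul_eq_mul_div, div_le_one hw0]
        linarith
      · have h1 : 16 * t ≤ θ * √ra := by
          refine abs_le_of_sq_le_sq' ?_ (by positivity) |>.2
          rw [mul_pow θ, hθ2, hr2, div_mul_eq_mul_div, le_div_iff₀ hw0, hra]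
          nlinarith [mul_pos hw0 ht0, mul_nonneg ht0.le (sq_nonneg (M * t)), mul_pos (mul_pos hw0 ht0) ht0]
        have h2 : w * θ ^ 2 = 8 * t := by rw [hθ2]; field_simp
        rw [h2]
        linarith

end Bernstein

/-! ### The Golden–Thompson inequality for rank-one perturbations -/

section GoldenThompson

open InnerProductSpace

variable {E : Type*} [NormedAddCommGroup E] [InnerProductSpace ℝ E]

theorem inner_apply_eq_sum {ι : Type*} [Fintype ι] (b : OrthonormalBasis ι ℝ E) {T : E →L[ℝ] E}
    {l : ι → ℝ} (h : ∀ a, T (b a) = l a • b a) (u : E) :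
    inner ℝ u (T u) = ∑ a, inner ℝ (b a) u ^ 2 * l a := by
  classical
  conv_lhs => rw [← b.sum_repr' u]
  simp only [map_sum, map_smul, h, inner_sum, sum_inner, real_inner_smul_left,
    real_inner_smul_right, b.inner_eq_ite]
  simp
  exact Finset.sum_congr rfl fun a _ => by ring

/-- The quadratic form of an operator at a fixed vector as a continuous functional. -/
noncomputable def quadCLM (u : E) : (E →L[ℝ] E) →L[ℝ] ℝ :=
  (innerSL ℝ u).comp (ContinuousLinearMap.apply ℝ E u)

@[simp]
theorem quadCLM_apply (u : E) (T : E →L[ℝ] E) : quadCLM u T = inner ℝ u (T u) := rfl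

theorem pow_apply_eigenvector {T : E →L[ℝ] E} {v : E} {l : ℝ} (h : T v = l • v) (k : ℕ) :
    (T ^ k) v = l ^ k • v := by
  induction k with
  | zero => simp
  | succ k ih =>
    rw [pow_succ, mul_apply_eq_comp, h, map_smul, ih, smul_smul, ← pow_succ']

theorem eigenvalue_nonneg_of_isPositive {H : E →L[ℝ] E} (hH : H.IsPositive) {v : E}
    (hv : ‖v‖ = 1) {l : ℝ} (h : H v = l • v) : 0 ≤ l := by
  have := hH.inner_nonneg_right v
  rw [h, real_inner_smul_right] at this
  simpa [hv] using this

theorem isPositive_add_smul_rankOne {H : E →L[ℝ] E} (hH : H.IsPositive) (u : E) {h : ℝ}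
    (hh : 0 ≤ h) : (H + h • rankOne ℝ u u).IsPositive :=
  hH.add (ContinuousLinearMap.IsPositive.smul_of_nonneg (isPositive_rankOne_self (𝕜 := ℝ) u) hh)

/-- Expanding one perturbed factor: the part `H` joins the power on its left, and the rank-one part
cuts the quadratic form into a product of two. Induction on the number of perturbed factors is then
possible in both directions. -/
theorem inner_pow_mul_pow_succ (H : E →L[ℝ] E) (u : E) (h : ℝ) (j k : ℕ) :
    inner ℝ u ((H ^ j * (H + h • rankOne ℝ u u) ^ (k + 1)) u) =
      inner ℝ u ((H ^ (j + 1) * (H + h • rankOne ℝ u u) ^ k) u) +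
        h * (inner ℝ u ((H ^ j) u) * inner ℝ u (((H + h • rankOne ℝ u u) ^ k) u)) := by
  rw [pow_succ' (H + h • rankOne ℝ u u) k, pow_succ H j]
  simp only [mul_apply_eq_comp, add_apply, map_add, inner_add_right,
    smul_apply, rankOne_apply, map_smul, real_inner_smul_right]
  ring

variable [FiniteDimensional ℝ E]

theorem exists_eigenbasis {T : E →L[ℝ] E} (hT : (T : E →ₗ[ℝ] E).IsSymmetric) :
    ∃ (b : OrthonormalBasis (Fin (Module.finrank ℝ E)) ℝ E) (l : Fin (Module.finrank ℝ E) → ℝ),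
      ∀ a, T (b a) = l a • b a :=
  ⟨hT.eigenvectorBasis rfl, hT.eigenvalues rfl, fun a => hT.apply_eigenvectorBasis rfl a⟩

/-- The trace as a continuous functional. -/
noncomputable def traceCLM (E : Type*) [NormedAddCommGroup E] [InnerProductSpace ℝ E]
    [FiniteDimensional ℝ E] : (E →L[ℝ] E) →L[ℝ] ℝ :=
  LinearMap.toContinuousLinearMap
    { toFun := fun T => LinearMap.trace ℝ E (T : E →ₗ[ℝ] E)
      map_add' := fun S T => by simp
      map_smul' := fun c T => by simp }

theorem traceCLM_apply (T : E →L[ℝ] E) :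
    traceCLM E T = LinearMap.trace ℝ E (T : E →ₗ[ℝ] E) := rfl

theorem traceCLM_eq_sum {ι : Type*} [Fintype ι] (b : OrthonormalBasis ι ℝ E) {T : E →L[ℝ] E}
    {l : ι → ℝ} (h : ∀ a, T (b a) = l a • b a) : traceCLM E T = ∑ a, l a := by
  rw [traceCLM_apply, LinearMap.trace_eq_sum_inner _ b]
  simp [h, real_inner_smul_right]

theorem traceCLM_mul_comm (S T : E →L[ℝ] E) : traceCLM E (S * T) = traceCLM E (T * S) :=
  LinearMap.trace_mul_comm ℝ (S : E →ₗ[ℝ] E) (T : E →ₗ[ℝ] E)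

theorem traceCLM_mul_rankOne_mul (S T : E →L[ℝ] E) (u : E) :
    traceCLM E (S * rankOne ℝ u u * T) = inner ℝ u (T (S u)) := by
  rw [traceCLM_mul_comm, ← mul_assoc, traceCLM_apply, ContinuousLinearMap.mul_def (T * S),
    comp_rankOne, InnerProductSpace.trace_rankOne]
  rfl

theorem hasSum_exp_apply (φ : (E →L[ℝ] E) →L[ℝ] ℝ) (T : E →L[ℝ] E) :
    HasSum (fun k : ℕ => ((k.factorial : ℝ)⁻¹) * φ (T ^ k)) (φ (NormedSpace.exp T)) := by
  have h := NormedSpace.exp_series_hasSum_exp' (𝕂 := ℝ) T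
  simpa using φ.hasSum h

theorem exp_apply_eigenvector {T : E →L[ℝ] E} {v : E} {l : ℝ} (h : T v = l • v) :
    NormedSpace.exp T v = Real.exp l • v := by
  have h1 := (ContinuousLinearMap.apply ℝ E v).hasSum
    (NormedSpace.exp_series_hasSum_exp' (𝕂 := ℝ) T)
  have h2 := (NormedSpace.exp_series_hasSum_exp' (𝕂 := ℝ) l).smul_const v
  rw [← Real.exp_eq_exp_ℝ] at h2
  refine h1.unique ?_
  convert h2 using 2 with k
  simp [pow_apply_eigenvector h, smul_smul]

theorem exp_add_smul_one (T : E →L[ℝ] E) (c : ℝ) :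
    NormedSpace.exp (T + c • 1) = Real.exp c • NormedSpace.exp T := by
  have : NormedAlgebra ℚ (E →L[ℝ] E) := NormedAlgebra.restrictScalars ℚ ℝ _
  have h1 : Commute T (c • (1 : E →L[ℝ] E)) := (Commute.one_right T).smul_right c
  rw [NormedSpace.exp_add_of_commute h1]
  have h2 : NormedSpace.exp (c • (1 : E →L[ℝ] E)) = Real.exp c • 1 := by
    ext1 v
    rw [exp_apply_eigenvector (l := c) (by simp)]
    simp
  rw [h2]; simp

theorem isPositive_pow {H : E →L[ℝ] E} (hH : H.IsPositive) (k : ℕ) : (H ^ k).IsPositive := by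
  obtain ⟨b, l, hb⟩ := exists_eigenbasis hH.isSymmetric
  refine ⟨?_, fun x => ?_⟩
  · exact (hH.isSelfAdjoint.pow k).isSymmetric
  · rw [ContinuousLinearMap.reApplyInnerSelf_apply, real_inner_comm,
      inner_apply_eq_sum b fun a => pow_apply_eigenvector (hb a) k]
    simp only [RCLike.re_to_real]
    exact Finset.sum_nonneg fun a _ => mul_nonneg (sq_nonneg _)
      (pow_nonneg (eigenvalue_nonneg_of_isPositive hH (b.norm_eq_one a) (hb a)) k)

/-- Chebyshev's inequality for the spectral measure of `H` at `u`. -/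
theorem inner_pow_mul_inner_pow_le {H : E →L[ℝ] E} (hH : H.IsPositive) {u : E} (hu : ‖u‖ = 1)
    {h : ℝ} (hh : 0 ≤ h) (j k : ℕ) :
    inner ℝ u ((H ^ j) u) * inner ℝ u (((H + h • 1) ^ k) u) ≤
      inner ℝ u ((H ^ j * (H + h • 1) ^ k) u) := by
  obtain ⟨b, l, hb⟩ := exists_eigenbasis hH.isSymmetric
  have hl : ∀ a, 0 ≤ l a := fun a => eigenvalue_nonneg_of_isPositive hH (b.norm_eq_one a) (hb a)
  have h1 : ∀ i a, (H ^ i) (b a) = l a ^ i • b a := fun i a => pow_apply_eigenvector (hb a) i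
  have h2 : ∀ i a, ((H + h • 1) ^ i) (b a) = (l a + h) ^ i • b a := fun i a =>
    pow_apply_eigenvector (by simp [hb, add_smul]) i
  have h3 : ∀ a, (H ^ j * (H + h • 1) ^ k) (b a) = (l a ^ j * (l a + h) ^ k) • b a := fun a => by
    rw [mul_apply_eq_comp, h2, map_smul, h1, smul_smul]; ring_nf
  rw [inner_apply_eq_sum b (h1 j), inner_apply_eq_sum b (h2 k), inner_apply_eq_sum b h3]
  set p : Fin (Module.finrank ℝ E) → ℝ := fun a => inner ℝ (b a) u ^ 2 with hp
  have hp1 : ∑ a, p a = 1 := by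
    have := b.sum_sq_norm_inner_right u
    simpa [hu, p] using this
  have hmono : ∀ a c, 0 ≤ (l a ^ j - l c ^ j) * ((l a + h) ^ k - (l c + h) ^ k) := fun a c => by
    rcases le_total (l a) (l c) with hac | hac
    · refine mul_nonneg_of_nonpos_of_nonpos (sub_nonpos.2 ?_) (sub_nonpos.2 ?_)
      · exact pow_le_pow_left₀ (hl a) hac _
      · exact pow_le_pow_left₀ (by linarith [hl a]) (by linarith) _
    · refine mul_nonneg (sub_nonneg.2 ?_) (sub_nonneg.2 ?_)
      · exact pow_le_pow_left₀ (hl c) hac _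
      · exact pow_le_pow_left₀ (by linarith [hl c]) (by linarith) _
  -- The symmetrised form of Chebyshev's inequality: both powers increase with the eigenvalue and
  -- the spectral weights sum to one.
  have hsum : 0 ≤ ∑ a, ∑ c, p a * p c *
      ((l a ^ j - l c ^ j) * ((l a + h) ^ k - (l c + h) ^ k)) :=
    Finset.sum_nonneg fun a _ => Finset.sum_nonneg fun c _ =>
      mul_nonneg (mul_nonneg (sq_nonneg _) (sq_nonneg _)) (hmono a c)
  have hexp : ∑ a, ∑ c, p a * p c * ((l a ^ j - l c ^ j) * ((l a + h) ^ k - (l c + h) ^ k)) =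
      (∑ a, p a * (l a ^ j * (l a + h) ^ k)) * ∑ c, p c +
      (∑ a, p a) * (∑ c, p c * (l c ^ j * (l c + h) ^ k)) -
      (∑ a, p a * l a ^ j) * (∑ c, p c * (l c + h) ^ k) -
      (∑ a, p a * (l a + h) ^ k) * (∑ c, p c * l c ^ j) := by
    simp only [Finset.sum_mul_sum, ← Finset.sum_add_distrib, ← Finset.sum_sub_distrib]
    exact Finset.sum_congr rfl fun a _ => Finset.sum_congr rfl fun c _ => by ring
  rw [hexp, hp1] at hsum
  have hcomm : (∑ a, p a * (l a + h) ^ k) * (∑ c, p c * l c ^ j) =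
    (∑ c, p c * l c ^ j) * (∑ a, p a * (l a + h) ^ k) := mul_comm _ _
  linarith

/-- Each peeled rank-one term is a product of two moments of the spectral measure at `u`, which
Chebyshev's inequality merges into one. At `u` the perturbation `uuᵀ` is therefore no worse than the
identity, which commutes with `H`. -/
theorem inner_pow_mul_perturbed_pow_le {H : E →L[ℝ] E} (hH : H.IsPositive) {u : E} (hu : ‖u‖ = 1)
    {h : ℝ} (hh : 0 ≤ h) (j k : ℕ) :
    inner ℝ u ((H ^ j * (H + h • rankOne ℝ u u) ^ k) u) ≤
      inner ℝ u ((H ^ j * (H + h • 1) ^ k) u) := by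
  induction k generalizing j with
  | zero => simp
  | succ k ih =>
    rw [inner_pow_mul_pow_succ]
    have h1 := inner_pow_mul_inner_pow_le hH hu hh j k
    have h0 := ih 0
    simp only [pow_zero, one_mul] at h0
    have hm : 0 ≤ inner ℝ u ((H ^ j) u) := (isPositive_pow hH j).inner_nonneg_right u
    have h2 : inner ℝ u ((H ^ j * (H + h • 1) ^ (k + 1)) u) =
        inner ℝ u ((H ^ (j + 1) * (H + h • 1) ^ k) u) +
          h * inner ℝ u ((H ^ j * (H + h • 1) ^ k) u) := by
      rw [pow_succ' (H + h • 1) k, pow_succ H j]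
      simp only [mul_apply_eq_comp, add_apply, map_add,
        inner_add_right, smul_apply, one_apply_eq_self, map_smul,
        real_inner_smul_right]
    rw [h2]
    have h3 := mul_le_mul_of_nonneg_left ((mul_le_mul_of_nonneg_left h0 hm).trans h1) hh
    linarith [ih (j + 1)]

theorem le_inner_pow_mul_perturbed_pow {H : E →L[ℝ] E} (hH : H.IsPositive) {u : E} {h : ℝ}
    (hh : 0 ≤ h) (j k : ℕ) :
    inner ℝ u ((H ^ (j + k)) u) ≤ inner ℝ u ((H ^ j * (H + h • rankOne ℝ u u) ^ k) u) := by
  induction k generalizing j with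
  | zero => simp
  | succ k ih =>
    rw [inner_pow_mul_pow_succ]
    have h0 := ih 0
    simp only [pow_zero, one_mul, zero_add] at h0
    have hm : ∀ i, 0 ≤ inner ℝ u ((H ^ i) u) := fun i => (isPositive_pow hH i).inner_nonneg_right u
    have h1 := ih (j + 1)
    rw [add_right_comm, add_assoc] at h1
    have h2 := mul_nonneg hh (mul_nonneg (hm j) ((hm k).trans h0))
    linarith

/-- The gain is the first-order term of the expansion in `h`: each of the `k` perturbed factors
contributes `h ⟨u, H^(j+k-1) u⟩`, and higher orders are nonnegative. The truncated subtraction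
matters only for `j = k = 0`, where the factor `k` vanishes. -/
theorem trace_pow_add_le {H : E →L[ℝ] E} (hH : H.IsPositive) {u : E} {h : ℝ}
    (hh : 0 ≤ h) (j k : ℕ) :
    traceCLM E (H ^ (j + k)) + k * (h * inner ℝ u ((H ^ (j + k - 1)) u)) ≤
      traceCLM E (H ^ j * (H + h • rankOne ℝ u u) ^ k) := by
  induction k generalizing j with
  | zero => simp
  | succ k ih =>
    have h1 : traceCLM E (H ^ j * (H + h • rankOne ℝ u u) ^ (k + 1)) =
        traceCLM E (H ^ (j + 1) * (H + h • rankOne ℝ u u) ^ k) +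
          h * inner ℝ u (((H + h • rankOne ℝ u u) ^ k) ((H ^ j) u)) := by
      rw [← traceCLM_mul_rankOne_mul, pow_succ' (H + h • rankOne ℝ u u) k, pow_succ H j,
        ← smul_eq_mul h, ← (traceCLM E).map_smul, ← (traceCLM E).map_add]
      congr 1
      simp only [mul_add, add_mul, mul_assoc, smul_mul_assoc, mul_smul_comm]
    have hMs : ((H + h • rankOne ℝ u u) ^ k).IsPositive :=
      isPositive_pow (isPositive_add_smul_rankOne hH u hh) k
    have h2 : inner ℝ u (((H + h • rankOne ℝ u u) ^ k) ((H ^ j) u)) =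
        inner ℝ u ((H ^ j * (H + h • rankOne ℝ u u) ^ k) u) := by
      rw [mul_apply_eq_comp]
      have e1 := hMs.isSymmetric u ((H ^ j) u)
      have e2 := (isPositive_pow hH j).isSymmetric u (((H + h • rankOne ℝ u u) ^ k) u)
      simp only [ContinuousLinearMap.coe_coe] at e1 e2
      rw [← e1, ← e2, real_inner_comm]
    have h3 := le_inner_pow_mul_perturbed_pow hH hh (u := u) j k
    have h4 := ih (j + 1)
    rw [h1, h2]
    have e3 : j + 1 + k = j + (k + 1) := by ring
    have e4 : j + (k + 1) - 1 = j + k := by omega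
    have e5 : j + 1 + k - 1 = j + k := by omega
    rw [e5, e3] at h4
    rw [e4]
    have h5 := mul_le_mul_of_nonneg_left h3 hh
    rw [Nat.cast_succ, add_mul, one_mul, ← add_assoc]
    exact add_le_add h4 h5

/-- The comparison of powers is summed against the nonnegative coefficients `1/k!`; the shift by `h
• 1` comes out as `exp h`. -/
theorem inner_exp_perturbed_le {H : E →L[ℝ] E} (hH : H.IsPositive) {u : E} (hu : ‖u‖ = 1)
    {h : ℝ} (hh : 0 ≤ h) :
    inner ℝ u (NormedSpace.exp (H + h • rankOne ℝ u u) u) ≤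
      Real.exp h * inner ℝ u (NormedSpace.exp H u) := by
  have h1 := hasSum_exp_apply (quadCLM u) (H + h • rankOne ℝ u u)
  have h2 := hasSum_exp_apply (quadCLM u) (H + h • 1)
  rw [exp_add_smul_one, map_smul, smul_eq_mul] at h2
  refine hasSum_le (fun k => ?_) h1 h2
  have := inner_pow_mul_perturbed_pow_le hH hu hh 0 k
  simp only [pow_zero, one_mul] at this
  simp only [quadCLM_apply]
  gcongr

/-- Summation of the power inequality against `1/k!`; since `k/k! = 1/(k-1)!`, the first-order terms
form the exponential series again. -/
theorem trace_exp_add_le {H : E →L[ℝ] E} (hH : H.IsPositive) {u : E} {h : ℝ}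
    (hh : 0 ≤ h) :
    traceCLM E (NormedSpace.exp H) + h * inner ℝ u (NormedSpace.exp H u) ≤
      traceCLM E (NormedSpace.exp (H + h • rankOne ℝ u u)) := by
  have h1 := hasSum_exp_apply (traceCLM E) (H + h • rankOne ℝ u u)
  have h2 := hasSum_exp_apply (traceCLM E) H
  have h3 := hasSum_exp_apply (quadCLM u) H
  have h4 : HasSum (fun k : ℕ => ((k.factorial : ℝ)⁻¹) * (k * inner ℝ u ((H ^ (k - 1)) u)))
      (quadCLM u (NormedSpace.exp H)) := by
    rw [← hasSum_nat_add_iff' 1]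
    simp only [Finset.range_one, Finset.sum_singleton, CharP.cast_eq_zero, zero_mul, mul_zero,
      sub_zero]
    refine (funext fun k => ?_ : (fun k : ℕ => _) = _) ▸ h3
    rw [Nat.factorial_succ, Nat.add_sub_cancel, quadCLM_apply]
    push_cast
    field_simp
  refine hasSum_le (fun k => ?_) (h2.add (h4.mul_left h)) h1
  have := trace_pow_add_le hH hh (u := u) 0 k
  simp only [pow_zero, one_mul, zero_add] at this
  have hk : 0 ≤ ((k.factorial : ℝ)⁻¹) := by positivity
  have := mul_le_mul_of_nonneg_left this hk
  linarith

/-- The trace exponential decreases under a negative rank-one perturbation. -/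
theorem trace_exp_le_of_isPositive {A : E →L[ℝ] E} (hA : A.IsPositive) {u : E} (hu : ‖u‖ = 1)
    {s : ℝ} (hs : 0 ≤ s) :
    traceCLM E (NormedSpace.exp A) +
        (1 - Real.exp (-s)) * inner ℝ u (NormedSpace.exp (A + s • rankOne ℝ u u) u) ≤
      traceCLM E (NormedSpace.exp (A + s • rankOne ℝ u u)) := by
  -- Heuristically, `f' ≥ g` and `g τ ≥ exp (τ - s) g s`, and integration over `[0, s]` gives the
  -- claim. The two step inequalities below are the finite-difference forms, so no operator function
  -- has to be differentiated.
  set f : ℝ → ℝ := fun τ => traceCLM E (NormedSpace.exp (A + τ • rankOne ℝ u u)) with hf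
  set g : ℝ → ℝ := fun τ => inner ℝ u (NormedSpace.exp (A + τ • rankOne ℝ u u) u) with hg
  have hpos : ∀ τ : ℝ, 0 ≤ τ → (A + τ • rankOne ℝ u u).IsPositive := fun τ hτ =>
    isPositive_add_smul_rankOne hA u hτ
  have hsplit : ∀ τ h : ℝ, A + (τ + h) • rankOne ℝ u u =
      A + τ • rankOne ℝ u u + h • rankOne ℝ u u := fun τ h => by rw [add_smul, add_assoc]
  have hfstep : ∀ τ h : ℝ, 0 ≤ τ → 0 ≤ h → f τ + h * g τ ≤ f (τ + h) := fun τ h hτ hh => by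
    have := trace_exp_add_le (hpos τ hτ) hh (u := u)
    simpa only [hf, hg, hsplit] using this
  have hgstep : ∀ τ h : ℝ, 0 ≤ τ → 0 ≤ h → g (τ + h) ≤ Real.exp h * g τ := fun τ h hτ hh => by
    have := inner_exp_perturbed_le (hpos τ hτ) hu hh
    simpa only [hg, hsplit] using this
  have hg0 : 0 ≤ g s := by
    have h3 := hasSum_exp_apply (quadCLM u) (A + s • rankOne ℝ u u)
    exact h3.nonneg fun k => mul_nonneg (by positivity)
      ((isPositive_pow (hpos s hs) k).inner_nonneg_right u)
  -- The sum over `N + 1` equal steps is geometric and loses only a factor `exp (-h)` with `h = s /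
  -- (N + 1)`, which tends to one.
  have key : ∀ N : ℕ, Real.exp (-(s / (N + 1 : ℝ))) * ((1 - Real.exp (-s)) * g s) ≤ f s - f 0 := by
    intro N
    set h := s / (N + 1 : ℝ) with hh
    have hN : (0 : ℝ) < N + 1 := by positivity
    have hh0 : 0 ≤ h := by positivity
    have hind : ∀ m : ℕ, m ≤ N + 1 →
        Real.exp (-h) * (Real.exp (m * h) - 1) * (Real.exp (-s) * g s) ≤ f (m * h) - f 0 := by
      intro m
      induction m with
      | zero => intro _; simp
      | succ m ih =>
        intro hm
        have h1 := ih (by omega)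
        have h2 := hfstep (m * h) h (by positivity) hh0
        have hms : (m : ℝ) * h ≤ s := by
          have : (m : ℝ) ≤ N + 1 := by exact_mod_cast (by omega : m ≤ N + 1)
          rw [hh, ← mul_div_assoc, div_le_iff₀ hN]
          nlinarith
        have h3 := hgstep (m * h) (s - m * h) (by positivity) (by linarith)
        rw [add_sub_cancel] at h3
        have h4 : Real.exp (m * h) * (Real.exp (-s) * g s) ≤ g (m * h) := by
          have := mul_le_mul_of_nonneg_left h3 (Real.exp_pos (m * h - s)).le
          rw [← mul_assoc, ← Real.exp_add, sub_add_sub_cancel, sub_self, Real.exp_zero,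
            one_mul] at this
          rwa [← mul_assoc, ← Real.exp_add, ← sub_eq_add_neg]
        have h5 : Real.exp (-h) * (Real.exp h - 1) ≤ h := by
          rw [mul_sub, ← Real.exp_add, neg_add_cancel, Real.exp_zero, mul_one]
          linarith [Real.add_one_le_exp (-h)]
        have h6 : ((m + 1 : ℕ) : ℝ) * h = m * h + h := by push_cast; ring
        rw [h6, Real.exp_add]
        have hq : 0 ≤ Real.exp (m * h) * (Real.exp (-s) * g s) := by positivity
        have h7 := mul_le_mul_of_nonneg_right h5 hq
        have h8 := mul_le_mul_of_nonneg_left h4 hh0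
        nlinarith
    have := hind (N + 1) le_rfl
    have e1 : ((N + 1 : ℕ) : ℝ) * h = s := by
      rw [hh]; push_cast; field_simp
    rw [e1] at this
    refine le_of_eq_of_le ?_ this
    have : (Real.exp s - 1) * Real.exp (-s) = 1 - Real.exp (-s) := by
      rw [sub_mul, ← Real.exp_add, add_neg_cancel, Real.exp_zero, one_mul]
    rw [← this]; ring
  have hlim : Filter.Tendsto (fun N : ℕ =>
      Real.exp (-(s / (N + 1 : ℝ))) * ((1 - Real.exp (-s)) * g s)) Filter.atTop
      (nhds (Real.exp (-0) * ((1 - Real.exp (-s)) * g s))) := by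
    refine Filter.Tendsto.mul_const _ ((Real.continuous_exp.tendsto _).comp (Filter.Tendsto.neg ?_))
    have := tendsto_one_div_add_atTop_nhds_zero_nat (𝕜 := ℝ)
    simpa [div_eq_mul_inv] using this.const_mul s
  have hfin := le_of_tendsto' hlim key
  rw [neg_zero, Real.exp_zero, one_mul] at hfin
  have hf0 : f 0 = traceCLM E (NormedSpace.exp A) := by simp [hf]
  rw [hf0] at hfin
  linarith

end GoldenThompson

/-! ### The smallest eigenvalue of a sum of bounded rank-one operators -/

section MatrixChernoff

open InnerProductSpace

variable {E : Type*} [NormedAddCommGroup E] [InnerProductSpace ℝ E] [FiniteDimensional ℝ E]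

/-- The concave function `r ↦ 1 - exp (-θr)` lies above its chord on `[0, R]`. The chord makes the
later bound linear in `‖x‖²`, hence quadratic in `x`, so that isotropy can be used. -/
theorem one_sub_exp_neg_mul_le {θ r R : ℝ} (hr : 0 ≤ r) (hrR : r ≤ R) (hR : 0 < R) :
    (1 - Real.exp (-(θ * R))) / R * r ≤ 1 - Real.exp (-(θ * r)) := by
  have h := convexOn_exp.2 (Set.mem_univ (-(θ * R))) (Set.mem_univ 0)
    (div_nonneg hr hR.le) (sub_nonneg.2 ((div_le_one hR).2 hrR)) (by ring)
  simp only [smul_eq_mul, Real.exp_zero, mul_zero, add_zero, mul_one] at h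
  have e1 : r / R * -(θ * R) = -(θ * r) := by field_simp
  rw [e1] at h
  have e2 : (1 - Real.exp (-(θ * R))) / R * r = r / R - r / R * Real.exp (-(θ * R)) := by
    field_simp
  linarith

theorem trace_exp_neg_add_rankOne_le {S : E →L[ℝ] E} (hS : S.IsPositive) {x : E} {R θ : ℝ}
    (hR : 0 < R) (hx : ‖x‖ ^ 2 ≤ R) (hθ : 0 ≤ θ) :
    traceCLM E (NormedSpace.exp (-θ • (S + rankOne ℝ x x))) ≤
      traceCLM E (NormedSpace.exp (-θ • S)) -
        (1 - Real.exp (-(θ * R))) / R * inner ℝ x (NormedSpace.exp (-θ • S) x) := by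
  by_cases hx0 : x = 0
  · simp [hx0]
  have hxn : 0 < ‖x‖ := norm_pos_iff.2 hx0
  set u := ‖x‖⁻¹ • x with hu
  have hu1 : ‖u‖ = 1 := by rw [hu, norm_smul, norm_inv, norm_norm, inv_mul_cancel₀ hxn.ne']
  have hT : (S + rankOne ℝ x x).IsPositive := hS.add (isPositive_rankOne_self (𝕜 := ℝ) x)
  set T := S + rankOne ℝ x x with hTdef
  set c := θ * ‖T‖ with hc
  -- The rank-one inequality needs a positive operator. A shift by `c = θ‖T‖` provides it and
  -- multiplies both sides by `exp c`, which is cancelled at the end.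
  have hA : (-θ • T + c • 1).IsPositive := by
    refine ⟨?_, fun v => ?_⟩
    · exact ((IsSelfAdjoint.all (-θ)).smul hT.isSelfAdjoint).add
        ((IsSelfAdjoint.all c).smul (IsSelfAdjoint.one _)) |>.isSymmetric
    · rw [ContinuousLinearMap.reApplyInnerSelf_apply]
      have h1 : inner ℝ (T v) v ≤ ‖T‖ * ‖v‖ ^ 2 := by
        refine (real_inner_le_norm _ _).trans ?_
        rw [sq, ← mul_assoc]
        gcongr
        exact T.le_opNorm v
      have h2 : inner ℝ ((-θ • T + c • 1) v) v = c * ‖v‖ ^ 2 - θ * inner ℝ (T v) v := by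
        simp only [add_apply, smul_apply, one_apply_eq_self, inner_add_left, real_inner_smul_left,
          real_inner_self_eq_norm_sq]
        ring
      simp only [RCLike.re_to_real]
      rw [h2, hc]
      nlinarith [mul_le_mul_of_nonneg_left h1 hθ]
  have hsplit : -θ • T + c • 1 + (θ * ‖x‖ ^ 2) • rankOne ℝ u u = -θ • S + c • 1 := by
    have : (θ * ‖x‖ ^ 2) • rankOne ℝ u u = θ • rankOne ℝ x x := by
      ext v
      simp only [smul_apply, rankOne_apply, hu, real_inner_smul_left, smul_smul]
      congr 1
      field_simp
    rw [this, hTdef]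
    module
  have key := trace_exp_le_of_isPositive hA hu1 (s := θ * ‖x‖ ^ 2) (by positivity)
  rw [hsplit, exp_add_smul_one, exp_add_smul_one] at key
  simp only [map_smul, smul_eq_mul, smul_apply, real_inner_smul_right] at key
  set G := NormedSpace.exp (-θ • S) with hG
  have hGu : inner ℝ x (G x) = ‖x‖ ^ 2 * inner ℝ u (G u) := by
    simp only [hu, map_smul, real_inner_smul_left, real_inner_smul_right]
    field_simp
  have hGpos : 0 ≤ inner ℝ u (G u) := by
    obtain ⟨b, l, hb⟩ := exists_eigenbasis hS.isSymmetric
    rw [inner_apply_eq_sum b (l := fun a => Real.exp (-θ * l a)) fun a =>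
      exp_apply_eigenvector (by rw [smul_apply, hb, smul_smul])]
    exact Finset.sum_nonneg fun a _ => by positivity
  have hk := one_sub_exp_neg_mul_le (θ := θ) (sq_nonneg ‖x‖) hx hR
  have hk2 := mul_le_mul_of_nonneg_right hk hGpos
  rw [hGu]
  have hec := Real.exp_pos c
  have key2 : traceCLM E (NormedSpace.exp (-θ • T)) +
      (1 - Real.exp (-(θ * ‖x‖ ^ 2))) * inner ℝ u (G u) ≤ traceCLM E G := by
    refine le_of_mul_le_mul_left ?_ hec
    linarith
  linarith

variable [MeasurableSpace E] [BorelSpace E] {α : Type*} [MeasurableSpace α] {ν : Measure α}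
  [IsProbabilityMeasure ν] {w : α → E}

theorem integrable_inner_sq_of_bound (hw : Measurable w) {R : ℝ} (hR : ∀ᵐ a ∂ν, ‖w a‖ ^ 2 ≤ R)
    (u : E) : Integrable (fun a => inner ℝ u (w a) ^ 2) ν := by
  refine Integrable.of_bound (by fun_prop) (‖u‖ ^ 2 * R) ?_
  filter_upwards [hR] with a ha
  rw [Real.norm_of_nonneg (sq_nonneg _)]
  have := abs_real_inner_le_norm u (w a)
  calc inner ℝ u (w a) ^ 2 = |inner ℝ u (w a)| ^ 2 := (sq_abs _).symm
    _ ≤ (‖u‖ * ‖w a‖) ^ 2 := by gcongr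
    _ = ‖u‖ ^ 2 * ‖w a‖ ^ 2 := by ring
    _ ≤ _ := by gcongr

/-- Isotropy turns the mean of `⟨w, G w⟩` into `tr G`, so one summand multiplies the potential by at
most `1 - κ ≤ exp (-κ)`. -/
theorem lintegral_trace_exp_le (hw : Measurable w) {R : ℝ} (hR0 : 0 < R)
    (hR : ∀ᵐ a ∂ν, ‖w a‖ ^ 2 ≤ R) (hiso : ∀ u : E, ∫ a, inner ℝ u (w a) ^ 2 ∂ν = ‖u‖ ^ 2)
    {θ : ℝ} (hθ : 0 ≤ θ) {S : E →L[ℝ] E} (hS : S.IsPositive) :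
    ∫⁻ a, ENNReal.ofReal (traceCLM E (NormedSpace.exp (-θ • (S + rankOne ℝ (w a) (w a))))) ∂ν ≤
      ENNReal.ofReal (Real.exp (-((1 - Real.exp (-(θ * R))) / R))) *
        ENNReal.ofReal (traceCLM E (NormedSpace.exp (-θ • S))) := by
  set κ := (1 - Real.exp (-(θ * R))) / R with hκ
  obtain ⟨b, l, hb⟩ := exists_eigenbasis hS.isSymmetric
  set G := NormedSpace.exp (-θ • S) with hG
  have hGb : ∀ a, G (b a) = Real.exp (-θ * l a) • b a := fun a =>
    exp_apply_eigenvector (by rw [smul_apply, hb, smul_smul])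
  have htr : traceCLM E G = ∑ i, Real.exp (-θ * l i) := traceCLM_eq_sum b hGb
  have hInt : ∀ i, Integrable (fun a => inner ℝ (b i) (w a) ^ 2 * Real.exp (-θ * l i)) ν := fun i =>
    (integrable_inner_sq_of_bound hw hR (b i)).mul_const _
  have hquad : ∀ a, inner ℝ (w a) (G (w a)) =
      ∑ i, inner ℝ (b i) (w a) ^ 2 * Real.exp (-θ * l i) := fun a =>
    inner_apply_eq_sum b hGb (w a)
  have hqi : Integrable (fun a => inner ℝ (w a) (G (w a))) ν := by
    simp only [hquad]; exact integrable_finsetSum _ fun i _ => hInt i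
  have hq : ∫ a, inner ℝ (w a) (G (w a)) ∂ν = traceCLM E G := by
    simp only [hquad]
    rw [integral_finsetSum _ fun i _ => hInt i, htr]
    refine Finset.sum_congr rfl fun i _ => ?_
    rw [integral_mul_const, hiso]
    simp
  have htr0 : 0 ≤ traceCLM E G := by rw [htr]; exact Finset.sum_nonneg fun i _ => by positivity
  have hle : ∀ᵐ a ∂ν, traceCLM E (NormedSpace.exp (-θ • (S + rankOne ℝ (w a) (w a)))) ≤
      traceCLM E G - κ * inner ℝ (w a) (G (w a)) := by
    filter_upwards [hR] with a ha using trace_exp_neg_add_rankOne_le hS hR0 ha hθ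
  have hnn : ∀ a, 0 ≤ traceCLM E (NormedSpace.exp (-θ • (S + rankOne ℝ (w a) (w a)))) := fun a => by
    obtain ⟨b', l', hb'⟩ := exists_eigenbasis
      (hS.add (isPositive_rankOne_self (𝕜 := ℝ) (w a))).isSymmetric
    rw [traceCLM_eq_sum b' (l := fun i => Real.exp (-θ * l' i)) fun i =>
      exp_apply_eigenvector (by rw [smul_apply, hb', smul_smul])]
    exact Finset.sum_nonneg fun i _ => by positivity
  refine (lintegral_mono_ae (hle.mono fun a h => ENNReal.ofReal_le_ofReal h)).trans ?_
  have hint2 : Integrable (fun a => traceCLM E G - κ * inner ℝ (w a) (G (w a))) ν :=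
    (integrable_const _).sub (hqi.const_mul κ)
  rw [← ofReal_integral_eq_lintegral_ofReal hint2
    (hle.mono fun a h => (hnn a).trans h), ← ENNReal.ofReal_mul (Real.exp_pos _).le]
  refine ENNReal.ofReal_le_ofReal ?_
  rw [integral_sub (integrable_const _) (hqi.const_mul κ), integral_const_mul, hq]
  simp only [integral_const, probReal_univ, one_smul]
  have := Real.add_one_le_exp (-κ)
  nlinarith

/-- A Chernoff bound for the smallest eigenvalue of a sum of independent isotropic rank-one
operators. -/
theorem measure_exists_sum_inner_sq_lt_le (hw : Measurable w) {R : ℝ} (hR0 : 0 < R)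
    (hR : ∀ᵐ a ∂ν, ‖w a‖ ^ 2 ≤ R) (hiso : ∀ u : E, ∫ a, inner ℝ u (w a) ^ 2 ∂ν = ‖u‖ ^ 2)
    (n : ℕ) {ε : ℝ} (hε : 0 ≤ ε) :
    Measure.pi (fun _ : Fin n => ν)
        {z | ∃ u : E, ∑ k, inner ℝ u (w (z k)) ^ 2 < n * ((1 - ε) * ‖u‖ ^ 2)} ≤
      ENNReal.ofReal (Module.finrank ℝ E * Real.exp (-(n * ε ^ 2 / (2 * R)))) := by
  have : NormedAlgebra ℚ (E →L[ℝ] E) := NormedAlgebra.restrictScalars ℚ ℝ _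
  -- This minimises `-θε + θ²R/2`, the exponent per observation after a second-order expansion.
  set θ := ε / R with hθ
  have hθ0 : 0 ≤ θ := by positivity
  set κ := (1 - Real.exp (-(θ * R))) / R with hκ
  have hcont : Continuous fun x : E => rankOne ℝ x x :=
    (rankOne ℝ).continuous.clm_apply continuous_id
  have hexpc : Continuous fun S : E →L[ℝ] E => traceCLM E (NormedSpace.exp (-θ • S)) :=
    (traceCLM E).continuous.comp (NormedSpace.exp_continuous.comp (continuous_const_smul _))
  have key := lintegral_potential_sum_le ν (p := fun S : E →L[ℝ] E => S.IsPositive)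
    (Φ := fun k S => ENNReal.ofReal (Real.exp (-κ)) ^ k *
      ENNReal.ofReal (traceCLM E (NormedSpace.exp (-θ • S))))
    (fun k => (hexpc.measurable.ennreal_ofReal).const_mul _) (hcont.measurable.comp hw)
    (fun S a hS => hS.add (isPositive_rankOne_self (𝕜 := ℝ) (w a)))
    (fun k S hS => by
      refine le_of_eq_of_le (lintegral_const_mul _ ((hexpc.measurable.comp
        ((hcont.measurable.comp hw).const_add S)).ennreal_ofReal)) ?_
      rw [pow_succ, mul_assoc]
      gcongr
      exact lintegral_trace_exp_le hw hR0 hR hiso hθ0 hS)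
    n (s := 0) ContinuousLinearMap.isPositive_zero
  simp only [pow_zero, one_mul, zero_add, smul_zero, NormedSpace.exp_zero] at key
  have htr1 : traceCLM E 1 = Module.finrank ℝ E := LinearMap.trace_one ℝ E
  rw [htr1] at key
  set W : (Fin n → α) → ℝ := fun z =>
    traceCLM E (NormedSpace.exp (-θ • ∑ k, (fun x : E => rankOne ℝ x x) (w (z k)))) with hW
  have hWm : Measurable W := hexpc.measurable.comp
    (Finset.measurable_sum _ fun k _ => (hcont.measurable.comp hw).comp (measurable_pi_apply k))
  have hsub : {z : Fin n → α | ∃ u : E, ∑ k, inner ℝ u (w (z k)) ^ 2 < n * ((1 - ε) * ‖u‖ ^ 2)} ⊆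
      {z | ENNReal.ofReal (Real.exp (-θ * (n * (1 - ε)))) ≤ ENNReal.ofReal (W z)} := by
    rintro z ⟨u, hu⟩
    refine ENNReal.ofReal_le_ofReal ?_
    have hS : (∑ k, rankOne ℝ (w (z k)) (w (z k))).IsPositive :=
      ContinuousLinearMap.isPositive_sum _ fun k _ => isPositive_rankOne_self (𝕜 := ℝ) (w (z k))
    obtain ⟨b, l, hb⟩ := exists_eigenbasis hS.isSymmetric
    have hWz : W z = ∑ i, Real.exp (-θ * l i) :=
      traceCLM_eq_sum b fun i => exp_apply_eigenvector (by rw [smul_apply, hb, smul_smul])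
    have hq : ∑ k, inner ℝ u (w (z k)) ^ 2 = ∑ i, inner ℝ (b i) u ^ 2 * l i := by
      rw [← inner_apply_eq_sum b hb, sum_apply, inner_sum]
      refine Finset.sum_congr rfl fun k _ => ?_
      rw [rankOne_apply, real_inner_smul_right, real_inner_comm u]; ring
    have hn : ‖u‖ ^ 2 = ∑ i, inner ℝ (b i) u ^ 2 := by
      simpa using (b.sum_sq_norm_inner_right u).symm
    -- A small value of the quadratic form forces a small eigenvalue, and its single term already
    -- makes the trace exponential large.
    obtain ⟨i, hi⟩ : ∃ i, l i < n * (1 - ε) := by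
      by_contra! hcon
      refine absurd hu (not_lt.2 ?_)
      rw [hq, hn, ← mul_assoc, Finset.mul_sum]
      exact Finset.sum_le_sum fun i _ => by
        rw [mul_comm]; exact mul_le_mul_of_nonneg_left (hcon i) (sq_nonneg _)
    rw [hWz]
    calc Real.exp (-θ * (n * (1 - ε))) ≤ Real.exp (-θ * l i) := by
          refine Real.exp_le_exp.2 ?_
          nlinarith
      _ ≤ _ := Finset.single_le_sum (f := fun i => Real.exp (-θ * l i))
          (fun i _ => (Real.exp_pos _).le) (Finset.mem_univ i)
  have hm := mul_meas_ge_le_lintegral₀ (μ := Measure.pi (fun _ : Fin n => ν))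
    (f := fun z => ENNReal.ofReal (W z)) hWm.ennreal_ofReal.aemeasurable
    (ENNReal.ofReal (Real.exp (-θ * (n * (1 - ε)))))
  have h1 := (mul_le_mul_right (measure_mono hsub) _).trans (hm.trans key)
  have hpos : ENNReal.ofReal (Real.exp (-θ * (n * (1 - ε)))) ≠ 0 := by simp [Real.exp_pos]
  rw [mul_comm, ← ENNReal.le_div_iff_mul_le (Or.inl hpos) (Or.inl ENNReal.ofReal_ne_top),
    ← ENNReal.ofReal_pow (Real.exp_pos _).le, ← Real.exp_nat_mul,
    ← ENNReal.ofReal_mul (Real.exp_pos _).le,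
    ← ENNReal.ofReal_div_of_pos (Real.exp_pos _)] at h1
  refine h1.trans (ENNReal.ofReal_le_ofReal ?_)
  rw [mul_comm, mul_div_assoc, ← Real.exp_sub]
  gcongr
  have hy : 0 ≤ θ * R := by positivity
  -- From `e^y ≥ 1 + y + y²/2` and `(1 + y + y²/2) (1 - y + y²/2) = 1 + y⁴/4`.
  have hexp2 : Real.exp (-(θ * R)) ≤ 1 - θ * R + (θ * R) ^ 2 / 2 := by
    rw [Real.exp_neg]
    have hq := Real.quadratic_le_exp_of_nonneg hy
    refine (inv_anti₀ (by positivity) hq).trans ?_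
    rw [inv_le_iff_one_le_mul₀ (by positivity)]
    nlinarith [sq_nonneg ((θ * R) ^ 2)]
  have hκ2 : θ - θ ^ 2 * R / 2 ≤ κ := by
    rw [hκ, le_div_iff₀ hR0]
    nlinarith
  have e1 : ε ^ 2 / (2 * R) = θ * ε - θ ^ 2 * R / 2 := by
    rw [hθ]; field_simp; ring
  have e2 : n * ε ^ 2 / (2 * R) = n * (θ * ε - θ ^ 2 * R / 2) := by rw [← e1]; ring
  rw [e2]
  have hn0 : (0 : ℝ) ≤ n := by positivity
  nlinarith [mul_le_mul_of_nonneg_left hκ2 hn0]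

end MatrixChernoff

/-! ### Squares of subgaussian variables -/

section SubgaussianSquares

/-- The series starts at order two, so scaling the argument by `c ≤ 1` gains at least `c²` in every
term. -/
theorem exp_sub_one_sub_id_mul_le {c y : ℝ} (hc0 : 0 ≤ c) (hc1 : c ≤ 1) (hy : 0 ≤ y) :
    Real.exp (c * y) - 1 - c * y ≤ c ^ 2 * (Real.exp y - 1 - y) := by
  have h : ∀ x : ℝ, HasSum (fun k : ℕ => x ^ (k + 2) / ((k + 2).factorial : ℝ))
      (Real.exp x - 1 - x) := fun x => by
    have h1 := NormedSpace.expSeries_div_hasSum_exp (𝔸 := ℝ) x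
    rw [← Real.exp_eq_exp_ℝ, ← hasSum_nat_add_iff' 2] at h1
    simpa [Finset.sum_range_succ, sub_sub] using h1
  refine hasSum_le (fun k => ?_) (h (c * y)) ((h y).mul_left (c ^ 2))
  rw [mul_pow, ← mul_div_assoc]
  have : c ^ (k + 2) ≤ c ^ 2 := pow_le_pow_of_le_one hc0 hc1 (by omega)
  gcongr

variable {α : Type*} [MeasurableSpace α] {ν : Measure α} [IsProbabilityMeasure ν]
  {Z : α → ℝ} {ρ : ℝ}

/-- Gaussian linearisation of the square reduces the claim to the moment generating function of `Z`,
and thereby to the square of a Gaussian. -/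
theorem lintegral_exp_mul_sq_le (hZ : Measurable Z) (hρ : 0 < ρ)
    (hmgf : ∀ l : ℝ, ∫⁻ a, ENNReal.ofReal (Real.exp (l * Z a)) ∂ν ≤
      ENNReal.ofReal (Real.exp (ρ * l ^ 2 / 2))) {s : ℝ} (h0 : 0 ≤ s) (hs : s < 1 / 2) :
    ∫⁻ a, ENNReal.ofReal (Real.exp (s / ρ * Z a ^ 2)) ∂ν ≤ ENNReal.ofReal (√(1 - 2 * s)⁻¹) := by
  have hsq : √(2 * (s / ρ)) ^ 2 = 2 * (s / ρ) := Real.sq_sqrt (by positivity)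
  have h1 : ∀ a, ENNReal.ofReal (Real.exp (s / ρ * Z a ^ 2)) =
      ∫⁻ g, ENNReal.ofReal (Real.exp (√(2 * (s / ρ)) * Z a * g)) ∂gaussianReal 0 1 := fun a => by
    rw [lintegral_exp_mul_gaussian, mul_pow, hsq]
    congr 2; ring
  simp only [h1]
  rw [lintegral_lintegral_swap (Measurable.aemeasurable (by fun_prop)),
    ← lintegral_exp_mul_sq_gaussian hs]
  refine lintegral_mono fun g => ?_
  have h2 : ∀ a, √(2 * (s / ρ)) * Z a * g = (√(2 * (s / ρ)) * g) * Z a := fun a => by ring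
  simp only [h2]
  refine (hmgf _).trans (ENNReal.ofReal_le_ofReal (Real.exp_le_exp.2 (le_of_eq ?_)))
  rw [mul_pow, hsq]; field_simp

theorem integrable_exp_mul_sq (hZ : Measurable Z) (hρ : 0 < ρ)
    (hmgf : ∀ l : ℝ, ∫⁻ a, ENNReal.ofReal (Real.exp (l * Z a)) ∂ν ≤
      ENNReal.ofReal (Real.exp (ρ * l ^ 2 / 2))) {s : ℝ} (h0 : 0 ≤ s) (hs : s < 1 / 2) :
    Integrable (fun a => Real.exp (s / ρ * Z a ^ 2)) ν ∧
      ∫ a, Real.exp (s / ρ * Z a ^ 2) ∂ν ≤ √(1 - 2 * s)⁻¹ := by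
  have h1 := lintegral_exp_mul_sq_le hZ hρ hmgf h0 hs
  have hi : Integrable (fun a => Real.exp (s / ρ * Z a ^ 2)) ν := by
    refine (lintegral_ofReal_ne_top_iff_integrable (by fun_prop)
      (Filter.Eventually.of_forall fun _ => (Real.exp_pos _).le)).1 ?_
    exact (h1.trans_lt ENNReal.ofReal_lt_top).ne
  refine ⟨hi, ?_⟩
  rw [← ofReal_integral_eq_lintegral_ofReal hi
    (Filter.Eventually.of_forall fun _ => (Real.exp_pos _).le)] at h1
  exact (ENNReal.ofReal_le_ofReal_iff (by positivity)).1 h1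

theorem integral_exp_sub_one_sub_id_le (hZ : Measurable Z) (hZ2 : Integrable (fun a => Z a ^ 2) ν)
    (hρ : 0 < ρ) (hmgf : ∀ l : ℝ, ∫⁻ a, ENNReal.ofReal (Real.exp (l * Z a)) ∂ν ≤
      ENNReal.ofReal (Real.exp (ρ * l ^ 2 / 2))) {s : ℝ} (h0 : 0 ≤ s) (hs : s < 1 / 2) :
    ∫ a, (Real.exp (s / ρ * Z a ^ 2) - 1 - s / ρ * Z a ^ 2) ∂ν ≤ 8 * s ^ 2 / (1 - 2 * s) := by
  have hs1 : 0 < 1 - 2 * s := by linarith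
  have hInt : ∀ r, 0 ≤ r → r < 1 / 2 →
      Integrable (fun a => Real.exp (r / ρ * Z a ^ 2) - 1) ν := fun r hr0 hr =>
    (integrable_exp_mul_sq hZ hρ hmgf hr0 hr).1.sub (integrable_const _)
  have hval : ∀ r, 0 ≤ r → r < 1 / 2 →
      ∫ a, (Real.exp (r / ρ * Z a ^ 2) - 1) ∂ν ≤ √(1 - 2 * r)⁻¹ - 1 := fun r hr0 hr => by
    rw [integral_sub (integrable_exp_mul_sq hZ hρ hmgf hr0 hr).1 (integrable_const _)]
    simpa using (integrable_exp_mul_sq hZ hρ hmgf hr0 hr).2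
  have hF : Integrable (fun a => Real.exp (s / ρ * Z a ^ 2) - 1 - s / ρ * Z a ^ 2) ν :=
    (hInt s h0 hs).sub (hZ2.const_mul _)
  -- At `3/8` the Gaussian bound `√(1 - 2s)⁻¹` equals `2`. Smaller `s` is compared with this value,
  -- giving `(8s/3)² ≤ 8s²`; for larger `s` one has `8s² > 1`, and the crude bound `√y ≤ y` for `y ≥
  -- 1` is enough.
  rcases le_or_gt s (3 / 8) with h38 | h38
  · have hle : ∀ a, Real.exp (s / ρ * Z a ^ 2) - 1 - s / ρ * Z a ^ 2 ≤
        (s / (3 / 8)) ^ 2 * (Real.exp (3 / 8 / ρ * Z a ^ 2) - 1) := fun a => by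
      have h1 := exp_sub_one_sub_id_mul_le (c := s / (3 / 8)) (y := 3 / 8 / ρ * Z a ^ 2)
        (by positivity) (by rw [div_le_one (by norm_num)]; exact h38) (by positivity)
      have e1 : s / (3 / 8) * (3 / 8 / ρ * Z a ^ 2) = s / ρ * Z a ^ 2 := by field_simp
      rw [e1] at h1
      refine h1.trans ?_
      have : 0 ≤ 3 / 8 / ρ * Z a ^ 2 := by positivity
      exact mul_le_mul_of_nonneg_left (by linarith) (sq_nonneg _)
    have h2 := integral_mono hF ((hInt (3 / 8) (by norm_num) (by norm_num)).const_mul _) hle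
    rw [integral_const_mul] at h2
    have h3 := hval (3 / 8) (by norm_num) (by norm_num)
    have e2 : √(1 - 2 * (3 / 8 : ℝ))⁻¹ = 2 := by
      rw [show (1 - 2 * (3 / 8 : ℝ))⁻¹ = 2 ^ 2 by norm_num, Real.sqrt_sq (by norm_num)]
    rw [e2] at h3
    refine h2.trans ?_
    rw [le_div_iff₀ hs1]
    have h4 : (s / (3 / 8)) ^ 2 * ∫ a, (Real.exp (3 / 8 / ρ * Z a ^ 2) - 1) ∂ν ≤
        (s / (3 / 8)) ^ 2 * 1 := by gcongr; linarith
    have h5 : (s / (3 / 8)) ^ 2 * 1 ≤ 8 * s ^ 2 := by nlinarith [sq_nonneg s]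
    have h6 : 0 ≤ 8 * s ^ 2 := by positivity
    nlinarith
  · have hle : ∀ a, Real.exp (s / ρ * Z a ^ 2) - 1 - s / ρ * Z a ^ 2 ≤
        Real.exp (s / ρ * Z a ^ 2) - 1 := fun a => by
      have : 0 ≤ s / ρ * Z a ^ 2 := by positivity
      linarith
    refine (integral_mono hF (hInt s h0 hs) hle).trans ((hval s h0 hs).trans ?_)
    have hy1 : 1 ≤ (1 - 2 * s)⁻¹ := (one_le_inv₀ hs1).2 (by linarith)
    have h1 : √(1 - 2 * s)⁻¹ ≤ (1 - 2 * s)⁻¹ :=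
      Real.sqrt_le_iff.2 ⟨by positivity, le_self_pow₀ hy1 two_ne_zero⟩
    have h2 : 1 * (1 - 2 * s)⁻¹ ≤ 8 * s ^ 2 * (1 - 2 * s)⁻¹ := by
      gcongr
      nlinarith
    rw [div_eq_mul_inv]
    linarith

/-- Both signs are controlled by the same remainder: `exp (-y) ≤ 1 - y + (e^y - 1 - y)` is `y ≤ sinh
y`. The unit second moment makes the first-order term cancel against the centring. -/
theorem lintegral_exp_sq_sub_one_le (hZ : Measurable Z) (hZ2 : Integrable (fun a => Z a ^ 2) ν)
    (hZ1 : ∫ a, Z a ^ 2 ∂ν = 1)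
    (hρ : 0 < ρ) (hmgf : ∀ l : ℝ, ∫⁻ a, ENNReal.ofReal (Real.exp (l * Z a)) ∂ν ≤
      ENNReal.ofReal (Real.exp (ρ * l ^ 2 / 2))) {s : ℝ} (h0 : 0 ≤ s) (hs : s < 1 / 2) {τ : ℝ}
    (hτ : τ = 1 ∨ τ = -1) :
    ∫⁻ a, ENNReal.ofReal (Real.exp (s * (τ * (Z a ^ 2 - 1) / ρ))) ∂ν ≤
      ENNReal.ofReal (Real.exp (8 * s ^ 2 / (1 - 2 * s))) := by
  have hF := integral_exp_sub_one_sub_id_le hZ hZ2 hρ hmgf h0 hs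
  set l := s / ρ with hl
  have hl0 : 0 ≤ l := by positivity
  have hFi : Integrable (fun a => Real.exp (l * Z a ^ 2) - 1 - l * Z a ^ 2) ν :=
    ((integrable_exp_mul_sq hZ hρ hmgf h0 hs).1.sub (integrable_const _)).sub (hZ2.const_mul _)
  have hle : ∀ a, Real.exp (s * (τ * (Z a ^ 2 - 1) / ρ)) ≤
      Real.exp (-(τ * l)) * ((1 + τ * l * Z a ^ 2) +
        (Real.exp (l * Z a ^ 2) - 1 - l * Z a ^ 2)) := fun a => by
    have e1 : s * (τ * (Z a ^ 2 - 1) / ρ) = -(τ * l) + τ * (l * Z a ^ 2) := by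
      rw [hl]; field_simp; ring
    rw [e1, Real.exp_add]
    gcongr
    have hy : 0 ≤ l * Z a ^ 2 := by positivity
    rcases hτ with rfl | rfl
    · rw [one_mul]; linarith
    · have := Real.self_le_sinh_iff.2 hy
      rw [Real.sinh_eq] at this
      rw [neg_one_mul]
      linarith
  have hi1 : Integrable (fun a => 1 + τ * l * Z a ^ 2) ν :=
    (integrable_const _).add (hZ2.const_mul _)
  have hi : Integrable (fun a => Real.exp (-(τ * l)) * ((1 + τ * l * Z a ^ 2) +
        (Real.exp (l * Z a ^ 2) - 1 - l * Z a ^ 2))) ν := (hi1.add hFi).const_mul _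
  refine (lintegral_mono fun a => ENNReal.ofReal_le_ofReal (hle a)).trans ?_
  rw [← ofReal_integral_eq_lintegral_ofReal hi
    (Filter.Eventually.of_forall fun a => (Real.exp_pos _).le.trans (hle a))]
  refine ENNReal.ofReal_le_ofReal ?_
  rw [integral_const_mul, integral_add hi1 hFi, integral_add (integrable_const _)
    (hZ2.const_mul _), integral_const_mul, hZ1]
  simp only [integral_const, probReal_univ, one_smul, mul_one]
  set Q := 8 * s ^ 2 / (1 - 2 * s)
  calc Real.exp (-(τ * l)) * (1 + τ * l + ∫ a, (Real.exp (l * Z a ^ 2) - 1 - l * Z a ^ 2) ∂ν)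
      ≤ Real.exp (-(τ * l)) * Real.exp (τ * l + Q) := by
        gcongr
        have := Real.add_one_le_exp (τ * l + Q)
        linarith
    _ = Real.exp Q := by rw [← Real.exp_add]; congr 1; ring

theorem measure_sum_sq_sub_one_le (hZ : Measurable Z) (hZ2 : Integrable (fun a => Z a ^ 2) ν)
    (hZ1 : ∫ a, Z a ^ 2 ∂ν = 1)
    (hρ : 0 < ρ) (hmgf : ∀ l : ℝ, ∫⁻ a, ENNReal.ofReal (Real.exp (l * Z a)) ∂ν ≤
      ENNReal.ofReal (Real.exp (ρ * l ^ 2 / 2))) {n : ℕ} (hn : 0 < n) {t : ℝ} (ht : 0 ≤ t) :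
    Measure.pi (fun _ : Fin n => ν)
        {z | ρ * (2 * √(8 * n * t) + 2 * t) < |∑ k, Z (z k) ^ 2 - n|} ≤
      ENNReal.ofReal (2 * Real.exp (-t)) := by
  have key : ∀ τ : ℝ, (τ = 1 ∨ τ = -1) → Measure.pi (fun _ : Fin n => ν)
      {z | 2 * √(8 * n * t) + 2 * t < ∑ k, τ * (Z (z k) ^ 2 - 1) / ρ} ≤
        ENNReal.ofReal (Real.exp (-t)) := fun τ hτ => by
    refine measure_lt_le_of_subgamma (by fun_prop) (by positivity) ht fun s h0 hs => ?_
    have h1 : ∀ z : Fin n → α,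
        ENNReal.ofReal (Real.exp (s * ∑ k, τ * (Z (z k) ^ 2 - 1) / ρ)) =
        ∏ k, ENNReal.ofReal (Real.exp (s * (τ * (Z (z k) ^ 2 - 1) / ρ))) := fun z => by
      rw [Finset.mul_sum, Real.exp_sum,
        ENNReal.ofReal_prod_of_nonneg fun _ _ => (Real.exp_pos _).le]
    simp only [h1]
    rw [lintegral_pi_prod ν
      (f := fun _ a => ENNReal.ofReal (Real.exp (s * (τ * (Z a ^ 2 - 1) / ρ))))
      (fun k => by fun_prop), Finset.prod_const, Finset.card_univ, Fintype.card_fin]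
    calc _ ≤ ENNReal.ofReal (Real.exp (8 * s ^ 2 / (1 - 2 * s))) ^ n := by
          gcongr
          exact lintegral_exp_sq_sub_one_le hZ hZ2 hZ1 hρ hmgf h0 hs hτ
      _ = _ := by
          rw [← ENNReal.ofReal_pow (Real.exp_pos _).le, ← Real.exp_nat_mul]
          congr 2; ring
  have hsum : ∀ (τ : ℝ) (z : Fin n → α), ∑ k, τ * (Z (z k) ^ 2 - 1) / ρ =
      τ * (∑ k, Z (z k) ^ 2 - n) / ρ := fun τ z => by
    rw [← Finset.sum_div, ← Finset.mul_sum, Finset.sum_sub_distrib]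
    simp
  have hsub : {z : Fin n → α | ρ * (2 * √(8 * n * t) + 2 * t) < |∑ k, Z (z k) ^ 2 - n|} ⊆
      {z | 2 * √(8 * n * t) + 2 * t < ∑ k, 1 * (Z (z k) ^ 2 - 1) / ρ} ∪
      {z | 2 * √(8 * n * t) + 2 * t < ∑ k, -1 * (Z (z k) ^ 2 - 1) / ρ} := fun z hz => by
    simp only [Set.mem_union, Set.mem_ofPred_eq, hsum, lt_div_iff₀' hρ] at hz ⊢
    rcases lt_abs.1 hz with h | h
    · left; linarith
    · right; linarith
  refine (measure_mono hsub).trans ((measure_union_le _ _).trans ?_)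
  refine (add_le_add (key 1 (Or.inl rfl)) (key (-1) (Or.inr rfl))).trans_eq ?_
  rw [← ENNReal.ofReal_add (Real.exp_pos _).le (Real.exp_pos _).le]
  congr 1; ring

end SubgaussianSquares

/-! ### A net argument for the smallest eigenvalue -/

section Net

open InnerProductSpace Metric

variable {E : Type*} [NormedAddCommGroup E] [InnerProductSpace ℝ E] [FiniteDimensional ℝ E]

/-- A volume comparison: the balls of radius `1/40` around the points are disjoint and lie in the
ball of radius `41/40`. -/
theorem card_le_of_separated_sphere (s : Finset E) (hs : ∀ c ∈ s, ‖c‖ = 1)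
    (h : ∀ c ∈ s, ∀ d ∈ s, c ≠ d → 1 / 20 ≤ ‖c - d‖) : s.card ≤ 41 ^ Module.finrank ℝ E := by
  borelize E
  let μ : Measure E := Measure.addHaar
  have D : Set.Pairwise (s : Set E) (Function.onFun Disjoint fun c => ball (c : E) (1 / 40)) := by
    rintro c hc d hd hcd
    apply ball_disjoint_ball
    rw [dist_eq_norm]
    exact le_trans (by norm_num) (h c hc d hd hcd)
  have hsub : ⋃ c ∈ s, ball (c : E) (1 / 40) ⊆ ball (0 : E) (41 / 40) := by
    refine Set.iUnion₂_subset fun x hx => ?_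
    apply ball_subset_ball'
    rw [dist_zero_right, hs x hx]; norm_num
  have hI : (s.card : ENNReal) * ENNReal.ofReal ((1 / 40) ^ Module.finrank ℝ E) * μ (ball 0 1) ≤
      ENNReal.ofReal ((41 / 40) ^ Module.finrank ℝ E) * μ (ball 0 1) :=
    calc (s.card : ENNReal) * ENNReal.ofReal ((1 / 40) ^ Module.finrank ℝ E) * μ (ball 0 1)
        = μ (⋃ c ∈ s, ball (c : E) (1 / 40)) := by
          rw [measure_biUnion_finset D fun c _ => measurableSet_ball]
          simp only [μ.addHaar_ball_of_pos _ (by norm_num : (0 : ℝ) < 1 / 40), Finset.sum_const,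
            nsmul_eq_mul, mul_assoc]
      _ ≤ μ (ball (0 : E) (41 / 40)) := measure_mono hsub
      _ = _ := μ.addHaar_ball_of_pos _ (by norm_num)
  have hJ := (ENNReal.mul_le_mul_iff_left (measure_ball_pos μ _ zero_lt_one).ne'
    measure_ball_lt_top.ne).1 hI
  have hK := ENNReal.toReal_le_of_le_ofReal (by positivity) hJ
  simp only [ENNReal.toReal_mul, ENNReal.toReal_natCast] at hK
  rw [ENNReal.toReal_ofReal (by positivity), div_pow, div_pow, one_pow, mul_one_div] at hK
  have := (div_le_div_iff_of_pos_right (by positivity)).1 hK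
  exact_mod_cast this

/-- A separated set of largest cardinality is a net, since a point far from all of it could be
added. The volume bound guarantees that a largest cardinality exists. -/
theorem exists_sphere_net (E : Type*) [NormedAddCommGroup E] [InnerProductSpace ℝ E]
    [FiniteDimensional ℝ E] : ∃ N : Finset E, (∀ v ∈ N, ‖v‖ = 1) ∧
      N.card ≤ 41 ^ Module.finrank ℝ E ∧ ∀ u : E, ‖u‖ = 1 → ∃ v ∈ N, ‖u - v‖ ≤ 1 / 20 := by
  classical
  let p : ℕ → Prop := fun m => ∃ N : Finset E, N.card = m ∧ (∀ v ∈ N, ‖v‖ = 1) ∧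
    ∀ c ∈ N, ∀ d ∈ N, c ≠ d → 1 / 20 ≤ ‖c - d‖
  have hp0 : p 0 := ⟨∅, by simp⟩
  have hbound : ∀ m, p m → m ≤ 41 ^ Module.finrank ℝ E := by
    rintro m ⟨N, rfl, h1, h2⟩
    exact card_le_of_separated_sphere N h1 h2
  obtain ⟨N, hN, h1, h2⟩ := Nat.findGreatest_spec (P := p) (Nat.zero_le (41 ^ Module.finrank ℝ E)) hp0
  refine ⟨N, h1, card_le_of_separated_sphere N h1 h2, fun u hu => ?_⟩
  by_contra! hcon
  have huN : u ∉ N := fun h => absurd (hcon u h) (by norm_num)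
  have hp : p (N.card + 1) := by
    refine ⟨insert u N, Finset.card_insert_of_notMem huN, ?_, ?_⟩
    · simpa [hu] using h1
    · intro c hc d hd hcd
      rcases Finset.mem_insert.1 hc with rfl | hc' <;> rcases Finset.mem_insert.1 hd with rfl | hd'
      · exact absurd rfl hcd
      · exact (hcon d hd').le
      · rw [norm_sub_rev]; exact (hcon c hc').le
      · exact h2 c hc' d hd' hcd
  have := Nat.le_findGreatest (hbound _ hp) hp
  omega

/-- Let `l` be the eigenvalue of largest modulus. Moving from its unit eigenvector to a net point
changes the quadratic form by at most `2 · |l| / 20`, hence `(9/10) |l| ≤ c`. -/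
theorem abs_inner_le_of_net {T : E →L[ℝ] E} (hT : (T : E →ₗ[ℝ] E).IsSymmetric) {N : Finset E}
    (hN1 : ∀ v ∈ N, ‖v‖ = 1) (hN : ∀ u : E, ‖u‖ = 1 → ∃ v ∈ N, ‖u - v‖ ≤ 1 / 20) {c : ℝ}
    (hc : ∀ v ∈ N, |inner ℝ v (T v)| ≤ c) (u : E) : |inner ℝ u (T u)| ≤ 10 / 9 * c * ‖u‖ ^ 2 := by
  obtain ⟨b, l, hb⟩ := exists_eigenbasis hT
  rcases isEmpty_or_nonempty (Fin (Module.finrank ℝ E)) with he | he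
  · have : u = 0 := by rw [← b.sum_repr' u]; simp
    simp [this]
  obtain ⟨a, ha⟩ := Finite.exists_max fun i => |l i|
  have hTn : ∀ v, ‖T v‖ ≤ |l a| * ‖v‖ := fun v => by
    refine abs_le_of_sq_le_sq' ?_ (by positivity) |>.2
    have h1 : ∀ i, inner ℝ (b i) (T v) = l i * inner ℝ (b i) v := fun i => by
      have := hT (b i) v
      simp only [ContinuousLinearMap.coe_coe] at this
      rw [← this, hb, real_inner_smul_left]
    have h2 : ‖T v‖ ^ 2 = ∑ i, inner ℝ (b i) (T v) ^ 2 := by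
      simpa using (b.sum_sq_norm_inner_right (T v)).symm
    have h3 : ‖v‖ ^ 2 = ∑ i, inner ℝ (b i) v ^ 2 := by
      simpa using (b.sum_sq_norm_inner_right v).symm
    rw [h2, mul_pow, h3, Finset.mul_sum]
    refine Finset.sum_le_sum fun i _ => ?_
    rw [h1, mul_pow, ← sq_abs (l i)]
    exact mul_le_mul_of_nonneg_right (pow_le_pow_left₀ (abs_nonneg _) (ha i) 2) (sq_nonneg _)
  have hba : ‖b a‖ = 1 := b.norm_eq_one a
  obtain ⟨v, hv, hvb⟩ := hN (b a) hba
  have hla : inner ℝ (b a) (T (b a)) = l a := by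
    rw [hb, real_inner_smul_right, real_inner_self_eq_norm_sq, hba]; ring
  have hdiff : l a = inner ℝ v (T v) + inner ℝ (b a - v) (T (b a)) + inner ℝ (T v) (b a - v) := by
    have := hT v (b a)
    simp only [ContinuousLinearMap.coe_coe] at this
    rw [← hla, inner_sub_left, inner_sub_right, this, real_inner_comm v (T v)]
    ring
  have e1 : |inner ℝ (b a - v) (T (b a))| ≤ 1 / 20 * |l a| := by
    refine (abs_real_inner_le_norm _ _).trans ?_
    have := hTn (b a)
    rw [hba, mul_one] at this
    gcongr
  have e2 : |inner ℝ (T v) (b a - v)| ≤ |l a| * (1 / 20) := by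
    refine (abs_real_inner_le_norm _ _).trans ?_
    have := hTn v
    rw [hN1 v hv, mul_one] at this
    gcongr
  have h3 : |l a| ≤ c + 1 / 20 * |l a| + |l a| * (1 / 20) := by
    conv_lhs => rw [hdiff]
    refine (abs_add_le _ _).trans (add_le_add ((abs_add_le _ _).trans (add_le_add (hc v hv) e1)) e2)
  have h4 : |l a| ≤ 10 / 9 * c := by linarith
  calc |inner ℝ u (T u)| ≤ ‖u‖ * ‖T u‖ := abs_real_inner_le_norm _ _
    _ ≤ ‖u‖ * (|l a| * ‖u‖) := by gcongr; exact hTn u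
    _ = |l a| * ‖u‖ ^ 2 := by ring
    _ ≤ _ := by gcongr

variable [MeasurableSpace E] [BorelSpace E] {α : Type*} [MeasurableSpace α] {ν : Measure α}
  [IsProbabilityMeasure ν] {w : α → E}

/-- The smallest eigenvalue of a sum of independent isotropic subgaussian rank-one operators. -/
theorem measure_exists_sum_inner_sq_lt_le_of_subgaussian (hw : Measurable w) {ρ : ℝ} (hρ : 0 < ρ)
    (hInt : ∀ u : E, Integrable (fun a => inner ℝ u (w a) ^ 2) ν)
    (hiso : ∀ u : E, ∫ a, inner ℝ u (w a) ^ 2 ∂ν = ‖u‖ ^ 2)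
    (hmgf : ∀ u : E, ∫⁻ a, ENNReal.ofReal (Real.exp (inner ℝ u (w a))) ∂ν ≤
      ENNReal.ofReal (Real.exp (ρ * ‖u‖ ^ 2 / 2))) {n : ℕ} (hn : 0 < n) {t : ℝ} (ht : 0 ≤ t) :
    Measure.pi (fun _ : Fin n => ν)
        {z | ∃ u : E, ∑ k, inner ℝ u (w (z k)) ^ 2 <
          n * ((1 - 10 * ρ / 9 * (√(32 * t / n) + 2 * t / n)) * ‖u‖ ^ 2)} ≤
      ENNReal.ofReal (41 ^ Module.finrank ℝ E * (2 * Real.exp (-t))) := by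
  obtain ⟨N, hN1, hNc, hN⟩ := exists_sphere_net E
  have hn' : (0 : ℝ) < n := by exact_mod_cast hn
  have hsub : {z : Fin n → α | ∃ u : E, ∑ k, inner ℝ u (w (z k)) ^ 2 <
          n * ((1 - 10 * ρ / 9 * (√(32 * t / n) + 2 * t / n)) * ‖u‖ ^ 2)} ⊆
      ⋃ v ∈ N, {z | ρ * (2 * √(8 * n * t) + 2 * t) < |∑ k, inner ℝ v (w (z k)) ^ 2 - n|} := by
    rintro z ⟨u, hu⟩
    by_contra hcon
    simp only [Set.mem_iUnion, Set.mem_ofPred_eq, not_exists, not_lt] at hcon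
    -- The net argument needs a two-sided bound for a symmetric operator, so it is applied to the
    -- deviation from the mean `n • 1`; only the lower side is used afterwards.
    set T : E →L[ℝ] E := (∑ k, rankOne ℝ (w (z k)) (w (z k))) - (n : ℝ) • 1 with hT
    have hTs : (T : E →ₗ[ℝ] E).IsSymmetric :=
      ((ContinuousLinearMap.isPositive_sum _ fun k _ =>
        isPositive_rankOne_self (𝕜 := ℝ) (w (z k))).isSelfAdjoint.sub
          ((IsSelfAdjoint.all (n : ℝ)).smul (IsSelfAdjoint.one _))).isSymmetric
    have hq : ∀ v, inner ℝ v (T v) = ∑ k, inner ℝ v (w (z k)) ^ 2 - n * ‖v‖ ^ 2 := fun v => by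
      rw [hT, sub_apply, sum_apply, inner_sub_right, inner_sum, smul_apply, one_apply_eq_self,
        real_inner_smul_right, real_inner_self_eq_norm_sq]
      congr 1
      refine Finset.sum_congr rfl fun k _ => ?_
      rw [rankOne_apply, real_inner_smul_right, real_inner_comm v]; ring
    have h1 := abs_inner_le_of_net hTs hN1 hN (c := ρ * (2 * √(8 * n * t) + 2 * t))
      (fun v hv => by rw [hq, hN1 v hv]; simpa using hcon v hv) u
    rw [hq] at h1
    have h2 := (abs_le.1 h1).1
    have e1 : n * √(32 * t / n) = 2 * √(8 * n * t) := by
      have : 32 * t / n * n ^ 2 = 2 ^ 2 * (8 * n * t) := by field_simp; ring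
      have h3 : √(32 * t / n * n ^ 2) = √(2 ^ 2 * (8 * n * t)) := by rw [this]
      rw [Real.sqrt_mul (by positivity), Real.sqrt_sq hn'.le, Real.sqrt_mul (by positivity),
        Real.sqrt_sq (by norm_num)] at h3
      linarith
    have e2 : n * ((1 - 10 * ρ / 9 * (√(32 * t / n) + 2 * t / n)) * ‖u‖ ^ 2) =
        n * ‖u‖ ^ 2 - 10 / 9 * (ρ * (n * √(32 * t / n) + 2 * t)) * ‖u‖ ^ 2 := by
      field_simp
    rw [e2, e1] at hu
    linarith
  refine (measure_mono hsub).trans ((measure_biUnion_finset_le _ _).trans ?_)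
  calc _ ≤ ∑ _v ∈ N, ENNReal.ofReal (2 * Real.exp (-t)) := by
        refine Finset.sum_le_sum fun v hv => ?_
        refine measure_sum_sq_sub_one_le (by fun_prop) (hInt v) (by rw [hiso, hN1 v hv]; norm_num)
          hρ (fun l => ?_) hn ht
        have := hmgf (l • v)
        simpa [real_inner_smul_left, norm_smul, hN1 v hv] using this
    _ = N.card * ENNReal.ofReal (2 * Real.exp (-t)) := by simp
    _ ≤ _ := by
        have hc : (N.card : ENNReal) ≤ ENNReal.ofReal (41 ^ Module.finrank ℝ E) := by
          rw [ENNReal.ofReal_pow (by norm_num), ENNReal.ofReal_ofNat]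
          exact_mod_cast hNc
        rw [ENNReal.ofReal_mul (p := 41 ^ Module.finrank ℝ E) (by positivity)]
        exact mul_le_mul_left hc _

end Net

/-! ### Deterministic bounds for one sample -/

section Deterministic

open Matrix

variable {d n : ℕ}

theorem toEuclideanLin_mul_apply (M N : Matrix (Fin d) (Fin d) ℝ) (v : EuclideanSpace ℝ (Fin d)) :
    toEuclideanLin (M * N) v = toEuclideanLin M (toEuclideanLin N v) := by
  rw [toEuclideanLin, toLpLin_mul_same]; rfl

theorem toEuclideanLin_one_apply (v : EuclideanSpace ℝ (Fin d)) :
    toEuclideanLin (1 : Matrix (Fin d) (Fin d) ℝ) v = v := by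
  rw [toEuclideanLin, toLpLin_one]; rfl

theorem inner_toEuclideanLin (M : Matrix (Fin d) (Fin d) ℝ) (hM : Mᵀ = M)
    (u v : EuclideanSpace ℝ (Fin d)) :
    inner ℝ u (toEuclideanLin M v) = inner ℝ (toEuclideanLin M u) v := by
  have h : M.IsHermitian := by rw [IsHermitian, conjTranspose_eq_transpose_of_trivial, hM]
  exact ((isSymmetric_toEuclideanLin_iff.2 h) u v).symm

theorem matNorm_eq {M : Matrix (Fin d) (Fin d) ℝ} (hM : M.PosSemidef)
    (v : EuclideanSpace ℝ (Fin d)) : matNorm M v = ‖toEuclideanLin (halfPow M) v‖ := by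
  rw [matNorm]
  nth_rewrite 1 [← halfPow_mul_self hM]
  rw [toEuclideanLin_mul_apply, inner_toEuclideanLin _ (transpose_halfPow M),
    real_inner_self_eq_norm_sq, Real.sqrt_sq (norm_nonneg _)]

theorem toEuclideanLin_empSecondMoment (x : Fin n → EuclideanSpace ℝ (Fin d))
    (v : EuclideanSpace ℝ (Fin d)) :
    toEuclideanLin (empSecondMoment x) v = empMean fun k => inner ℝ (x k) v • x k := by
  ext i
  simp only [ofLp_toLpLin, toLin'_apply, mulVec, dotProduct, empSecondMoment, Matrix.of_apply,
    empMean, PiLp.smul_apply, smul_eq_mul, PiLp.inner_apply, WithLp.ofLp_sum, Finset.sum_apply,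
    RCLike.inner_apply, conj_trivial, Finset.sum_mul, Finset.mul_sum, Finset.sum_div]
  rw [Finset.sum_comm]
  exact Finset.sum_congr rfl fun k _ => Finset.sum_congr rfl fun j _ => by ring

theorem inner_toEuclideanLin_empSecondMoment (x : Fin n → EuclideanSpace ℝ (Fin d))
    (v : EuclideanSpace ℝ (Fin d)) :
    inner ℝ v (toEuclideanLin (empSecondMoment x) v) =
      (n : ℝ)⁻¹ * ∑ k, inner ℝ v (x k) ^ 2 := by
  rw [toEuclideanLin_empSecondMoment, empMean, real_inner_smul_right, inner_sum]
  congr 1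
  refine Finset.sum_congr rfl fun k _ => ?_
  rw [real_inner_smul_right, real_inner_comm v]; ring

theorem empContribution_eq (x : Fin n → EuclideanSpace ℝ (Fin d)) (u : Fin n → ℝ) :
    empContribution x u =
      toEuclideanLin (empSecondMoment x)⁻¹ (empMean fun k => u k • x k) := by
  simp [empContribution, empMean]

/-- This identity connects the noise contribution to the projection whose quadratic form has
chi-squared moments. -/
theorem inner_empMean_eq (x : Fin n → EuclideanSpace ℝ (Fin d)) (u : Fin n → ℝ) :
    inner ℝ (empMean fun k => u k • x k)
      (toEuclideanLin (empSecondMoment x)⁻¹ (empMean fun k => u k • x k)) =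
      (n : ℝ)⁻¹ * (u ⬝ᵥ hatMatrix x *ᵥ u) := by
  have h1 : (empMean fun k => u k • x k) =
      WithLp.toLp 2 ((n : ℝ)⁻¹ • ((designMatrix x)ᵀ *ᵥ u)) := by
    ext i
    simp only [empMean, PiLp.smul_apply, WithLp.ofLp_sum, Finset.sum_apply, smul_eq_mul,
      Pi.smul_apply, mulVec, dotProduct, Matrix.transpose_apply, designMatrix, Matrix.of_apply]
    congr 1
    exact Finset.sum_congr rfl fun k _ => by simp [mul_comm]
  rw [h1, EuclideanSpace.inner_eq_star_dotProduct]
  simp only [ofLp_toLpLin, toLin'_apply, star_trivial]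
  have h2 : ∀ v, u ⬝ᵥ designMatrix x *ᵥ v = v ⬝ᵥ (designMatrix x)ᵀ *ᵥ u := fun v => by
    rw [dotProduct_mulVec, ← mulVec_transpose, dotProduct_comm]
  simp only [hatMatrix, smul_mulVec, ← mulVec_mulVec, mulVec_smul, smul_dotProduct,
    dotProduct_smul, smul_eq_mul, h2]

section

variable {S : Matrix (Fin d) (Fin d) ℝ} {x : Fin n → EuclideanSpace ℝ (Fin d)} {K : ℝ}

/-- The whitened sample has smallest eigenvalue at least `K⁻¹`. -/
def WhitenedLowerBound (S : Matrix (Fin d) (Fin d) ℝ) (x : Fin n → EuclideanSpace ℝ (Fin d))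
    (K : ℝ) : Prop :=
  ∀ u, n * (K⁻¹ * ‖u‖ ^ 2) ≤ ∑ k, inner ℝ u (toEuclideanLin (negHalfPow S) (x k)) ^ 2

theorem WhitenedLowerBound.le_inner (h : WhitenedLowerBound S x K) (hn : 0 < n)
    (q : EuclideanSpace ℝ (Fin d)) :
    K⁻¹ * ‖q‖ ^ 2 ≤ inner ℝ (toEuclideanLin (negHalfPow S) q)
      (toEuclideanLin (empSecondMoment x) (toEuclideanLin (negHalfPow S) q)) := by
  have hn' : (0 : ℝ) < n := by exact_mod_cast hn
  rw [inner_toEuclideanLin_empSecondMoment, le_inv_mul_iff₀ hn']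
  refine (h q).trans_eq (Finset.sum_congr rfl fun k _ => ?_)
  rw [inner_toEuclideanLin _ (transpose_negHalfPow S)]

theorem WhitenedLowerBound.posDef (h : WhitenedLowerBound S x K) (hS : S.PosSemidef)
    (hSu : IsUnit S) (hn : 0 < n) (hK : 0 < K) : (empSecondMoment x).PosDef := by
  refine PosDef.of_dotProduct_mulVec_pos (posSemidef_empSecondMoment x).isHermitian fun v hv => ?_
  have h1 := h.le_inner hn (toEuclideanLin (halfPow S) (WithLp.toLp 2 v))
  rw [← toEuclideanLin_mul_apply, negHalfPow_mul_halfPow hS hSu, toEuclideanLin_one_apply] at h1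
  have h2 : toEuclideanLin (halfPow S) (WithLp.toLp 2 v) ≠ 0 := by
    intro h0
    have h3 := congrArg (toEuclideanLin (negHalfPow S)) h0
    rw [← toEuclideanLin_mul_apply, negHalfPow_mul_halfPow hS hSu, toEuclideanLin_one_apply,
      map_zero] at h3
    exact hv (by simpa using h3)
  have h4 : 0 < K⁻¹ * ‖toEuclideanLin (halfPow S) (WithLp.toLp 2 v)‖ ^ 2 := by
    have := norm_pos_iff.2 h2
    positivity
  refine (h4.trans_le h1).trans_eq ?_
  rw [EuclideanSpace.inner_eq_star_dotProduct, dotProduct_comm]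
  simp

/-- At `q = Σ^(1/2) Σ̂⁻¹ m` the whitening is undone and the form collapses to `⟨m, Σ̂⁻¹ m⟩`. Only
one factor `K` is spent, which is why the noise bound has `K` and not `K²`. -/
theorem WhitenedLowerBound.norm_le (h : WhitenedLowerBound S x K) (hS : S.PosSemidef)
    (hSu : IsUnit S) (hn : 0 < n) (hK : 0 < K) (m : EuclideanSpace ℝ (Fin d)) :
    ‖toEuclideanLin (halfPow S) (toEuclideanLin (empSecondMoment x)⁻¹ m)‖ ^ 2 ≤
      K * inner ℝ m (toEuclideanLin (empSecondMoment x)⁻¹ m) := by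
  have hu := (h.posDef hS hSu hn hK).isUnit
  have h1 := h.le_inner hn
    (toEuclideanLin (halfPow S) (toEuclideanLin (empSecondMoment x)⁻¹ m))
  rw [← toEuclideanLin_mul_apply (negHalfPow S), negHalfPow_mul_halfPow hS hSu,
    toEuclideanLin_one_apply, ← toEuclideanLin_mul_apply (empSecondMoment x),
    mul_nonsing_inv _ ((isUnit_iff_isUnit_det _).1 hu), toEuclideanLin_one_apply,
    real_inner_comm] at h1
  rwa [inv_mul_le_iff₀ hK] at h1

/-- For `m = Σ^(1/2) y` the previous bound reads `‖q‖² ≤ K ⟨y, q⟩`; Cauchy–Schwarz and division by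
`‖q‖` finish. -/
theorem WhitenedLowerBound.norm_whitened_le (h : WhitenedLowerBound S x K) (hS : S.PosSemidef)
    (hSu : IsUnit S) (hn : 0 < n) (hK : 0 < K) (y : EuclideanSpace ℝ (Fin d)) :
    ‖toEuclideanLin (halfPow S * (empSecondMoment x)⁻¹ * halfPow S) y‖ ≤ K * ‖y‖ := by
  have h1 := h.norm_le hS hSu hn hK (toEuclideanLin (halfPow S) y)
  rw [← inner_toEuclideanLin _ (transpose_halfPow S)] at h1
  rw [Matrix.mul_assoc, toEuclideanLin_mul_apply, toEuclideanLin_mul_apply]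
  set q := toEuclideanLin (halfPow S)
    (toEuclideanLin (empSecondMoment x)⁻¹ (toEuclideanLin (halfPow S) y)) with hq
  have h2 := real_inner_le_norm y q
  rcases (norm_nonneg q).eq_or_lt with h0 | h0
  · rw [← h0]; positivity
  · have h3 : ‖q‖ * ‖q‖ ≤ K * ‖y‖ * ‖q‖ := by
      calc ‖q‖ * ‖q‖ = ‖q‖ ^ 2 := (sq _).symm
        _ ≤ K * inner ℝ y q := h1
        _ ≤ K * (‖y‖ * ‖q‖) := by gcongr
        _ = _ := by ring
    exact le_of_mul_le_mul_right h3 h0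

end

/-- The linear part of the response contributes `Σ̂ β` to the empirical mean, and `Σ̂⁻¹` returns `β`
exactly. -/
theorem ols_sub_eq {x : Fin n → EuclideanSpace ℝ (Fin d)} (hu : IsUnit (empSecondMoment x))
    (y b e : Fin n → ℝ) (β : EuclideanSpace ℝ (Fin d))
    (hy : ∀ k, y k = b k + e k + inner ℝ (x k) β) :
    ols x y - β = empContribution x b + empContribution x e := by
  have h1 : (empMean fun k => y k • x k) = (empMean fun k => b k • x k) +
      (empMean fun k => e k • x k) + toEuclideanLin (empSecondMoment x) β := by
    rw [toEuclideanLin_empSecondMoment]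
    simp only [empMean, ← smul_add, ← Finset.sum_add_distrib, ← add_smul, hy]
  rw [ols, h1, map_add, map_add, ← toEuclideanLin_mul_apply,
    nonsing_inv_mul _ ((isUnit_iff_isUnit_det _).1 hu), toEuclideanLin_one_apply,
    empContribution_eq, empContribution_eq]
  abel

theorem sampleBounds_of_whitenedLowerBound {Ω : Type*} [MeasurableSpace Ω] {μ : Measure Ω}
    [IsFiniteMeasure μ] {X : Ω → EuclideanSpace ℝ (Fin d)} {Y : Ω → ℝ} {σ B δ K : ℝ}
    {x : Fin n → EuclideanSpace ℝ (Fin d)} {y : Fin n → ℝ} (hS : (secondMoment μ X).PosSemidef)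
    (hSu : IsUnit (secondMoment μ X)) (hn : 0 < n) (hK : 0 < K)
    (h : WhitenedLowerBound (secondMoment μ X) x K)
    (happ : ‖∑ k, whitenedApprox μ X Y (x k)‖ ^ 2 ≤
      4 * (n * ∫ ω, ‖whitenedApprox μ X Y (X ω)‖ ^ 2 ∂μ) * (1 + 8 * Real.log (1 / δ)) +
        3 * (B * √d) ^ 2 * Real.log (1 / δ) ^ 2)
    (hnoise : (fun k => noise μ X Y (x k) (y k)) ⬝ᵥ hatMatrix x *ᵥ
        (fun k => noise μ X Y (x k) (y k)) ≤
      σ ^ 2 * (d + 2 * √(d * Real.log (1 / δ)) + 2 * Real.log (1 / δ))) :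
    SampleBounds μ X Y σ B δ K x y := by
  have hn' : (0 : ℝ) < n := by exact_mod_cast hn
  have hpd := h.posDef hS hSu hn hK
  set S := secondMoment μ X with hSdef
  have hexc : matNorm S (ols x y - popCoef μ X Y) ≤
      matNorm S (empContribution x fun k => approxErr μ X Y (x k)) +
      matNorm S (empContribution x fun k => noise μ X Y (x k) (y k)) := by
    rw [ols_sub_eq hpd.isUnit y (fun k => approxErr μ X Y (x k))
      (fun k => noise μ X Y (x k) (y k)) (popCoef μ X Y)
      fun k => by simp only [approxErr, noise]; ring]
    rw [matNorm_eq hS, matNorm_eq hS, matNorm_eq hS, map_add]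
    exact norm_add_le _ _
  refine ⟨hpd, ?_, ?_, ?_, hexc, ?_⟩
  · refine ContinuousLinearMap.opNorm_le_bound _ hK.le fun v => ?_
    exact h.norm_whitened_le hS hSu hn hK v
  · rw [matNorm_eq hS, empContribution_eq]
    -- Pulling `Σ^(1/2)` out of the mean exposes the matrix `Σ^(1/2) Σ̂⁻¹ Σ^(1/2)` acting on a mean
    -- of whitened vectors; its norm bound, squared, gives `K²`.
    have h1 : (empMean fun k => approxErr μ X Y (x k) • x k) = toEuclideanLin (halfPow S)
        ((n : ℝ)⁻¹ • ∑ k, whitenedApprox μ X Y (x k)) := by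
      simp only [whitenedApprox, empMean]
      rw [map_smul, map_sum]
      simp only [← toEuclideanLin_mul_apply, ← hSdef, halfPow_mul_negHalfPow hS hSu,
        toEuclideanLin_one_apply]
    have h2 := h.norm_whitened_le hS hSu hn hK ((n : ℝ)⁻¹ • ∑ k, whitenedApprox μ X Y (x k))
    rw [Matrix.mul_assoc, toEuclideanLin_mul_apply, toEuclideanLin_mul_apply, ← h1, norm_smul,
      norm_inv, RCLike.norm_natCast] at h2
    refine (pow_le_pow_left₀ (norm_nonneg _) h2 2).trans ?_
    rw [mul_pow, mul_pow]
    refine mul_le_mul_of_nonneg_left ?_ (sq_nonneg K)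
    refine (mul_le_mul_of_nonneg_left happ (by positivity)).trans_eq ?_
    rw [mul_pow, Real.sq_sqrt (by positivity)]
    field_simp
  · rw [matNorm_eq hS, empContribution_eq]
    refine (h.norm_le hS hSu hn hK _).trans ?_
    rw [inner_empMean_eq]
    refine mul_le_mul_of_nonneg_left ?_ hK.le
    rw [← div_eq_inv_mul]
    gcongr
  · have h0 : 0 ≤ matNorm S (ols x y - popCoef μ X Y) := Real.sqrt_nonneg _
    have h1 := pow_le_pow_left₀ h0 hexc 2
    refine h1.trans ?_
    nlinarith [sq_nonneg (matNorm S (empContribution x fun k => approxErr μ X Y (x k)) -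
      matNorm S (empContribution x fun k => noise μ X Y (x k) (y k)))]

end Deterministic

/-! ### Population moments -/

section Population

open Matrix

variable {Ω : Type*} [MeasurableSpace Ω] {d : ℕ} {μ : Measure Ω}
  {X : Ω → EuclideanSpace ℝ (Fin d)} {Y : Ω → ℝ}

theorem integrable_apply_mul_apply (hX2 : MemLp X 2 μ) (i j : Fin d) :
    Integrable (fun ω => X ω i * X ω j) μ := by
  have h : ∀ i, MemLp (fun ω => X ω i) 2 μ := fun i =>
    (EuclideanSpace.proj (𝕜 := ℝ) i).comp_memLp' hX2
  exact (h i).integrable_mul (h j)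

theorem inner_smul_apply_eq_sum (x v : EuclideanSpace ℝ (Fin d)) (i : Fin d) :
    (inner ℝ x v • x) i = ∑ j, x i * x j * v j := by
  simp only [PiLp.smul_apply, smul_eq_mul, PiLp.inner_apply, RCLike.inner_apply, conj_trivial,
    Finset.sum_mul]
  exact Finset.sum_congr rfl fun j _ => by ring

theorem integrable_inner_smul (hX2 : MemLp X 2 μ) (v : EuclideanSpace ℝ (Fin d)) :
    Integrable (fun ω => inner ℝ (X ω) v • X ω) μ := by
  refine Integrable.of_eval_piLp fun i => ?_
  simp only [inner_smul_apply_eq_sum]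
  exact integrable_finsetSum _ fun j _ => (integrable_apply_mul_apply hX2 i j).mul_const _

theorem toEuclideanLin_secondMoment (hX2 : MemLp X 2 μ) (v : EuclideanSpace ℝ (Fin d)) :
    toEuclideanLin (secondMoment μ X) v = ∫ ω, inner ℝ (X ω) v • X ω ∂μ := by
  ext i
  rw [eval_integral_piLp fun i => (integrable_inner_smul hX2 v).eval_piLp i]
  simp only [inner_smul_apply_eq_sum]
  rw [integral_finsetSum _ fun j _ => (integrable_apply_mul_apply hX2 i j).mul_const _]
  simp only [integral_mul_const]
  simp [secondMoment, mulVec, dotProduct]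

theorem integrable_inner_sq (hX2 : MemLp X 2 μ) (v : EuclideanSpace ℝ (Fin d)) :
    Integrable (fun ω => inner ℝ v (X ω) ^ 2) μ :=
  ((innerSL ℝ v).comp_memLp' hX2).integrable_sq

theorem inner_toEuclideanLin_secondMoment (hX2 : MemLp X 2 μ) (v : EuclideanSpace ℝ (Fin d)) :
    inner ℝ v (toEuclideanLin (secondMoment μ X) v) = ∫ ω, inner ℝ v (X ω) ^ 2 ∂μ := by
  rw [toEuclideanLin_secondMoment hX2, ← integral_inner (integrable_inner_smul hX2 v)]
  refine integral_congr_ae (Filter.Eventually.of_forall fun ω => ?_)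
  simp only [real_inner_smul_right, real_inner_comm v]
  ring

theorem posSemidef_secondMoment (hX2 : MemLp X 2 μ) : (secondMoment μ X).PosSemidef := by
  refine PosSemidef.of_dotProduct_mulVec_nonneg ?_ fun v => ?_
  · ext i j
    simp [secondMoment, mul_comm]
  · have h := inner_toEuclideanLin_secondMoment hX2 (WithLp.toLp 2 v)
    rw [EuclideanSpace.inner_eq_star_dotProduct, dotProduct_comm] at h
    have h0 : 0 ≤ ∫ ω, inner ℝ (WithLp.toLp 2 v) (X ω) ^ 2 ∂μ := integral_nonneg fun ω => sq_nonneg _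
    rw [← h] at h0
    simpa using h0

theorem inner_whiten (v x : EuclideanSpace ℝ (Fin d)) (S : Matrix (Fin d) (Fin d) ℝ) :
    inner ℝ v (toEuclideanLin (negHalfPow S) x) = inner ℝ (toEuclideanLin (negHalfPow S) v) x :=
  inner_toEuclideanLin _ (transpose_negHalfPow S) v x

/-- The whitened covariates are isotropic. -/
theorem integral_inner_whiten_sq (hX2 : MemLp X 2 μ) (hS : IsUnit (secondMoment μ X))
    (u : EuclideanSpace ℝ (Fin d)) :
    ∫ ω, inner ℝ u (toEuclideanLin (negHalfPow (secondMoment μ X)) (X ω)) ^ 2 ∂μ = ‖u‖ ^ 2 := by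
  simp only [inner_whiten]
  rw [← inner_toEuclideanLin_secondMoment hX2, ← inner_whiten, ← toEuclideanLin_mul_apply,
    ← toEuclideanLin_mul_apply,
    negHalfPow_mul_mul_negHalfPow (posSemidef_secondMoment hX2) hS, toEuclideanLin_one_apply,
    real_inner_self_eq_norm_sq]

theorem measurable_toEuclideanLin (M : Matrix (Fin d) (Fin d) ℝ) :
    Measurable (toEuclideanLin M) :=
  (toEuclideanLin M).continuous_of_finiteDimensional.measurable

theorem measurable_whiten_fst (S : Matrix (Fin d) (Fin d) ℝ) :
    Measurable fun p : EuclideanSpace ℝ (Fin d) × ℝ => toEuclideanLin (negHalfPow S) p.1 :=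
  (measurable_toEuclideanLin _).comp measurable_fst

theorem integral_inner_whiten_fst_sq (hX : Measurable X) (hY : Measurable Y) (hX2 : MemLp X 2 μ)
    (hS : IsUnit (secondMoment μ X)) (u : EuclideanSpace ℝ (Fin d)) :
    ∫ p, inner ℝ u (toEuclideanLin (negHalfPow (secondMoment μ X)) p.1) ^ 2
      ∂(μ.map fun ω => (X ω, Y ω)) = ‖u‖ ^ 2 := by
  have hw := measurable_whiten_fst (secondMoment μ X)
  rw [integral_map (hX.prodMk hY).aemeasurable (by fun_prop)]
  exact integral_inner_whiten_sq hX2 hS u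

theorem measurable_whitenedApprox [IsFiniteMeasure μ] : Measurable (whitenedApprox μ X Y) := by
  have hr := measurable_regression μ X Y
  refine (measurable_toEuclideanLin _).comp ?_
  unfold approxErr
  fun_prop

/-- The approximation error is uncorrelated with the covariates. -/
theorem integral_approxErr_smul [IsFiniteMeasure μ] (hX : Measurable X) (hX2 : MemLp X 2 μ)
    (hY : Integrable Y μ) (hXY : Integrable (fun ω => Y ω • X ω) μ)
    (hS : IsUnit (secondMoment μ X)) :
    ∫ ω, approxErr μ X Y (X ω) • X ω ∂μ = 0 := by
  have hXm : StronglyMeasurable[MeasurableSpace.comap X inferInstance] X :=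
    (comap_measurable X).stronglyMeasurable
  have h1 : (fun ω => regression μ X Y (X ω) • X ω) =ᵐ[μ]
      μ[fun ω => Y ω • X ω | MeasurableSpace.comap X inferInstance] := by
    refine Filter.EventuallyEq.trans ?_
      (condExp_smul_of_aestronglyMeasurable_right hY hXY hXm.aestronglyMeasurable).symm
    filter_upwards [regression_comp_ae_eq_condExp μ hX hY] with ω h
    simp [h]
  have h2 : Integrable (fun ω => regression μ X Y (X ω) • X ω) μ :=
    integrable_condExp.congr h1.symm
  simp only [approxErr, sub_smul]
  rw [integral_sub h2 (integrable_inner_smul hX2 _), integral_congr_ae h1,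
    integral_condExp hX.comap_le, ← toEuclideanLin_secondMoment hX2, popCoef,
    ← toEuclideanLin_mul_apply, mul_nonsing_inv _ ((isUnit_iff_isUnit_det _).1 hS),
    toEuclideanLin_one_apply, sub_self]

theorem integral_whitenedApprox [IsFiniteMeasure μ] (hX : Measurable X) (hX2 : MemLp X 2 μ)
    (hY : Integrable Y μ) (hXY : Integrable (fun ω => Y ω • X ω) μ)
    (hS : IsUnit (secondMoment μ X)) {M : ℝ} (hM : ∀ᵐ ω ∂μ, ‖whitenedApprox μ X Y (X ω)‖ ≤ M) :
    ∫ ω, whitenedApprox μ X Y (X ω) ∂μ = 0 := by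
  have hSp := posSemidef_secondMoment hX2
  have hInt : Integrable (fun ω => whitenedApprox μ X Y (X ω)) μ :=
    Integrable.of_bound (measurable_whitenedApprox.comp hX).aestronglyMeasurable M hM
  have h1 : ∀ ω, approxErr μ X Y (X ω) • X ω =
      toEuclideanCLM (n := Fin d) (𝕜 := ℝ) (halfPow (secondMoment μ X))
        (whitenedApprox μ X Y (X ω)) := fun ω => by
    change _ = toEuclideanLin _ _
    rw [whitenedApprox, ← toEuclideanLin_mul_apply, halfPow_mul_negHalfPow hSp hS,
      toEuclideanLin_one_apply]
  have h2 := integral_approxErr_smul hX hX2 hY hXY hS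
  simp only [h1] at h2
  rw [ContinuousLinearMap.integral_comp_comm _ hInt] at h2
  have h3 := congrArg (toEuclideanLin (negHalfPow (secondMoment μ X))) h2
  change toEuclideanLin _ (toEuclideanLin _ _) = _ at h3
  rwa [← toEuclideanLin_mul_apply, negHalfPow_mul_halfPow hSp hS, toEuclideanLin_one_apply,
    map_zero] at h3

end Population

/-! ### Passing to the sample -/

section Sample

open Matrix

variable {Ω Ω' : Type*} [MeasurableSpace Ω] [MeasurableSpace Ω'] {d n : ℕ}
  {μ : Measure Ω} [IsProbabilityMeasure μ] {P : Measure Ω'} [IsProbabilityMeasure P]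
  {X : Ω → EuclideanSpace ℝ (Fin d)} {Y : Ω → ℝ}
  {Xs : Fin n → Ω' → EuclideanSpace ℝ (Fin d)} {Ys : Fin n → Ω' → ℝ} {σ B δ : ℝ}

theorem exp_neg_log_one_div (hδ0 : 0 < δ) : Real.exp (-Real.log (1 / δ)) = δ := by
  rw [one_div, Real.log_inv, neg_neg, Real.exp_log hδ0]

theorem SubgaussianNoise.measure_hatMatrix_log_le (hX : Measurable X) (hY : Measurable Y)
    (h : SubgaussianNoise μ X Y σ) (hδ0 : 0 < δ) (hδ1 : δ < 1) :
    Measure.pi (fun _ : Fin n => μ.map fun ω => (X ω, Y ω))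
      {z | σ ^ 2 * (d + 2 * √(d * Real.log (1 / δ)) + 2 * Real.log (1 / δ)) <
        (fun k => noise μ X Y (z k).1 (z k).2) ⬝ᵥ hatMatrix (fun i => (z i).1) *ᵥ
          (fun k => noise μ X Y (z k).1 (z k).2)} ≤ ENNReal.ofReal δ := by
  have ht : 0 ≤ Real.log (1 / δ) := Real.log_nonneg (by rw [le_div_iff₀ hδ0]; linarith)
  -- The tail bound needs a positive number of degrees of freedom; without covariates the hat matrix
  -- vanishes.
  rcases Nat.eq_zero_or_pos d with hd | hd
  · subst hd
    refine le_of_eq_of_le (measure_mono_null (t := ∅) (fun z hz => ?_) measure_empty) zero_le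
    have h0 : hatMatrix (fun i => (z i).1) = 0 := by
      ext k l
      simp [hatMatrix]
    rw [Set.mem_ofPred_eq, h0, zero_mulVec, dotProduct_zero] at hz
    exact absurd hz (not_lt.2 (by positivity))
  · simpa only [exp_neg_log_one_div hδ0] using h.measure_hatMatrix_le (n := n) hX hY hd ht

theorem BoundedApprox.measure_norm_sum_le (hX : Measurable X) (hY : Measurable Y)
    (hX2 : MemLp X 2 μ) (hY1 : Integrable Y μ) (hXY : Integrable (fun ω => Y ω • X ω) μ)
    (hS : IsUnit (secondMoment μ X)) (h : BoundedApprox μ X Y B) (hδ0 : 0 < δ) (hδ1 : δ < 1) :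
    Measure.pi (fun _ : Fin n => μ.map fun ω => (X ω, Y ω))
      {z | 4 * (n * ∫ ω, ‖whitenedApprox μ X Y (X ω)‖ ^ 2 ∂μ) * (1 + 8 * Real.log (1 / δ)) +
        3 * (B * √d) ^ 2 * Real.log (1 / δ) ^ 2 < ‖∑ k, whitenedApprox μ X Y (z k).1‖ ^ 2} ≤
      ENNReal.ofReal δ := by
  have ht : 0 ≤ Real.log (1 / δ) := Real.log_nonneg (by rw [le_div_iff₀ hδ0]; linarith)
  have hXYm := (hX.prodMk hY).aemeasurable (μ := μ)
  have : IsProbabilityMeasure (μ.map fun ω => (X ω, Y ω)) :=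
    Measure.isProbabilityMeasure_map hXYm
  have hf : Measurable fun p : EuclideanSpace ℝ (Fin d) × ℝ => whitenedApprox μ X Y p.1 :=
    measurable_whitenedApprox.comp measurable_fst
  have hM : ∀ᵐ p ∂(μ.map fun ω => (X ω, Y ω)), ‖whitenedApprox μ X Y p.1‖ ≤ B * √d := by
    rw [ae_map_iff hXYm (measurableSet_le hf.norm measurable_const)]
    exact h.2
  have h0 : ∫ p, whitenedApprox μ X Y p.1 ∂(μ.map fun ω => (X ω, Y ω)) = 0 := by
    rw [integral_map hXYm hf.aestronglyMeasurable]
    exact integral_whitenedApprox hX hX2 hY1 hXY hS h.2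
  have h1 := measure_norm_sum_sq_le hf (by have := h.1; positivity) hM h0 n ht
  rwa [integral_map hXYm (hf.norm.pow_const 2).aestronglyMeasurable,
    exp_neg_log_one_div hδ0] at h1

/-- A lower bound of probability `1 - δ` for the whitened empirical second moment gives all sample
bounds with probability `1 - 3δ`. -/
theorem one_sub_le_measureReal_sampleBounds (hX : Measurable X) (hY : Measurable Y)
    (hX2 : MemLp X 2 μ) (hY1 : Integrable Y μ) (hXY : Integrable (fun ω => Y ω • X ω) μ)
    (hS : IsUnit (secondMoment μ X)) (hindep : iIndepFun (fun i ω => (Xs i ω, Ys i ω)) P)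
    (hcopy : ∀ i, IdentDistrib (fun ω => (Xs i ω, Ys i ω)) (fun ω => (X ω, Y ω)) P μ)
    (hδ0 : 0 < δ) (hδ1 : δ < 1) (hnoise : SubgaussianNoise μ X Y σ)
    (happrox : BoundedApprox μ X Y B) (hn : 0 < n) {κ : ℝ} (hκ : 0 < κ)
    (hmat : Measure.pi (fun _ : Fin n => μ.map fun ω => (X ω, Y ω))
      {z | ∃ u : EuclideanSpace ℝ (Fin d), ∑ k, inner ℝ u
        (toEuclideanLin (negHalfPow (secondMoment μ X)) (z k).1) ^ 2 < n * (κ * ‖u‖ ^ 2)} ≤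
      ENNReal.ofReal δ) :
    1 - 3 * δ ≤ P.real {ω | SampleBounds μ X Y σ B δ (1 / κ)
      (fun i => Xs i ω) (fun i => Ys i ω)} := by
  have hm : ∀ i, AEMeasurable (fun ω => (Xs i ω, Ys i ω)) P := fun i => (hcopy i).aemeasurable_fst
  have hmap : P.map (fun ω i => (Xs i ω, Ys i ω)) =
      Measure.pi (fun _ : Fin n => μ.map fun ω => (X ω, Y ω)) := by
    rw [(iIndepFun_iff_map_fun_eq_pi_map hm).1 hindep]
    exact congrArg Measure.pi (funext fun i => (hcopy i).map_eq)
  -- A preimage has at most the outer measure of the set under the image law, so the bad sets need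
  -- no measurability.
  have hpull : ∀ s : Set (Fin n → EuclideanSpace ℝ (Fin d) × ℝ),
      Measure.pi (fun _ : Fin n => μ.map fun ω => (X ω, Y ω)) s ≤ ENNReal.ofReal δ →
      P.real ((fun ω i => (Xs i ω, Ys i ω)) ⁻¹' s) ≤ δ := fun s hs => by
    rw [← hmap] at hs
    exact ENNReal.toReal_le_of_le_ofReal hδ0.le
      ((Measure.le_map_apply (aemeasurable_pi_lambda _ hm) s).trans hs)
  have h1 := hpull _ hmat
  have h2 := hpull _ (happrox.measure_norm_sum_le hX hY hX2 hY1 hXY hS hδ0 hδ1)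
  have h3 := hpull _ (hnoise.measure_hatMatrix_log_le hX hY hδ0 hδ1)
  set G := {ω | SampleBounds μ X Y σ B δ (1 / κ) (fun i => Xs i ω) (fun i => Ys i ω)} with hG
  set A₁ := (fun ω i => (Xs i ω, Ys i ω)) ⁻¹' {z : Fin n → EuclideanSpace ℝ (Fin d) × ℝ |
    ∃ u : EuclideanSpace ℝ (Fin d), ∑ k, inner ℝ u
      (toEuclideanLin (negHalfPow (secondMoment μ X)) (z k).1) ^ 2 < n * (κ * ‖u‖ ^ 2)} with hA₁
  set A₂ := (fun ω i => (Xs i ω, Ys i ω)) ⁻¹' {z : Fin n → EuclideanSpace ℝ (Fin d) × ℝ |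
    4 * (n * ∫ ω, ‖whitenedApprox μ X Y (X ω)‖ ^ 2 ∂μ) * (1 + 8 * Real.log (1 / δ)) +
      3 * (B * √d) ^ 2 * Real.log (1 / δ) ^ 2 < ‖∑ k, whitenedApprox μ X Y (z k).1‖ ^ 2} with hA₂
  set A₃ := (fun ω i => (Xs i ω, Ys i ω)) ⁻¹' {z : Fin n → EuclideanSpace ℝ (Fin d) × ℝ |
    σ ^ 2 * (d + 2 * √(d * Real.log (1 / δ)) + 2 * Real.log (1 / δ)) <
      (fun k => noise μ X Y (z k).1 (z k).2) ⬝ᵥ hatMatrix (fun i => (z i).1) *ᵥ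
        (fun k => noise μ X Y (z k).1 (z k).2)} with hA₃
  -- Covering the whole space, instead of taking complements, leaves only subadditivity to use; the
  -- good event need not be measurable either.
  have hcover : Set.univ ⊆ G ∪ (A₁ ∪ (A₂ ∪ A₃)) := fun ω _ => by
    by_contra hω
    simp only [Set.mem_union, not_or] at hω
    obtain ⟨hg, hω₁, hω₂, hω₃⟩ := hω
    refine hg (sampleBounds_of_whitenedLowerBound (posSemidef_secondMoment hX2) hS hn
      (by positivity) (fun u => ?_) (not_lt.1 hω₂) (not_lt.1 hω₃))
    rw [one_div, inv_inv]
    exact not_lt.1 fun hu => hω₁ ⟨u, hu⟩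
  have h4 := measureReal_mono (μ := P) hcover
  have h5 := measureReal_union_le (μ := P) G (A₁ ∪ (A₂ ∪ A₃))
  have h6 := measureReal_union_le (μ := P) A₁ (A₂ ∪ A₃)
  have h7 := measureReal_union_le (μ := P) A₂ A₃
  rw [probReal_univ] at h4
  linarith

theorem SubgaussianProjections.measure_exists_le (hX : Measurable X) (hY : Measurable Y)
    (hX2 : MemLp X 2 μ) (hS : IsUnit (secondMoment μ X)) {ρ : ℝ}
    (h : SubgaussianProjections μ X ρ) (hδ0 : 0 < δ) (hδ1 : δ < 1) (hn : 0 < n) :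
    Measure.pi (fun _ : Fin n => μ.map fun ω => (X ω, Y ω))
      {z | ∃ u : EuclideanSpace ℝ (Fin d), ∑ k, inner ℝ u
        (toEuclideanLin (negHalfPow (secondMoment μ X)) (z k).1) ^ 2 <
          n * ((1 - 10 * ρ / 9 * (√(32 * (d * Real.log 41 + Real.log (2 / δ)) / n)
            + 2 * (d * Real.log 41 + Real.log (2 / δ)) / n)) * ‖u‖ ^ 2)} ≤
      ENNReal.ofReal δ := by
  have hXYm := (hX.prodMk hY).aemeasurable (μ := μ)
  have : IsProbabilityMeasure (μ.map fun ω => (X ω, Y ω)) :=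
    Measure.isProbabilityMeasure_map hXYm
  have hw := measurable_whiten_fst (secondMoment μ X)
  have hL : 0 ≤ d * Real.log 41 + Real.log (2 / δ) := by
    have h1 : 0 ≤ Real.log 41 := Real.log_nonneg (by norm_num)
    have h2 : 0 ≤ Real.log (2 / δ) := Real.log_nonneg (by rw [le_div_iff₀ hδ0]; linarith)
    positivity
  -- The deviation parameter `t = d log 41 + log (2/δ)` is chosen so that `41^d · 2 exp (-t) = δ`:
  -- net size times two tails.
  refine (measure_exists_sum_inner_sq_lt_le_of_subgaussian hw (by linarith [h.1]) (fun u => ?_)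
    (fun u => integral_inner_whiten_fst_sq hX hY hX2 hS u) (fun u => ?_) hn hL).trans_eq ?_
  · rw [integrable_map_measure (by fun_prop) hXYm]
    simp only [Function.comp_def, inner_whiten]
    exact integrable_inner_sq hX2 _
  · rw [lintegral_map (by fun_prop) (hX.prodMk hY), ← ofReal_integral_eq_lintegral_ofReal
      (h.2 u).1 (Filter.Eventually.of_forall fun _ => (Real.exp_pos _).le)]
    exact ENNReal.ofReal_le_ofReal (h.2 u).2
  · rw [finrank_euclideanSpace_fin, neg_add, Real.exp_add, ← mul_neg, Real.exp_nat_mul,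
      Real.exp_neg, Real.exp_neg, Real.exp_log (by norm_num), Real.exp_log (by positivity)]
    congr 1
    have : (41 : ℝ) ^ d ≠ 0 := by positivity
    rw [inv_pow]
    field_simp

theorem BoundedLeverage.measure_exists_le (hX : Measurable X) (hY : Measurable Y)
    (hX2 : MemLp X 2 μ) (hS : IsUnit (secondMoment μ X)) {ρ : ℝ}
    (h : BoundedLeverage μ X ρ) (hδ0 : 0 < δ) (hδ1 : δ < 1) (hn : 0 < n) :
    Measure.pi (fun _ : Fin n => μ.map fun ω => (X ω, Y ω))
      {z | ∃ u : EuclideanSpace ℝ (Fin d), ∑ k, inner ℝ u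
        (toEuclideanLin (negHalfPow (secondMoment μ X)) (z k).1) ^ 2 <
          n * ((1 - √(2 * ρ ^ 2 * d * Real.log (d / δ) / n)) * ‖u‖ ^ 2)} ≤
      ENNReal.ofReal δ := by
  have hn' : (0 : ℝ) < n := by exact_mod_cast hn
  have hρ : 0 < ρ := by linarith [h.1]
  rcases Nat.eq_zero_or_pos d with hd | hd
  · subst hd
    refine le_of_eq_of_le (measure_mono_null (t := ∅) (fun z hz => ?_) measure_empty) zero_le
    obtain ⟨u, hu⟩ := hz
    simp [Subsingleton.elim u 0] at hu
  have hd' : (1 : ℝ) ≤ d := by exact_mod_cast hd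
  have hXYm := (hX.prodMk hY).aemeasurable (μ := μ)
  have : IsProbabilityMeasure (μ.map fun ω => (X ω, Y ω)) :=
    Measure.isProbabilityMeasure_map hXYm
  have hw := measurable_whiten_fst (secondMoment μ X)
  have hlog : 0 ≤ Real.log (d / δ) := Real.log_nonneg (by rw [le_div_iff₀ hδ0]; linarith)
  have hR : ∀ᵐ p ∂(μ.map fun ω => (X ω, Y ω)),
      ‖toEuclideanLin (negHalfPow (secondMoment μ X)) p.1‖ ^ 2 ≤ ρ ^ 2 * d := by
    rw [ae_map_iff hXYm (measurableSet_le (by fun_prop) measurable_const)]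
    filter_upwards [h.2] with ω hω
    rw [div_le_iff₀ (by positivity)] at hω
    refine (pow_le_pow_left₀ (norm_nonneg _) hω 2).trans_eq ?_
    rw [mul_pow, Real.sq_sqrt (by positivity)]
  -- With `R = ρ²d` the chosen `ε` satisfies `nε² / (2R) = log (d/δ)`, so the dimensional factor `d`
  -- is cancelled and `δ` remains.
  refine (measure_exists_sum_inner_sq_lt_le hw (by positivity) hR
    (fun u => integral_inner_whiten_fst_sq hX hY hX2 hS u) n (Real.sqrt_nonneg _)).trans_eq ?_
  rw [finrank_euclideanSpace_fin, Real.sq_sqrt (by positivity)]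
  have h1 : n * (2 * ρ ^ 2 * d * Real.log (d / δ) / n) / (2 * (ρ ^ 2 * d)) =
      Real.log (d / δ) := by
    field_simp
  rw [h1, Real.exp_neg, Real.exp_log (by positivity)]
  congr 1
  field_simp

end Sample

/-! ### The factors `K` -/

section Constants

variable {d n : ℕ} {δ ρ : ℝ}

theorem n₁_pos (hρ : 1 ≤ ρ) (hδ0 : 0 < δ) (hδ1 : δ < 1) : 0 < n₁ ρ d δ := by
  have h1 : 0 ≤ Real.log 41 := Real.log_nonneg (by norm_num)
  have h2 : 0 < Real.log (2 / δ) := Real.log_pos (by rw [lt_div_iff₀ hδ0]; linarith)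
  unfold n₁
  positivity

/-- The threshold `70ρ²L` gives `ρ√(32L/n) ≤ √(32/70) < 0.6763` and, using `ρ ≥ 1`, `2ρL/n ≤ 1/35`;
ten ninths of the sum is below `4/5`. The same bound supplies the positivity of `1/K`. -/
theorem one_fifth_le_of_n₁_lt (hρ : 1 ≤ ρ) (hδ0 : 0 < δ) (hδ1 : δ < 1) (hn : n₁ ρ d δ < n) :
    1 / 5 ≤ 1 - 10 * ρ / 9 * (√(32 * (d * Real.log 41 + Real.log (2 / δ)) / n)
      + 2 * (d * Real.log 41 + Real.log (2 / δ)) / n) := by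
  have hn' : (0 : ℝ) < n := (n₁_pos hρ hδ0 hδ1).trans hn
  have h1 : 0 ≤ Real.log 41 := Real.log_nonneg (by norm_num)
  have h2 : 0 < Real.log (2 / δ) := Real.log_pos (by rw [lt_div_iff₀ hδ0]; linarith)
  unfold n₁ at hn
  have hL : 0 ≤ d * Real.log 41 + Real.log (2 / δ) := by positivity
  set L := d * Real.log 41 + Real.log (2 / δ)
  have hρ0 : 0 < ρ := by linarith
  have h3 : ρ * √(32 * L / n) ≤ 0.6763 := by
    rw [← Real.sqrt_sq hρ0.le, ← Real.sqrt_mul (sq_nonneg _)]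
    refine Real.sqrt_le_iff.2 ⟨by norm_num, ?_⟩
    rw [← mul_div_assoc, div_le_iff₀ hn']
    nlinarith
  have h4 : ρ * (2 * L / n) ≤ 1 / 35 := by
    rw [← mul_div_assoc, div_le_iff₀ hn']
    have : ρ * L ≤ ρ ^ 2 * L := by gcongr; nlinarith
    nlinarith
  nlinarith

theorem n₂_nonneg (hδ0 : 0 < δ) (hδ1 : δ < 1) : 0 ≤ n₂ ρ d δ := by
  unfold n₂
  rcases Nat.eq_zero_or_pos d with hd | hd
  · simp [hd]
  · have hd' : (1 : ℝ) ≤ d := by exact_mod_cast hd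
    have : 0 ≤ Real.log (d / δ) := Real.log_nonneg (by rw [le_div_iff₀ hδ0]; linarith)
    positivity

/-- The threshold makes the radicand at most `1/2`, and `√(1/2) < 4/5`. -/
theorem one_fifth_le_of_n₂_lt (hδ0 : 0 < δ) (hδ1 : δ < 1) (hn : n₂ ρ d δ < n) :
    1 / 5 ≤ 1 - √(2 * ρ ^ 2 * d * Real.log (d / δ) / n) := by
  have hn' : (0 : ℝ) < n := (n₂_nonneg hδ0 hδ1).trans_lt hn
  unfold n₂ at hn
  have h : √(2 * ρ ^ 2 * d * Real.log (d / δ) / n) ≤ 4 / 5 := by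
    refine Real.sqrt_le_iff.2 ⟨by norm_num, ?_⟩
    rw [div_le_iff₀ hn']
    linarith
  linarith

theorem one_div_le_five {κ : ℝ} (h : 1 / 5 ≤ κ) : 1 / κ ≤ 5 := by
  rw [div_le_iff₀ (by linarith)]
  linarith

end Constants

end RandomDesign

/-! ### The two regimes -/

theorem theorem2 {Ω Ω' : Type*} [MeasurableSpace Ω] [MeasurableSpace Ω']
    (μ : Measure Ω) [IsProbabilityMeasure μ] (P : Measure Ω') [IsProbabilityMeasure P]
    {d n : ℕ}
    -- the population pair
    (X : Ω → EuclideanSpace ℝ (Fin d)) (Y : Ω → ℝ)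
    (hX : Measurable X) (hY : Measurable Y)
    (hX2 : MemLp X 2 μ) (hY1 : Integrable Y μ) (hXY : Integrable (fun ω => Y ω • X ω) μ)
    (hS : IsUnit (secondMoment μ X))
    -- the sample: `n` independent copies of the population pair
    (Xs : Fin n → Ω' → EuclideanSpace ℝ (Fin d)) (Ys : Fin n → Ω' → ℝ)
    (hindep : iIndepFun (fun i ω => (Xs i ω, Ys i ω)) P)
    (hcopy : ∀ i, IdentDistrib (fun ω => (Xs i ω, Ys i ω)) (fun ω => (X ω, Y ω)) P μ)
    (σ B δ : ℝ) (hδ0 : 0 < δ) (hδ1 : δ < 1)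
    (hnoise : SubgaussianNoise μ X Y σ) (happrox : BoundedApprox μ X Y B) :
    (∀ ρ₁ : ℝ, SubgaussianProjections μ X ρ₁ → n₁ ρ₁ d δ < n →
      K₁ ρ₁ d δ n ≤ 5 ∧
      1 - 3 * δ ≤ P.real {ω | SampleBounds μ X Y σ B δ (K₁ ρ₁ d δ n)
        (fun i => Xs i ω) (fun i => Ys i ω)}) ∧
    (∀ ρ₂ : ℝ, BoundedLeverage μ X ρ₂ → n₂ ρ₂ d δ < n →
      K₂ ρ₂ d δ n ≤ 5 ∧
      1 - 3 * δ ≤ P.real {ω | SampleBounds μ X Y σ B δ (K₂ ρ₂ d δ n)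
        (fun i => Xs i ω) (fun i => Ys i ω)}) := by
  refine ⟨fun ρ h hn => ?_, fun ρ h hn => ?_⟩
  · have hκ := one_fifth_le_of_n₁_lt h.1 hδ0 hδ1 hn
    have hn0 : 0 < n := by exact_mod_cast (n₁_pos h.1 hδ0 hδ1).trans hn
    exact ⟨one_div_le_five hκ, one_sub_le_measureReal_sampleBounds hX hY hX2 hY1 hXY hS hindep
      hcopy hδ0 hδ1 hnoise happrox hn0 (by linarith)
      (h.measure_exists_le hX hY hX2 hS hδ0 hδ1 hn0)⟩
  · have hκ := one_fifth_le_of_n₂_lt hδ0 hδ1 hn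
    have hn0 : 0 < n := by exact_mod_cast (n₂_nonneg hδ0 hδ1).trans_lt hn
    exact ⟨one_div_le_five hκ, one_sub_le_measureReal_sampleBounds hX hY hX2 hY1 hXY hS hindep
      hcopy hδ0 hδ1 hnoise happrox hn0 (by linarith)
      (h.measure_exists_le hX hY hX2 hS hδ0 hδ1 hn0)⟩
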